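/- Setting. Let $d\ge 1$, let $\Sigma\in\mathbb R^{d\times d}$ be symmetric positive definite with $\|\Sigma\|_{op}<1$, let $\mathbf r(\Sigma)=\operatorname{tr}(\Sigma)/\|\Sigma\|_{op}$, and let $x=\theta+\xi$ with $\theta\in\mathbb R^d$ and $\xi\sim\mathcal N(0,\Sigma)$; $\mathbb P_\theta,\mathbb E_\theta$ refer to this law. Let $\mathcal F u(\zeta)=(2\pi)^{-d/2}\int u(y)e^{-i\zeta\cdot y}dy$, extended to tempered distributions. Let $(\varphi_j)_{j\ge0}$ be Schwartz functions on $\mathbb R^d$ with $\operatorname{supp}\varphi_0\subset\{\|\zeta\|\le2\}$, $\operatorname{supp}\varphi_j\subset\{2^{j-1}\le\|\zeta\|\le2^{j+1}\}$ for $j\ge1$, $\sup_{j,\zeta}2^{j|\alpha|}|D^\alpha\varphi_j(\zeta)|<\infty$ for every multi-index $\alpha$, $\sum_j\varphi_j\equiv1$, and $\varphi_j(-\zeta)=\overline{\varphi_j(\zeta)}$ (for example, $\varphi_j$ real and even). For a tempered distribution $f$ put $f_j=\mathcal F^{-1}\varphi_j\mathcal F f$ and $\|f\|_{B^s_{\infty,1}}=\sum_{j\ge0}2^{js}\|f_j\|_{L^\infty}$;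 $f\in B^s_{\infty,1}(\mathbb R^d)$ means that this is finite. For $s>1$ such an $f$ is a $C^1$ function, and we take $f$ real-valued. Let $$N=\Big\lceil\tfrac12\big(\log_2\tfrac1{\|\Sigma\|_{op}}-\log_2\mathbf r(\Sigma)-2\big)\Big\rceil,\qquad f^N=\sum_{0\le j\le N}f_j$$ (the sum is empty if $N<0$), and define the estimator $$g(x)=\frac1{(2\pi)^{d/2}}\int\mathcal F f^N(\zeta)\,e^{\langle\Sigma\zeta,\zeta\rangle/2}\,e^{i\zeta\cdot x}\,d\zeta ,$$ where the integral is the pairing of the compactly supported distribution $\mathcal F f^N$ with a smooth function. Put $$\sigma_{f,\xi}(\theta)=\langle\Sigma\nabla f(\theta),\nabla f(\theta)\rangle^{1/2},\qquad K(f;\Sigma;\theta)=\frac{\|\Sigma\|_{op}^{1/2}\|f\|_{B^s_{\infty,1}}}{\sigma_{f,\xi}(\theta)},$$ $$\|\nabla^2g\|_{op}=\sup_{x}\sup_{\|v\|=1}|\langle\nabla^2g(x)v,v\rangle|,\qquad R_N(f;\sigma)=\sup_x\|\nabla(f-f^N)(x)\|,$$ $$\mathcal E=\frac{(\|\Sigma\|_{op}\mathbf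 r(\Sigma))^{s/2}}{\|\Sigma\|_{op}^{1/2}}\ \vee\ \|\Sigma\|_{op}^{1/2}\log(\|\Sigma\|_{op}^{-1})\ \vee\ \Big((\|\Sigma\|_{op}\mathbf r(\Sigma))^{1/2}\|\nabla^2g\|_{op}\vee R_N(f;\sigma)\Big)\sqrt{\log(\|\Sigma\|_{op}^{-1})}.$$ Theorem. For all $s>1$, $\tau>0$ and $m>0$ there are constants $C_1^*,C_2^*$, depending only on $s,\tau,m$ (not on $d$, $\Sigma$, $\theta$, $f$ or $(\varphi_j)$), such that for every real-valued $f\in B^s_{\infty,1}(\mathbb R^d)$ with $\|f\|_{B^s_{\infty,1}}\ge m$ and every $\theta$ with $\sigma_{f,\xi}(\theta)>0$ and $K(f;\Sigma;\theta)\le\tau$, $$\sup_{t\in\mathbb R}\Big|\mathbb P_\theta\Big\{\frac{g(x)-f(\theta)}{\sigma_{f,\xi}(\theta)}\le t\Big\}-\mathbb P\{Z\le t\}\Big|\le C_1^*\,\mathcal E,\qquad Z\sim\mathcal N(0,1),$$ and $$\frac{\big(\mathbb E_\theta(g(x)-f(\theta))^2\big)^{1/2}}{\sigma_{f,\xi}(\theta)}\le1+C_2^*\,\mathcal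 E .$$ -/

import Mathlib

open MeasureTheory ProbabilityTheory
open scoped SchwartzMap FourierTransform ContDiff ENNReal NNReal

noncomputable section

namespace GaussianShift

/-- `d`-dimensional Euclidean space. -/
abbrev E (d : ℕ) := EuclideanSpace ℝ (Fin d)

/-! ### Resolutions of unity and Besov spaces -/

/-- A smooth dyadic resolution of unity on `ℝ^d`. The last field says that
`𝓕⁻¹ φ_j 𝓕` maps real functions to real functions; it holds when `φ_j` is real and even. -/
structure DyadicResolution (d : ℕ) where
  φ : ℕ → 𝓢(E d, ℂ)
  supp_zero : tsupport (φ 0) ⊆ {ζ | ‖ζ‖ ≤ 2}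
  supp_succ : ∀ j : ℕ, tsupport (φ (j + 1)) ⊆ {ζ | 2 ^ j ≤ ‖ζ‖ ∧ ‖ζ‖ ≤ 2 ^ (j + 2)}
  deriv_bound : ∀ k : ℕ, ∃ c : ℝ, ∀ (j : ℕ) (ζ : E d),
    2 ^ (j * k) * ‖iteratedFDeriv ℝ k (φ j) ζ‖ ≤ c
  sum_eq_one : ∀ ζ : E d, HasSum (fun j => φ j ζ) 1
  hermitian : ∀ (j : ℕ) (ζ : E d), φ j (-ζ) = starRingEnd ℂ (φ j ζ)

variable {d : ℕ}

lemma DyadicResolution.hasCompactSupport (R : DyadicResolution d) (j : ℕ) :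
    HasCompactSupport (R.φ j) := by
  have key : ∃ r : ℝ, tsupport (R.φ j) ⊆ Metric.closedBall 0 r := by
    cases j with
    | zero => exact ⟨2, fun ζ h => by simpa using R.supp_zero h⟩
    | succ j => exact ⟨2 ^ (j + 2), fun ζ h => by simpa using (R.supp_succ j h).2⟩
  obtain ⟨r, hr⟩ := key
  exact (isCompact_closedBall (0 : E d) r).of_isClosed_subset (isClosed_tsupport _) hr

/-- The Schwartz function `ν ↦ a(2πν) e^{2πi⟨ν,x⟩}`, for a smooth compactly supported `a`. -/
def waveSchwartz (a : E d → ℂ) (ha : ContDiff ℝ ∞ a) (hc : HasCompactSupport a) (x : E d) :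
    𝓢(E d, ℂ) :=
  HasCompactSupport.toSchwartzMap
    (f := fun ν : E d => a ((2 * Real.pi) • ν) *
      Complex.exp (2 * Real.pi * Complex.I * ((inner ℝ ν x : ℝ) : ℂ)))
    (by
      have h : HasCompactSupport (fun ν : E d => a ((2 * Real.pi) • ν)) :=
        hc.comp_smul (by positivity)
      exact h.mul_right)
    (by
      have h1 : ContDiff ℝ ∞ (fun ν : E d => a ((2 * Real.pi) • ν)) :=
        ha.comp (contDiff_const_smul _)
      have h2 : ContDiff ℝ ∞ (fun ν : E d => ((inner ℝ ν x : ℝ) : ℂ)) :=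
        Complex.ofRealCLM.contDiff.comp (contDiff_id.inner ℝ contDiff_const)
      exact h1.mul (contDiff_const.mul h2).cexp)

/-- The function `x ↦ (2π)^{-d/2} ∫ û(ζ) a(ζ) e^{i⟨ζ,x⟩} dζ`, where
`û(ζ) = (2π)^{-d/2} ∫ u(y) e^{-i⟨ζ,y⟩} dy` in the sense of tempered distributions and the outer
integral is the pairing of the distribution `û` with the test function `ζ ↦ a(ζ) e^{i⟨ζ,x⟩}`.
It is written with Mathlib's Fourier transform `𝓕 u (ν) = ∫ u(y) e^{-2πi⟨ν,y⟩} dy` through the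
substitution `ζ = 2πν`. It is the function representing the distribution `𝓕⁻¹ a 𝓕 u`. -/
def synth (u : 𝓢'(E d, ℂ)) (a : E d → ℂ) (ha : ContDiff ℝ ∞ a) (hc : HasCompactSupport a)
    (x : E d) : ℂ :=
  (𝓕 u) (waveSchwartz a ha hc x)

/-- The dyadic block `u_j = 𝓕⁻¹ φ_j 𝓕 u`. -/
def block (R : DyadicResolution d) (u : 𝓢'(E d, ℂ)) (j : ℕ) : E d → ℂ :=
  synth u (R.φ j) ((R.φ j).smooth ⊤) (R.hasCompactSupport j)

/-- The norm of the Besov space `B^s_{∞,1}(ℝ^d)`; the tempered distribution `u` belongs to the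
space when it is finite. -/
def besovNorm (R : DyadicResolution d) (s : ℝ) (u : 𝓢'(E d, ℂ)) : ℝ≥0∞ :=
  ∑' j : ℕ, ENNReal.ofReal ((2 : ℝ) ^ ((j : ℝ) * s)) * eLpNorm (block R u j) ⊤ volume

/-- The tempered distribution `u` is given by the real-valued continuous function `f`. -/
structure IsGivenBy (u : 𝓢'(E d, ℂ)) (f : E d → ℝ) : Prop where
  continuous : Continuous f
  integrable : ∀ ψ : 𝓢(E d, ℂ), Integrable (fun x => ψ x * (f x : ℂ))
  apply_eq : ∀ ψ : 𝓢(E d, ℂ), u ψ = ∫ x, ψ x * (f x : ℂ)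

/-! ### The noise -/

/-- The spectral norm of a matrix. -/
def opNorm (S : Matrix (Fin d) (Fin d) ℝ) : ℝ :=
  ‖Matrix.toEuclideanCLM (𝕜 := ℝ) S‖

/-- The effective rank. -/
def effRank (S : Matrix (Fin d) (Fin d) ℝ) : ℝ := S.trace / opNorm S

/-- The quadratic form `⟨S ζ, ζ⟩`. -/
def quad (S : Matrix (Fin d) (Fin d) ℝ) (ζ : E d) : ℝ :=
  inner ℝ (Matrix.toEuclideanCLM (𝕜 := ℝ) S ζ) ζ

/-! ### The estimator -/

/-- The truncation level `N`. -/
def level (S : Matrix (Fin d) (Fin d) ℝ) : ℤ :=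
  ⌈(Real.logb 2 (1 / opNorm S) - Real.logb 2 (effRank S) - 2) / 2⌉

/-- The set of indices `0 ≤ j ≤ N` (empty when `N < 0`). -/
def indices (S : Matrix (Fin d) (Fin d) ℝ) : Finset ℕ := Finset.range (level S + 1).toNat

/-- The truncation `f^N = ∑_{0 ≤ j ≤ N} f_j`. It is real-valued, so nothing is lost in taking
the real part. -/
def truncation (R : DyadicResolution d) (S : Matrix (Fin d) (Fin d) ℝ) (u : 𝓢'(E d, ℂ))
    (x : E d) : ℝ :=
  (∑ j ∈ indices S, block R u j x).re

/-- The frequency profile `ζ ↦ (∑_{0 ≤ j ≤ N} φ_j(ζ)) e^{⟨Sζ,ζ⟩/2}` of the estimator. -/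
def profile (R : DyadicResolution d) (S : Matrix (Fin d) (Fin d) ℝ) (ζ : E d) : ℂ :=
  (∑ j ∈ indices S, R.φ j ζ) * (Real.exp (quad S ζ / 2) : ℂ)

lemma profile_contDiff (R : DyadicResolution d) (S : Matrix (Fin d) (Fin d) ℝ) :
    ContDiff ℝ ∞ (profile R S) := by
  have h1 : ContDiff ℝ ∞ (fun ζ : E d => ∑ j ∈ indices S, R.φ j ζ) :=
    ContDiff.sum fun j _ => (R.φ j).smooth ⊤
  have h2 : ContDiff ℝ ∞ (fun ζ : E d => quad S ζ) :=
    (ContinuousLinearMap.contDiff _).inner ℝ contDiff_id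
  exact h1.mul (Complex.ofRealCLM.contDiff.comp (h2.div_const 2).exp)

lemma profile_hasCompactSupport (R : DyadicResolution d) (S : Matrix (Fin d) (Fin d) ℝ) :
    HasCompactSupport (profile R S) := by
  have h : HasCompactSupport (fun ζ : E d => ∑ j ∈ indices S, R.φ j ζ) := by
    induction indices S using Finset.induction_on with
    | empty =>
      simp only [Finset.sum_empty]
      exact HasCompactSupport.zero
    | insert j t hj ih =>
      simp only [Finset.sum_insert hj]
      exact (R.hasCompactSupport j).add ih
  exact h.mul_right

/-- The estimator `g(x) = (2π)^{-d/2} ∫ 𝓕f^N(ζ) e^{⟨Sζ,ζ⟩/2} e^{i⟨ζ,x⟩} dζ`, where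
`𝓕f^N = (∑_{0 ≤ j ≤ N} φ_j) 𝓕f` is a compactly supported distribution. It is real-valued, so
nothing is lost in taking the real part. -/
def estimator (R : DyadicResolution d) (S : Matrix (Fin d) (Fin d) ℝ) (u : 𝓢'(E d, ℂ))
    (x : E d) : ℝ :=
  (synth u (profile R S) (profile_contDiff R S) (profile_hasCompactSupport R S) x).re

/-! ### The quantities in the bounds -/

/-- The standard deviation `σ_{f,ξ}(θ) = ⟨S ∇f(θ), ∇f(θ)⟩^{1/2}`. -/
def stdDev (S : Matrix (Fin d) (Fin d) ℝ) (f : E d → ℝ) (θ : E d) : ℝ :=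
  √(quad S (gradient f θ))

/-- `K(f;S;θ) = ‖S‖^{1/2} ‖f‖_{B^s_{∞,1}} / σ_{f,ξ}(θ)`. -/
def KQuantity (R : DyadicResolution d) (s : ℝ) (S : Matrix (Fin d) (Fin d) ℝ)
    (u : 𝓢'(E d, ℂ)) (f : E d → ℝ) (θ : E d) : ℝ :=
  opNorm S ^ (1 / 2 : ℝ) * (besovNorm R s u).toReal / stdDev S f θ

/-- The operator norm `sup_x sup_{‖v‖=1} |⟨∇²g(x) v, v⟩|` of the Hessian. -/
def hessianNorm (g : E d → ℝ) : ℝ≥0∞ :=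
  ⨆ x : E d, ⨆ v ∈ Metric.sphere (0 : E d) 1, ‖iteratedFDeriv ℝ 2 g x ![v, v]‖ₑ

/-- `R_N = sup_x ‖∇(f - f^N)(x)‖`. -/
def remainderNorm (R : DyadicResolution d) (S : Matrix (Fin d) (Fin d) ℝ)
    (u : 𝓢'(E d, ℂ)) (f : E d → ℝ) : ℝ≥0∞ :=
  ⨆ x : E d, ‖gradient (fun y => f y - truncation R S u y) x‖ₑ

/-- The error term: the maximum of `(‖S‖ r(S))^{s/2} / ‖S‖^{1/2}`, `‖S‖^{1/2} log ‖S‖⁻¹` and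
`max ((‖S‖ r(S))^{1/2} ‖∇²g‖, R_N) * (log ‖S‖⁻¹)^{1/2}`. -/
def errorTerm (R : DyadicResolution d) (s : ℝ) (S : Matrix (Fin d) (Fin d) ℝ)
    (u : 𝓢'(E d, ℂ)) (f : E d → ℝ) : ℝ≥0∞ :=
  max (ENNReal.ofReal ((opNorm S * effRank S) ^ (s / 2) / opNorm S ^ (1 / 2 : ℝ)))
    (max (ENNReal.ofReal (opNorm S ^ (1 / 2 : ℝ) * Real.log (opNorm S)⁻¹))
      (max (ENNReal.ofReal ((opNorm S * effRank S) ^ (1 / 2 : ℝ)) * hessianNorm (estimator R S u))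
          (remainderNorm R S u f)
        * ENNReal.ofReal (√(Real.log (opNorm S)⁻¹))))

/-- The Kolmogorov distance `sup_x |P{Y ≤ x} - P{Z ≤ x}|` between the law of a real random
variable `Y` under `P` and the standard normal law. -/
def kolmogorovToNormal {X : Type*} [MeasurableSpace X] (P : Measure X) (Y : X → ℝ) : ℝ≥0∞ :=
  ⨆ x : ℝ, ENNReal.ofReal |P.real {y | Y y ≤ x} - (gaussianReal 0 1).real (Set.Iic x)|

end GaussianShift

end

/-! Write `T = tr Σ = ‖Σ‖ r(Σ)`, `γ = N(0, Σ)`, `σ = σ_{f,ξ}(θ)`, and let `D` be the larger of `√T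
‖∇²g‖` and `R_N`. The characteristic function of `γ` cancels the factor `e^{⟨Σζ,ζ⟩/2}` in the
estimator, so `E g(x + ξ) = f^N(x)` (`integral_estimator_shift`). Hence the bias at `θ` is `f^N(θ) -
f(θ)`, which the Besov norm and the choice of `N` bound by `T^{s/2} ‖f‖_B`, and the mean of `∇g(θ +
ξ)` is `∇f^N(θ)`.

Thus `G(ξ) = g(θ + ξ)` is a function of a Gaussian vector whose gradient is almost the constant
`∇f(θ)`: fluctuations about the mean gradient are controlled by `√T ‖∇²g‖`, and the mean gradient is
within `R_N` of `∇f(θ)`. In `L²(γ)` the distance is at most `3D` (`integral_norm_fderiv_sub_sq_le`).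
If the gradient were constant, `G` would be Gaussian with variance `σ²`. The deviation is measured
by Stein's method: rotating a pair of independent copies gives a covariance formula
(`covariance_approx`) in which `⟨Σ∇G(U), ∇F(cos α U - sin α V)⟩` appears, and replacing both
gradients by the constant one costs `σ² (6κD + 9(κD)²)` with `κ = ‖Σ‖^{1/2}/σ`. With `F` a function
of `G` through a Stein solution this gives normal approximation for every continuous test function
with values in `[0, 1]`, hence for half-lines without a smoothing loss; with `F = G - E G` it gives
the variance.

Two analytic facts make this legitimate. First, `f` is only known to be a continuous function
defining a tempered distribution; `ae_eq_tsum_cv` shows that it is the uniformly convergent sum of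
its dyadic blocks, hence bounded. Second, `g` must be bounded although it comes from inverting the
heat flow. On frequencies below `2/√T` the inversion is done in eight small steps, each at most
doubling the sup norm (`heat_step`); this rests on a Bernstein inequality with a constant free of
dimension (`bernstein_second`), so `|g| ≤ 256 ‖f‖_B`.

Finally `K ≤ τ` and `‖f‖_B ≥ m` give `κ ≤ τ/m`. If `log ‖Σ‖⁻¹ ≥ 1`, then `D ≤ ℰ` and the estimates
above conclude. Otherwise `‖Σ‖ > 1/e`, so `ℰ` is bounded below by a positive constant, and crude
bounds (a Kolmogorov distance at most one, the sup bound on `g`) suffice. -/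

noncomputable section

namespace GaussianShift

variable {d : ℕ}

/-! ### Convolution of a real function with a Schwartz function -/

section Convolution

variable {V : Type} [NormedAddCommGroup V] [NormedSpace ℝ V]

/-- The convolution `x ↦ ∫ f(z) K(x - z) dz`. -/
def cv (f : E d → ℝ) (K : 𝓢(E d, V)) (x : E d) : V := ∫ z, f z • K (x - z)

lemma schwartz_decay (K : 𝓢(E d, V)) (n : ℕ) :
    ∃ C : ℝ, 0 ≤ C ∧ ∀ x, (1 + ‖x‖) ^ n * ‖K x‖ ≤ C := by
  refine ⟨2 ^ n * ((Finset.Iic (n, 0)).sup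
    (fun m => SchwartzMap.seminorm ℝ m.1 m.2) K), by positivity, fun x => ?_⟩
  simpa using SchwartzMap.one_add_le_sup_seminorm_apply (𝕜 := ℝ) (m := (n, 0)) (k := n) (n := 0)
    le_rfl le_rfl K x

/-- Uniformity over a unit ball of base points supplies the dominating function for differentiating
a convolution under the integral. -/
lemma schwartz_local_decay (K : 𝓢(E d, V)) :
    ∃ C : ℝ, 0 ≤ C ∧ ∀ x x' z : E d, ‖x' - x‖ ≤ 1 →
      ‖K (x' - z)‖ ≤ C * (1 + ‖x - z‖) ^ (-(d + 1 : ℝ)) := by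
  obtain ⟨C, hC0, hC⟩ := schwartz_decay K (d + 1)
  refine ⟨2 ^ (d + 1) * C, by positivity, fun x x' z h => ?_⟩
  have h1 : 1 + ‖x - z‖ ≤ 2 * (1 + ‖x' - z‖) := by
    have : ‖x - z‖ ≤ ‖x' - z‖ + ‖x' - x‖ := by
      have := norm_sub_le (x' - z) (x' - x)
      simpa using this
    linarith [norm_nonneg (x' - z)]
  have h2 : (1 + ‖x - z‖) ^ (d + 1) ≤ 2 ^ (d + 1) * (1 + ‖x' - z‖) ^ (d + 1) := by
    rw [← mul_pow]; gcongr
  have h3 := hC (x' - z)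
  have e : (1 + ‖x - z‖) ^ (-(d + 1 : ℝ)) = ((1 + ‖x - z‖) ^ (d + 1))⁻¹ := by
    rw [Real.rpow_neg (by positivity)]; congr 1
    exact_mod_cast Real.rpow_natCast (1 + ‖x - z‖) (d + 1)
  rw [e, ← div_eq_mul_inv, le_div_iff₀ (by positivity)]
  calc ‖K (x' - z)‖ * (1 + ‖x - z‖) ^ (d + 1)
      ≤ ‖K (x' - z)‖ * (2 ^ (d + 1) * (1 + ‖x' - z‖) ^ (d + 1)) := by gcongr
    _ = 2 ^ (d + 1) * ((1 + ‖x' - z‖) ^ (d + 1) * ‖K (x' - z)‖) := by ring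
    _ ≤ 2 ^ (d + 1) * C := by gcongr

lemma integrable_decay (x : E d) :
    Integrable (fun z : E d => (1 + ‖x - z‖) ^ (-(d + 1 : ℝ))) := by
  have := integrable_one_add_norm (E := E d) (μ := volume) (r := d + 1) (by simp)
  exact this.comp_sub_left x

lemma cv_integrable {f : E d → ℝ} (hf : Measurable f) {C : ℝ} (hC : ∀ x, |f x| ≤ C)
    (K : 𝓢(E d, V)) (x : E d) : Integrable (fun z => f z • K (x - z)) := by
  have := (K.integrable (μ := volume)).comp_sub_left x
  exact this.bdd_smul C hf.aestronglyMeasurable (Filter.Eventually.of_forall hC)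

lemma cv_norm_le {f : E d → ℝ} {C : ℝ} (hC : ∀ x, |f x| ≤ C)
    (K : 𝓢(E d, V)) (x : E d) : ‖cv f K x‖ ≤ C * ∫ z, ‖K z‖ := by
  have h := (K.integrable (μ := volume)).norm
  calc ‖cv f K x‖ ≤ ∫ z, C * ‖K (x - z)‖ := by
        refine norm_integral_le_of_norm_le ((h.comp_sub_left x).const_mul C)
          (Filter.Eventually.of_forall fun z => ?_)
        rw [norm_smul]
        exact mul_le_mul_of_nonneg_right (hC z) (norm_nonneg _)
    _ = C * ∫ z, ‖K z‖ := by
        rw [integral_const_mul, integral_sub_left_eq_self (fun z => ‖K z‖) volume x]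

lemma cv_hasFDerivAt {f : E d → ℝ} (hf : Measurable f) {C : ℝ} (hC : ∀ x, |f x| ≤ C)
    (K : 𝓢(E d, V)) (x : E d) :
    HasFDerivAt (cv f K) (cv f (SchwartzMap.fderivCLM ℝ (E d) V K) x) x := by
  obtain ⟨B, hB0, hB⟩ := schwartz_local_decay (SchwartzMap.fderivCLM ℝ (E d) V K)
  have hC0 : 0 ≤ C := (abs_nonneg _).trans (hC 0)
  refine hasFDerivAt_integral_of_dominated_of_fderiv_le
    (F := fun x z => f z • K (x - z))
    (F' := fun x z => f z • SchwartzMap.fderivCLM ℝ (E d) V K (x - z))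
    (bound := fun z => C * (B * (1 + ‖x - z‖) ^ (-(d + 1 : ℝ))))
    (Metric.closedBall_mem_nhds x one_pos)
    (Filter.Eventually.of_forall fun y => (cv_integrable hf hC K y).aestronglyMeasurable)
    (cv_integrable hf hC K x) (cv_integrable hf hC _ x).aestronglyMeasurable
    (Filter.Eventually.of_forall fun z y hy => ?_)
    (((integrable_decay x).const_mul B).const_mul C)
    (Filter.Eventually.of_forall fun z y _ => ?_)
  · rw [norm_smul]
    exact mul_le_mul (hC z) (hB x y z (by simpa [dist_eq_norm] using hy)) (norm_nonneg _) hC0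
  · have h1 := (K.hasFDerivAt (y - z)).comp y ((hasFDerivAt_id y).sub_const z)
    exact (h1.const_smul (f z)).congr_fderiv (by ext; simp)

lemma cv_fderiv {f : E d → ℝ} (hf : Measurable f) {C : ℝ} (hC : ∀ x, |f x| ≤ C)
    (K : 𝓢(E d, V)) : fderiv ℝ (cv f K) = cv f (SchwartzMap.fderivCLM ℝ (E d) V K) := by
  ext1 x; exact (cv_hasFDerivAt hf hC K x).fderiv

/-- The induction runs over all codomains at once, because differentiating the kernel replaces `V`
by linear maps into `V`. -/
lemma cv_contDiff_nat {f : E d → ℝ} (hf : Measurable f) {C : ℝ} (hC : ∀ x, |f x| ≤ C) (n : ℕ) :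
    ∀ {V : Type} [NormedAddCommGroup V] [NormedSpace ℝ V] (K : 𝓢(E d, V)),
      ContDiff ℝ n (cv f K) := by
  induction n with
  | zero =>
    intro V _ _ K
    simp only [Nat.cast_zero]
    exact contDiff_zero.2 (continuous_iff_continuousAt.2 fun x =>
      (cv_hasFDerivAt hf hC K x).continuousAt)
  | succ n ih =>
    intro V _ _ K
    rw [Nat.cast_add, Nat.cast_one, contDiff_succ_iff_fderiv]
    refine ⟨fun x => (cv_hasFDerivAt hf hC K x).differentiableAt, by simp, ?_⟩
    rw [cv_fderiv hf hC]
    exact ih _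

lemma cv_contDiff {f : E d → ℝ} (hf : Measurable f) {C : ℝ} (hC : ∀ x, |f x| ≤ C)
    (K : 𝓢(E d, V)) : ContDiff ℝ ∞ (cv f K) :=
  contDiff_infty.2 fun n => cv_contDiff_nat hf hC n K

lemma cv_decay {f : E d → ℝ}
    (hdec : ∀ k : ℕ, ∃ C : ℝ, ∀ x, ‖x‖ ^ k * |f x| ≤ C) (K : 𝓢(E d, V)) (k : ℕ) :
    ∃ C : ℝ, ∀ x, ‖x‖ ^ k * ‖cv f K x‖ ≤ C := by
  obtain ⟨A, hA⟩ := hdec 0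
  obtain ⟨B, hB⟩ := hdec k
  simp only [pow_zero, one_mul] at hA
  have i0 := (K.integrable (μ := volume)).norm
  have ik := K.integrable_pow_mul volume k
  refine ⟨∫ z, 2 ^ k * (B * ‖K z‖ + A * (‖z‖ ^ k * ‖K z‖)), fun x => ?_⟩
  have hi : Integrable (fun z => 2 ^ k * (B * ‖K z‖ + A * (‖z‖ ^ k * ‖K z‖))) volume :=
    ((i0.const_mul B).add (ik.const_mul A)).const_mul _
  rw [← integral_sub_left_eq_self (fun z => 2 ^ k * (B * ‖K z‖ + A * (‖z‖ ^ k * ‖K z‖))) volume x]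
  calc ‖x‖ ^ k * ‖cv f K x‖ = ‖∫ z, ‖x‖ ^ k • (f z • K (x - z))‖ := by
        rw [integral_smul, norm_smul, norm_pow, norm_norm, cv]
    _ ≤ _ := by
        refine norm_integral_le_of_norm_le (hi.comp_sub_left x)
          (Filter.Eventually.of_forall fun z => ?_)
        rw [norm_smul, norm_smul, norm_pow, norm_norm, Real.norm_eq_abs]
        have h1 : ‖x‖ ^ k ≤ 2 ^ k * (‖z‖ ^ k + ‖x - z‖ ^ k) := by
          have hx : ‖x‖ ≤ ‖z‖ + ‖x - z‖ := by
            simpa using norm_add_le z (x - z)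
          calc ‖x‖ ^ k ≤ (‖z‖ + ‖x - z‖) ^ k := by gcongr
            _ ≤ 2 ^ (k - 1) * (‖z‖ ^ k + ‖x - z‖ ^ k) :=
              add_pow_le (norm_nonneg _) (norm_nonneg _) k
            _ ≤ _ := by gcongr <;> [norm_num; omega]
        calc ‖x‖ ^ k * (|f z| * ‖K (x - z)‖)
            ≤ 2 ^ k * (‖z‖ ^ k + ‖x - z‖ ^ k) * (|f z| * ‖K (x - z)‖) := by gcongr
          _ = 2 ^ k * ((‖z‖ ^ k * |f z|) * ‖K (x - z)‖
                + |f z| * (‖x - z‖ ^ k * ‖K (x - z)‖)) := by ring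
          _ ≤ _ := by
            gcongr
            · exact hB z
            · exact hA z

lemma cv_iteratedFDeriv_decay {f : E d → ℝ} (hf : Measurable f)
    (hdec : ∀ k : ℕ, ∃ C : ℝ, ∀ x, ‖x‖ ^ k * |f x| ≤ C) (k n : ℕ) :
    ∀ {V : Type} [NormedAddCommGroup V] [NormedSpace ℝ V] (K : 𝓢(E d, V)),
      ∃ C : ℝ, ∀ x, ‖x‖ ^ k * ‖iteratedFDeriv ℝ n (cv f K) x‖ ≤ C := by
  induction n with
  | zero =>
    intro V _ _ K
    simpa using cv_decay hdec K k
  | succ n ih =>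
    intro V _ _ K
    obtain ⟨A, hA⟩ := hdec 0
    simp only [pow_zero, one_mul] at hA
    simp_rw [← norm_iteratedFDeriv_fderiv, cv_fderiv hf hA]
    exact ih _

/-- The convolution of a rapidly decaying function with a Schwartz function. -/
def cvSchwartz (f : E d → ℝ) (hf : Measurable f)
    (hdec : ∀ k : ℕ, ∃ C : ℝ, ∀ x, ‖x‖ ^ k * |f x| ≤ C) (K : 𝓢(E d, V)) : 𝓢(E d, V) where
  toFun := cv f K
  smooth' := by
    obtain ⟨A, hA⟩ := hdec 0
    simp only [pow_zero, one_mul] at hA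
    exact cv_contDiff hf hA K
  decay' k n := cv_iteratedFDeriv_decay hf hdec k n K

end Convolution

/-! ### Schwartz majorants of rapidly decaying functions -/

/-- The radial envelope `t ↦ sup_{‖x‖ ≥ t} |q x|`. -/
def envelope (q : E d → ℝ) (t : ℝ) : ℝ := ⨆ x : {x : E d // t ≤ ‖x‖}, |q x|

lemma envelope_nonneg (q : E d → ℝ) (t : ℝ) : 0 ≤ envelope q t :=
  Real.iSup_nonneg fun _ => abs_nonneg _

lemma le_envelope {q : E d → ℝ} {C : ℝ} (hC : ∀ x, |q x| ≤ C) {t : ℝ} {x : E d} (h : t ≤ ‖x‖) :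
    |q x| ≤ envelope q t :=
  le_ciSup (f := fun x : {x : E d // t ≤ ‖x‖} => |q x|)
    ⟨C, by rintro _ ⟨x, rfl⟩; exact hC x⟩ ⟨x, h⟩

lemma envelope_le {q : E d → ℝ} {t C : ℝ} (hC0 : 0 ≤ C) (h : ∀ x, t ≤ ‖x‖ → |q x| ≤ C) :
    envelope q t ≤ C :=
  Real.iSup_le (fun x => h x x.2) hC0

lemma envelope_antitone {q : E d → ℝ} {C : ℝ} (hC : ∀ x, |q x| ≤ C) : Antitone (envelope q) :=
  fun _ _ hst => envelope_le (envelope_nonneg _ _) fun _ hx => le_envelope hC (hst.trans hx)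

lemma envelope_decay {q : E d → ℝ} (hdec : ∀ k : ℕ, ∃ C : ℝ, ∀ x, ‖x‖ ^ k * |q x| ≤ C) (k : ℕ) :
    ∃ C : ℝ, ∀ x : E d, ‖x‖ ^ k * |envelope q (‖x‖ - 1)| ≤ C := by
  obtain ⟨A, hA⟩ := hdec 0
  obtain ⟨B, hB⟩ := hdec k
  simp only [pow_zero, one_mul] at hA
  have hA0 : 0 ≤ A := (abs_nonneg _).trans (hA 0)
  have hB0 : 0 ≤ B := le_trans (by positivity) (hB 0)
  refine ⟨2 ^ k * (B + A), fun x => ?_⟩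
  rw [abs_of_nonneg (envelope_nonneg _ _)]
  have h0 : envelope q (‖x‖ - 1) ≤ A := envelope_le hA0 fun x _ => hA x
  -- Beyond radius 2 the shift by one is harmless, since `‖x‖ ≤ 2(‖x‖ - 1)`; inside it the sup bound
  -- suffices.
  rcases le_or_gt ‖x‖ 2 with hx | hx
  · calc ‖x‖ ^ k * envelope q (‖x‖ - 1) ≤ 2 ^ k * A := by
          gcongr
          exact envelope_nonneg _ _
      _ ≤ _ := by gcongr; linarith
  · have h1 : envelope q (‖x‖ - 1) ≤ B / (‖x‖ - 1) ^ k := by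
      refine envelope_le (div_nonneg hB0 (pow_nonneg (by linarith) _)) fun y hy => ?_
      rw [le_div_iff₀ (pow_pos (by linarith) _), mul_comm]
      refine le_trans ?_ (hB y)
      gcongr
      linarith
    have h2 : ‖x‖ ^ k ≤ 2 ^ k * (‖x‖ - 1) ^ k := by
      rw [← mul_pow]; gcongr; linarith
    have hp : 0 < (‖x‖ - 1) ^ k := pow_pos (by linarith) _
    calc ‖x‖ ^ k * envelope q (‖x‖ - 1) ≤ (2 ^ k * (‖x‖ - 1) ^ k) * (B / (‖x‖ - 1) ^ k) := by
          gcongr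
          exact envelope_nonneg _ _
      _ = 2 ^ k * B := by field_simp
      _ ≤ _ := by gcongr; linarith

/-- A smooth bump function as a Schwartz function. -/
def bumpSchwartz (b : ContDiffBump (0 : E d)) : 𝓢(E d, ℂ) :=
  HasCompactSupport.toSchwartzMap (f := fun x => ((b.normed volume x : ℝ) : ℂ))
    (b.hasCompactSupport_normed.comp_left (g := fun t : ℝ => (t : ℂ)) (by simp))
    (Complex.ofRealCLM.contDiff.comp b.contDiff_normed)

/-- Mollify the decreasing radial envelope of `q`, moved outward by one, with a bump supported in
the unit ball: every value averaged at `x` is already at least `|q x|`. This converts rapid decay of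
a nonsmooth function into a bound by a Schwartz function, the only functions against which `f` is
known to be integrable. -/
lemma exists_schwartz_majorant (q : E d → ℝ)
    (hdec : ∀ k : ℕ, ∃ C : ℝ, ∀ x, ‖x‖ ^ k * |q x| ≤ C) :
    ∃ Ψ : 𝓢(E d, ℂ), ∀ x, |q x| ≤ ‖Ψ x‖ := by
  obtain ⟨A, hA⟩ := hdec 0
  simp only [pow_zero, one_mul] at hA
  let b : ContDiffBump (0 : E d) := ⟨1 / 2, 1, by norm_num, by norm_num⟩
  have hm : Measurable fun x : E d => envelope q (‖x‖ - 1) :=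
    (envelope_antitone hA).measurable.comp (measurable_norm.sub_const 1)
  refine ⟨cvSchwartz _ hm (envelope_decay hdec) (bumpSchwartz b), fun x => ?_⟩
  change _ ≤ ‖∫ z, envelope q (‖z‖ - 1) • ((b.normed volume (x - z) : ℝ) : ℂ)‖
  have e : (fun z => envelope q (‖z‖ - 1) • ((b.normed volume (x - z) : ℝ) : ℂ)) =
      fun z => ((envelope q (‖z‖ - 1) * b.normed volume (x - z) : ℝ) : ℂ) := by
    ext z; simp
  rw [e, integral_complex_ofReal, Complex.norm_real]
  refine le_trans ?_ (le_abs_self _)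
  have hb : Integrable (fun z => b.normed volume (x - z)) :=
    (b.integrable_normed (μ := volume)).comp_sub_left x
  have h1 : |q x| = ∫ z, |q x| * b.normed volume (x - z) := by
    rw [integral_const_mul, integral_sub_left_eq_self (fun z => b.normed volume z) volume x,
      b.integral_normed, mul_one]
  rw [h1]
  refine integral_mono (hb.const_mul _) ?_ fun z => ?_
  · refine hb.bdd_mul (c := A) hm.aestronglyMeasurable (Filter.Eventually.of_forall fun z => ?_)
    rw [Real.norm_eq_abs, abs_of_nonneg (envelope_nonneg _ _)]
    exact envelope_le ((abs_nonneg _).trans (hA 0)) fun x _ => hA x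
  · by_cases hz : ‖x - z‖ < 1
    · refine mul_le_mul_of_nonneg_right (le_envelope hA ?_) (b.nonneg_normed _)
      have : ‖z‖ ≤ ‖x‖ + ‖x - z‖ := by simpa using norm_sub_le x (x - z)
      linarith
    · have : b.normed volume (x - z) = 0 := by
        have hs := b.support_normed_eq (μ := volume)
        by_contra h
        have : x - z ∈ Function.support (b.normed volume) := h
        rw [hs] at this
        exact hz (by simpa [b] using this)
      simp [this]

/-! ### Fourier transforms of Schwartz functions and of integrable functions -/

lemma fourier_translate (K : 𝓢(E d, ℂ)) (z ν : E d) :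
    (𝓕 (SchwartzMap.compSubConstCLM ℂ z K)) ν =
      Complex.exp (((-2 * Real.pi * inner ℝ z ν : ℝ) : ℂ) * Complex.I) * (𝓕 K) ν := by
  rw [SchwartzMap.fourier_coe, SchwartzMap.fourier_coe, Real.fourier_eq', Real.fourier_eq',
    ← integral_const_mul, ← integral_add_right_eq_self _ z]
  congr 1
  ext v
  simp only [SchwartzMap.compSubConstCLM_apply, smul_eq_mul, inner_add_left, add_sub_cancel_right]
  rw [← mul_assoc, ← Complex.exp_add]
  congr 2
  push_cast
  ring

lemma integral_fourier_mul_eq_of_integrable {f g : E d → ℂ} (hf : Integrable f)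
    (hg : Integrable g) : ∫ x, 𝓕 f x * g x = ∫ x, f x * 𝓕 g x := by
  have h := VectorFourier.integral_fourierIntegral_smul_eq_flip (μ := volume) (ν := volume)
    (L := innerₗ (E d)) (f := f) (g := g) Real.continuous_fourierChar continuous_inner hf hg
  simp only [flip_innerₗ, smul_eq_mul] at h
  exact h

/-- Every test function is the Fourier transform of a Schwartz function, so moving the transform
across the pairing shows that `G` annihilates all of them. -/
lemma ae_eq_zero_of_fourier_eq_zero {G : E d → ℂ} (hG : Integrable G) (h : ∀ ξ, 𝓕 G ξ = 0) :
    ∀ᵐ x, G x = 0 := by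
  refine ae_eq_zero_of_integral_contDiff_smul_eq_zero hG.locallyIntegrable fun g hg hc => ?_
  let η : 𝓢(E d, ℂ) := HasCompactSupport.toSchwartzMap (f := fun x => ((g x : ℝ) : ℂ))
    (hc.comp_left (g := fun t : ℝ => (t : ℂ)) (by simp)) (Complex.ofRealCLM.contDiff.comp hg)
  have h1 := integral_fourier_mul_eq_of_integrable ((𝓕⁻ η : 𝓢(E d, ℂ)).integrable (μ := volume)) hG
  have h2 : 𝓕 ((𝓕⁻ η : 𝓢(E d, ℂ)) : E d → ℂ) = η := by
    rw [← SchwartzMap.fourier_coe, FourierTransform.fourier_fourierInv_eq]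
  simp only [h2, h, mul_zero, integral_zero] at h1
  rw [← h1]
  congr 1

/-- A probability density concentrated near the origin has Fourier transform close to 1 on a
prescribed ball. -/
lemma exists_fourier_ne_zero (R : ℝ) :
    ∃ ρ : 𝓢(E d, ℂ), HasCompactSupport ρ ∧ ∀ x : E d, ‖x‖ ≤ R → (𝓕 ρ) x ≠ 0 := by
  -- With this radius the phase `2π⟨v, x⟩` is at most `1/2` for `‖v‖ < ε` and `‖x‖ ≤ R`.
  have hε : (0 : ℝ) < 1 / (4 * Real.pi * (|R| + 1)) := by positivity
  set ε := 1 / (4 * Real.pi * (|R| + 1)) with hεdef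
  let b : ContDiffBump (0 : E d) := ⟨ε / 2, ε, by positivity, by linarith⟩
  refine ⟨bumpSchwartz b,
    b.hasCompactSupport_normed.comp_left (g := fun t : ℝ => (t : ℂ)) (by simp), fun x hx => ?_⟩
  have key : ‖(𝓕 (bumpSchwartz b)) x - 1‖ ≤ 1 / 2 := by
    have h1 : (1 : ℂ) = ∫ v, bumpSchwartz b v := by
      change _ = ∫ v, ((b.normed volume v : ℝ) : ℂ)
      rw [integral_complex_ofReal, b.integral_normed]; simp
    have hi := (bumpSchwartz b).integrable (μ := volume)
    have hi2 := (Real.fourierIntegral_convergent_iff x).2 hi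
    rw [SchwartzMap.fourier_coe, Real.fourier_eq, h1, ← integral_sub hi2 hi]
    have h2 : (1 / 2 : ℝ) = ∫ v, b.normed volume v * (1 / 2) := by
      rw [integral_mul_const, b.integral_normed, one_mul]
    rw [h2]
    refine norm_integral_le_of_norm_le (b.integrable_normed.mul_const _)
      (Filter.Eventually.of_forall fun v => ?_)
    have h3 : bumpSchwartz b v = ((b.normed volume v : ℝ) : ℂ) := rfl
    rw [h3, Circle.smul_def, smul_eq_mul, ← sub_one_mul, norm_mul, Complex.norm_real,
      Real.norm_of_nonneg (b.nonneg_normed v), mul_comm]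
    by_cases hv : ‖v‖ < ε
    · refine mul_le_mul_of_nonneg_left ?_ (b.nonneg_normed v)
      rw [Real.fourierChar_apply, mul_comm]
      refine Real.norm_exp_I_mul_ofReal_sub_one_le.trans ?_
      rw [Real.norm_eq_abs, abs_mul, abs_neg]
      have hin : |inner ℝ v x| ≤ ε * (|R| + 1) :=
        (abs_real_inner_le_norm v x).trans (mul_le_mul hv.le
          (hx.trans ((le_abs_self R).trans (by linarith))) (norm_nonneg _) hε.le)
      calc |2 * Real.pi| * |inner ℝ v x| ≤ (2 * Real.pi) * (ε * (|R| + 1)) := by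
            rw [abs_of_pos Real.two_pi_pos]; gcongr
        _ = 1 / 2 := by
            rw [hεdef]; have := Real.pi_pos; have : (0:ℝ) < |R| + 1 := by positivity
            field_simp; norm_num
    · have : b.normed volume v = 0 := by
        have hs := b.support_normed_eq (μ := volume)
        by_contra h
        have : v ∈ Function.support (b.normed volume) := h
        rw [hs] at this
        exact hv (by simpa [b] using this)
      simp [this]
  intro h0
  rw [h0] at key
  norm_num at key

/-! ### The convolution with a function of slow growth -/

lemma integral_norm_mul_decay (ψ K : 𝓢(E d, ℂ)) (k : ℕ) :
    ∃ C : ℝ, ∀ z, ‖z‖ ^ k * |∫ x, ‖ψ x‖ * ‖K (x - z)‖| ≤ C := by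
  obtain ⟨A, hA0, hA⟩ := schwartz_decay ψ 0
  obtain ⟨B, hB0, hB⟩ := schwartz_decay ψ k
  simp only [pow_zero, one_mul] at hA
  have i0 := (K.integrable (μ := volume)).norm
  have ik := K.integrable_pow_mul volume k
  refine ⟨∫ x, 2 ^ k * (B * ‖K x‖ + A * (‖x‖ ^ k * ‖K x‖)), fun z => ?_⟩
  have hi : Integrable (fun x => 2 ^ k * (B * ‖K x‖ + A * (‖x‖ ^ k * ‖K x‖))) volume :=
    ((i0.const_mul B).add (ik.const_mul A)).const_mul _
  rw [abs_of_nonneg (integral_nonneg fun x => by positivity), ← integral_const_mul,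
    ← integral_sub_right_eq_self (fun z => 2 ^ k * (B * ‖K z‖ + A * (‖z‖ ^ k * ‖K z‖))) z]
  refine integral_mono_of_nonneg (Filter.Eventually.of_forall fun x => by positivity)
    (hi.comp_sub_right z) (Filter.Eventually.of_forall fun x => ?_)
  have h1 : ‖z‖ ^ k ≤ 2 ^ k * ((1 + ‖x‖) ^ k + ‖x - z‖ ^ k) := by
    have hx : ‖z‖ ≤ (1 + ‖x‖) + ‖x - z‖ := by
      have : ‖z‖ ≤ ‖x‖ + ‖x - z‖ := by simpa using norm_sub_le x (x - z)
      linarith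
    calc ‖z‖ ^ k ≤ ((1 + ‖x‖) + ‖x - z‖) ^ k := by gcongr
      _ ≤ 2 ^ (k - 1) * ((1 + ‖x‖) ^ k + ‖x - z‖ ^ k) :=
        add_pow_le (by positivity) (norm_nonneg _) k
      _ ≤ _ := by gcongr <;> [norm_num; omega]
  beta_reduce
  calc ‖z‖ ^ k * (‖ψ x‖ * ‖K (x - z)‖)
      ≤ 2 ^ k * ((1 + ‖x‖) ^ k + ‖x - z‖ ^ k) * (‖ψ x‖ * ‖K (x - z)‖) := by gcongr
    _ = 2 ^ k * (((1 + ‖x‖) ^ k * ‖ψ x‖) * ‖K (x - z)‖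
          + ‖ψ x‖ * (‖x - z‖ ^ k * ‖K (x - z)‖)) := by ring
    _ ≤ _ := by
      gcongr
      · exact hB x
      · exact hA x

lemma cv_stronglyMeasurable {f : E d → ℝ} (hf : Continuous f) (K : 𝓢(E d, ℂ)) :
    StronglyMeasurable (cv f K) := by
  have : Continuous fun p : E d × E d => f p.2 • K (p.1 - p.2) :=
    (hf.comp continuous_snd).smul (K.continuous.comp (continuous_fst.sub continuous_snd))
  exact this.stronglyMeasurable.integral_prod_right

section SlowGrowth

variable {f : E d → ℝ} (hf : Continuous f)
  (hint : ∀ ψ : 𝓢(E d, ℂ), Integrable (fun x => ψ x * (f x : ℂ)))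

include hf hint in
-- Integrating first in `x` leaves a rapidly decaying weight in `z`; a Schwartz majorant of this
-- weight is integrable against `f`. This is Fubini without any boundedness of `f`.
lemma integrable_prod_cv (ψ K : 𝓢(E d, ℂ)) :
    Integrable (fun p : E d × E d => ψ p.1 * (f p.2 • K (p.1 - p.2)))
      ((volume : Measure (E d)).prod volume) := by
  have hc : Continuous (fun p : E d × E d => ψ p.1 * (f p.2 • K (p.1 - p.2))) :=
    (ψ.continuous.comp continuous_fst).mul
      ((hf.comp continuous_snd).smul (K.continuous.comp (continuous_fst.sub continuous_snd)))
  have hslice : ∀ z, Integrable fun x => ψ x * K (x - z) := fun z => by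
    obtain ⟨A, -, hA⟩ := schwartz_decay ψ 0
    simp only [pow_zero, one_mul] at hA
    exact ((K.integrable (μ := volume)).comp_sub_right z).bdd_mul
      ψ.continuous.aestronglyMeasurable (Filter.Eventually.of_forall hA)
  rw [integrable_prod_iff' hc.aestronglyMeasurable]
  refine ⟨Filter.Eventually.of_forall fun z => ?_, ?_⟩
  · refine ((hslice z).const_mul (f z : ℂ)).congr (Filter.Eventually.of_forall fun x => ?_)
    simp only [Complex.real_smul]
    ring
  · obtain ⟨Ψ, hΨ⟩ := exists_schwartz_majorant _ (integral_norm_mul_decay ψ K)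
    refine (hint Ψ).mono hc.norm.stronglyMeasurable.integral_prod_left'.aestronglyMeasurable
      (Filter.Eventually.of_forall fun z => ?_)
    have e : (∫ x, ‖ψ x * (f z • K (x - z))‖) = |f z| * ∫ x, ‖ψ x‖ * ‖K (x - z)‖ := by
      rw [← integral_const_mul]
      congr 1
      ext x
      rw [norm_mul, norm_smul, Real.norm_eq_abs]
      ring
    dsimp only
    rw [e, norm_mul, norm_mul, Complex.norm_real, mul_comm, Real.norm_eq_abs, Real.norm_eq_abs,
      Real.norm_eq_abs, abs_abs]
    exact mul_le_mul_of_nonneg_right (hΨ z) (abs_nonneg _)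

include hf hint in
lemma integrable_mul_cv (ψ K : 𝓢(E d, ℂ)) : Integrable (fun x => ψ x * cv f K x) := by
  have := (integrable_prod_cv hf hint ψ K).integral_prod_left
  simpa only [integral_const_mul, cv] using this

include hf hint in
-- Convolution with `𝓕⁻ A` is the Fourier multiplier `A`, here in its weak form so that it makes
-- sense for `f` of slow growth.
lemma integral_mul_cv (ρ A : 𝓢(E d, ℂ)) :
    ∫ x, (𝓕 ρ) x * cv f (𝓕⁻ A) x =
      ∫ z, (𝓕 (SchwartzMap.pairing (ContinuousLinearMap.mul ℂ ℂ) A ρ)) z * (f z : ℂ) := by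
  have h := integral_integral_swap
    (f := fun x z => (𝓕 ρ) x * f z • (𝓕⁻ A) (x - z)) (integrable_prod_cv hf hint (𝓕 ρ) (𝓕⁻ A))
  simp only [integral_const_mul] at h
  change ∫ x, (𝓕 ρ) x * ∫ z, _ = _
  rw [h]
  congr 1
  ext z
  have h1 := SchwartzMap.integral_fourier_mul_eq (SchwartzMap.compSubConstCLM ℂ z (𝓕⁻ A)) ρ
  simp only [fourier_translate, FourierTransform.fourier_fourierInv_eq,
    SchwartzMap.compSubConstCLM_apply] at h1
  have h2 : ∀ x, (𝓕 ρ) x * f z • (𝓕⁻ A) (x - z) = (f z : ℂ) * ((𝓕⁻ A) (x - z) * (𝓕 ρ) x) :=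
    fun x => by rw [Complex.real_smul]; ring
  simp only [h2, integral_const_mul]
  rw [← h1, SchwartzMap.fourier_coe, Real.fourier_eq', mul_comm]
  congr 2
  ext ν
  simp [real_inner_comm]
  ring

include hf hint in
-- Against `𝓕 ρ` with `ρ` of compact support only finitely many symbols matter, and they sum to one
-- on the support of `ρ`; so `f` and the sum of its blocks have the same pairings. Translating `ρ`
-- upgrades this to equality almost everywhere, which also rules out a polynomial discrepancy.
lemma ae_eq_tsum_cv (A : ℕ → 𝓢(E d, ℂ)) {M : ℕ → ℝ} (hM : Summable M)
    (hb : ∀ j, ∀ᵐ x, ‖cv f (𝓕⁻ (A j)) x‖ ≤ M j)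
    (hA : ∀ ρ : 𝓢(E d, ℂ), HasCompactSupport ρ → ∃ J : ℕ,
      (∀ ν, ∑ j ∈ Finset.range J, A j ν * ρ ν = ρ ν) ∧ ∀ j ≥ J, ∀ ν, A j ν * ρ ν = 0) :
    ∀ᵐ x, (f x : ℂ) = ∑' j, cv f (𝓕⁻ (A j)) x := by
  have hb' : ∀ᵐ x, ∀ j, ‖cv f (𝓕⁻ (A j)) x‖ ≤ M j := ae_all_iff.2 hb
  set F : E d → ℂ := fun x => ∑' j, cv f (𝓕⁻ (A j)) x with hF
  have hFm : AEStronglyMeasurable F := by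
    refine aestronglyMeasurable_of_tendsto_ae Filter.atTop
      (f := fun n x => ∑ j ∈ Finset.range n, cv f (𝓕⁻ (A j)) x) (fun n => ?_) ?_
    · exact (Finset.stronglyMeasurable_fun_sum _
        fun j _ => cv_stronglyMeasurable hf _).aestronglyMeasurable
    · filter_upwards [hb'] with x hx
      exact (Summable.of_norm_bounded hM hx).hasSum.tendsto_sum_nat
  have hFb : ∀ᵐ x, ‖F x‖ ≤ ∑' j, M j := by
    filter_upwards [hb'] with x hx
    exact tsum_of_norm_bounded hM.hasSum hx
  have hint2 : ∀ ψ : 𝓢(E d, ℂ), Integrable (fun x => ψ x * F x) := fun ψ =>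
    (ψ.integrable (μ := volume)).mul_bdd hFm hFb
  have hzero : ∀ ρ : 𝓢(E d, ℂ), HasCompactSupport ρ →
      ∫ x, (𝓕 ρ) x * ((f x : ℂ) - F x) = 0 := fun ρ hρ => by
    simp only [mul_sub]
    rw [integral_sub (hint _) (hint2 _), sub_eq_zero]
    obtain ⟨J, hJ1, hJ2⟩ := hA ρ hρ
    have hs := hasSum_integral_of_summable_integral_norm
      (F := fun j x => (𝓕 ρ) x * cv f (𝓕⁻ (A j)) x) (μ := volume)
      (fun j => integrable_mul_cv hf hint _ _) (by
        refine Summable.of_nonneg_of_le (fun j => integral_nonneg fun x => norm_nonneg _)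
          (fun j => ?_) (hM.mul_left (∫ x, ‖(𝓕 ρ) x‖))
        rw [← integral_mul_const]
        refine integral_mono_ae (integrable_mul_cv hf hint _ _).norm
          (((𝓕 ρ : 𝓢(E d, ℂ)).integrable (μ := volume)).norm.mul_const _) ?_
        filter_upwards [hb j] with x hx
        rw [norm_mul]
        gcongr)
    simp only [tsum_mul_left, integral_mul_cv hf hint] at hs
    have hP : ∀ j ≥ J, SchwartzMap.pairing (ContinuousLinearMap.mul ℂ ℂ) (A j) ρ = 0 :=
      fun j hj => by ext ν; simpa using hJ2 j hj ν
    have hs2 := hasSum_sum_of_ne_finset_zero (L := SummationFilter.unconditional ℕ) (s := Finset.range J)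
      (f := fun j => ∫ z, (𝓕 (SchwartzMap.pairing (ContinuousLinearMap.mul ℂ ℂ) (A j) ρ)) z *
        (f z : ℂ)) (fun j hj => by
          have h0 : 𝓕 (0 : 𝓢(E d, ℂ)) = 0 := map_zero (SchwartzMap.fourierTransformCLM ℂ)
          rw [hP j (by simpa using hj), h0]
          simp)
    rw [hs.unique hs2, ← integral_finsetSum _ fun j _ => hint _]
    congr 1
    ext z
    rw [← Finset.sum_mul]
    congr 1
    have : ρ = ∑ j ∈ Finset.range J,
        SchwartzMap.pairing (ContinuousLinearMap.mul ℂ ℂ) (A j) ρ := by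
      ext ν; simpa using (hJ1 ν).symm
    have h2 := congrArg (fun η => (SchwartzMap.fourierTransformCLM ℂ η) z) this
    simp only [map_sum, sum_apply] at h2
    exact h2
  -- Translating `ρ` by `ξ` modulates `𝓕 ρ`, so the vanishing pairings are all the values of the
  -- Fourier transform of the integrable function `𝓕 ρ · (f - F)`.
  have hG : ∀ ρ : 𝓢(E d, ℂ), HasCompactSupport ρ → ∀ᵐ x, (𝓕 ρ) x * ((f x : ℂ) - F x) = 0 :=
    fun ρ hρ => by
      refine ae_eq_zero_of_fourier_eq_zero ?_ fun ξ => ?_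
      · simp only [mul_sub]
        exact (hint _).sub (hint2 _)
      · have h1 : HasCompactSupport (SchwartzMap.compSubConstCLM ℂ ξ ρ) :=
          hρ.comp_homeomorph (Homeomorph.subRight ξ)
        rw [Real.fourier_eq', ← hzero _ h1]
        congr 1
        ext x
        rw [fourier_translate, real_inner_comm, smul_eq_mul]
        ring
  -- Divide by `𝓕 ρ` on balls exhausting the space.
  have hR : ∀ n : ℕ, ∀ᵐ x : E d, ‖x‖ ≤ n → (f x : ℂ) = F x := fun n => by
    obtain ⟨ρ, hρ, hne⟩ := exists_fourier_ne_zero (d := d) n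
    filter_upwards [hG ρ hρ] with x hx hxn
    exact sub_eq_zero.1 ((mul_eq_zero.1 hx).resolve_left (hne x hxn))
  filter_upwards [ae_all_iff.2 hR] with x hx
  obtain ⟨n, hn⟩ := exists_nat_ge ‖x‖
  exact hx n hn

end SlowGrowth

/-! ### Dyadic blocks of a function -/

lemma waveSchwartz_apply (a : E d → ℂ) (ha : ContDiff ℝ ∞ a) (hc : HasCompactSupport a)
    (x ν : E d) : waveSchwartz a ha hc x ν = a ((2 * Real.pi) • ν) *
      Complex.exp (2 * Real.pi * Complex.I * ((inner ℝ ν x : ℝ) : ℂ)) := rfl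

/-- The Schwartz function `ν ↦ a(2πν)`. -/
def symbol (a : E d → ℂ) (ha : ContDiff ℝ ∞ a) (hc : HasCompactSupport a) : 𝓢(E d, ℂ) :=
  waveSchwartz a ha hc 0

lemma symbol_apply (a : E d → ℂ) (ha : ContDiff ℝ ∞ a) (hc : HasCompactSupport a) (ν : E d) :
    symbol a ha hc ν = a ((2 * Real.pi) • ν) := by
  simp [symbol, waveSchwartz_apply]

lemma synth_eq_cv {u : 𝓢'(E d, ℂ)} {f : E d → ℝ} (hu : IsGivenBy u f) (a : E d → ℂ)
    (ha : ContDiff ℝ ∞ a) (hc : HasCompactSupport a) :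
    synth u a ha hc = cv f (𝓕⁻ (symbol a ha hc)) := by
  ext x
  rw [synth, TemperedDistribution.fourier_apply, hu.apply_eq, cv]
  congr 1
  ext z
  rw [Complex.real_smul, mul_comm]
  congr 1
  rw [SchwartzMap.fourier_coe, SchwartzMap.fourierInv_coe, Real.fourier_eq', Real.fourierInv_eq']
  congr 1
  ext v
  rw [waveSchwartz_apply, symbol_apply, smul_eq_mul, smul_eq_mul, mul_left_comm,
    ← Complex.exp_add, mul_comm]
  congr 2
  rw [inner_sub_right]
  push_cast
  ring

lemma forall_norm_le_of_ae {F : Type*} [NormedAddCommGroup F] {g : E d → F} (hg : Continuous g)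
    {C : ℝ} (h : ∀ᵐ x, ‖g x‖ ≤ C) (x : E d) : ‖g x‖ ≤ C := by
  have ho : IsOpen {x | C < ‖g x‖} := isOpen_lt continuous_const hg.norm
  have h0 : (volume : Measure (E d)) {x | C < ‖g x‖} = 0 := by
    rw [ae_iff] at h
    simpa using h
  rw [ho.measure_eq_zero_iff volume] at h0
  by_contra hx
  have : x ∈ {x | C < ‖g x‖} := not_le.1 hx
  rw [h0] at this
  exact this

/-! ### Finite overlap and supports of the resolution. -/

namespace DyadicResolution

variable (R : DyadicResolution d)

lemma apply_eq_zero {j : ℕ} {ζ : E d} (h : 2 * ‖ζ‖ < 2 ^ j) (hj : j ≠ 0) : R.φ j ζ = 0 := by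
  obtain ⟨k, rfl⟩ := Nat.exists_eq_succ_of_ne_zero hj
  by_contra h0
  have := (R.supp_succ k (subset_tsupport _ h0)).1
  rw [Nat.succ_eq_add_one, pow_succ] at h
  linarith

lemma norm_le_of_ne_zero {j : ℕ} {ζ : E d} (h : R.φ j ζ ≠ 0) : ‖ζ‖ ≤ 2 ^ (j + 1) := by
  cases j with
  | zero => simpa using R.supp_zero (subset_tsupport _ h)
  | succ j => exact (R.supp_succ j (subset_tsupport _ h)).2

lemma sum_range_eq_one {J : ℕ} {ζ : E d} (h : 2 * ‖ζ‖ < 2 ^ J) (hJ : J ≠ 0) :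
    ∑ j ∈ Finset.range J, R.φ j ζ = 1 := by
  refine (hasSum_sum_of_ne_finset_zero (L := SummationFilter.unconditional ℕ)
    (fun j hj => ?_)).unique (R.sum_eq_one ζ)
  have hj' : J ≤ j := by simpa using hj
  exact R.apply_eq_zero (h.trans_le (by gcongr; norm_num)) (by omega)

/-- The Schwartz function `ν ↦ φ_j(2πν)`. -/
def sym (j : ℕ) : 𝓢(E d, ℂ) := symbol (R.φ j) ((R.φ j).smooth ⊤) (R.hasCompactSupport j)

lemma sym_apply (j : ℕ) (ν : E d) : R.sym j ν = R.φ j ((2 * Real.pi) • ν) := symbol_apply _ _ _ _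

lemma exists_sum_sym_mul (ρ : 𝓢(E d, ℂ)) (hρ : HasCompactSupport ρ) :
    ∃ J : ℕ, (∀ ν, ∑ j ∈ Finset.range J, R.sym j ν * ρ ν = ρ ν) ∧
      ∀ j ≥ J, ∀ ν, R.sym j ν * ρ ν = 0 := by
  obtain ⟨r, hr⟩ := hρ.isBounded.subset_closedBall (0 : E d)
  obtain ⟨J, hJ⟩ := pow_unbounded_of_one_lt (2 * (2 * Real.pi * r)) (one_lt_two (α := ℝ))
  have hlt : ∀ j ≥ J, ∀ ν, ρ ν ≠ 0 → 2 * ‖(2 * Real.pi) • ν‖ < 2 ^ (j + 1) := fun j hj ν hν => by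
    have h1 : ‖ν‖ ≤ r := by simpa using hr (subset_tsupport _ hν)
    rw [norm_smul, Real.norm_of_nonneg Real.two_pi_pos.le]
    have h2 : (2 : ℝ) ^ J ≤ 2 ^ (j + 1) := by gcongr <;> [norm_num; omega]
    have : 2 * Real.pi * ‖ν‖ ≤ 2 * Real.pi * r := by have := Real.two_pi_pos; gcongr
    linarith
  refine ⟨J + 1, fun ν => ?_, fun j hj ν => ?_⟩
  · by_cases h : ρ ν = 0
    · simp [h]
    · simp only [← Finset.sum_mul, sym_apply]
      rw [R.sum_range_eq_one (hlt J le_rfl ν h) (by omega), one_mul]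
  · by_cases h : ρ ν = 0
    · simp [h]
    · obtain ⟨k, rfl⟩ : ∃ k, j = k + 1 := ⟨j - 1, by omega⟩
      rw [sym_apply, R.apply_eq_zero (hlt k (by omega) ν h) (by omega), zero_mul]

end DyadicResolution

lemma block_eq_cv (R : DyadicResolution d) {u : 𝓢'(E d, ℂ)} {f : E d → ℝ} (hu : IsGivenBy u f)
    (j : ℕ) : block R u j = cv f (𝓕⁻ (R.sym j)) := synth_eq_cv hu _ _ _

lemma exists_block_bounds (R : DyadicResolution d) {s : ℝ} {u : 𝓢'(E d, ℂ)}
    (hb : besovNorm R s u < ⊤) :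
    ∃ M : ℕ → ℝ, (∀ j, 0 ≤ M j) ∧ (∀ j, ∀ᵐ x, ‖block R u j x‖ ≤ M j) ∧
      HasSum (fun j : ℕ => (2 : ℝ) ^ ((j : ℝ) * s) * M j) (besovNorm R s u).toReal := by
  have hfin : ∀ j : ℕ, ENNReal.ofReal ((2 : ℝ) ^ ((j : ℝ) * s)) *
      eLpNorm (block R u j) ⊤ volume ≠ ⊤ := fun j =>
    ((ENNReal.le_tsum j).trans_lt hb).ne
  have hfin' : ∀ j, eLpNorm (block R u j) ⊤ volume ≠ ⊤ := fun j h => by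
    apply hfin j
    rw [h, ENNReal.mul_top]
    simp only [ne_eq, ENNReal.ofReal_eq_zero, not_le]
    positivity
  refine ⟨fun j => (eLpNorm (block R u j) ⊤ volume).toReal, fun j => ENNReal.toReal_nonneg,
    fun j => ?_, ?_⟩
  · filter_upwards [ae_le_eLpNormEssSup (f := block R u j) (μ := volume)] with x hx
    rw [← eLpNorm_exponent_top] at hx
    have := ENNReal.toReal_mono (hfin' j) hx
    simpa using this
  · have h := ENNReal.hasSum_toReal hb.ne
    rw [← ENNReal.tsum_toReal_eq hfin] at h
    simpa [besovNorm, ENNReal.toReal_mul, ENNReal.toReal_ofReal, Real.rpow_nonneg] using h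

/-! ### Sup bounds for `f`, its partial sums and its tails. -/

section Representation

variable {R : DyadicResolution d} {s : ℝ} {u : 𝓢'(E d, ℂ)} {f : E d → ℝ}

/-- The partial sum `∑_{j < n} f_j`. -/
def partialSum (R : DyadicResolution d) (u : 𝓢'(E d, ℂ)) (n : ℕ) (x : E d) : ℂ :=
  ∑ j ∈ Finset.range n, block R u j x

/-- The Besov norm dominates the sum of the sup norms of the blocks, and the weights `2^{js}` make
the tail from `n` on gain `2^{-ns}`. All bounds first hold almost everywhere and extend by
continuity. -/
lemma partialSum_bounds (hu : IsGivenBy u f) (hs : 0 ≤ s) (hb : besovNorm R s u < ⊤) :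
    (∀ x, |f x| ≤ (besovNorm R s u).toReal) ∧
    (∀ n x, ‖partialSum R u n x‖ ≤ (besovNorm R s u).toReal) ∧
    (∀ n x, ‖(f x : ℂ) - partialSum R u n x‖ ≤
      (2 : ℝ) ^ (-((n : ℝ) * s)) * (besovNorm R s u).toReal) := by
  obtain ⟨M, hM0, hMb, hMs⟩ := exists_block_bounds R hb
  set B := (besovNorm R s u).toReal
  have hone : ∀ j : ℕ, (1 : ℝ) ≤ 2 ^ ((j : ℝ) * s) := fun j =>
    Real.one_le_rpow one_le_two (by positivity)
  have hle : ∀ j, M j ≤ (2 : ℝ) ^ ((j : ℝ) * s) * M j := fun j =>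
    le_mul_of_one_le_left (hM0 j) (hone j)
  have hMsum : Summable M := Summable.of_nonneg_of_le hM0 hle hMs.summable
  have hMB : ∑' j, M j ≤ B := by
    rw [← hMs.tsum_eq]
    exact hMsum.tsum_le_tsum hle hMs.summable
  have hae := ae_eq_tsum_cv hu.continuous hu.integrable R.sym hMsum
    (fun j => by rw [← block_eq_cv R hu j]; exact hMb j) R.exists_sum_sym_mul
  simp only [← block_eq_cv R hu] at hae
  have hMb' : ∀ᵐ x, ∀ j, ‖block R u j x‖ ≤ M j := ae_all_iff.2 hMb
  have hfB : ∀ x, |f x| ≤ B := by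
    refine forall_norm_le_of_ae hu.continuous ?_
    filter_upwards [hae, hMb'] with x hx hx2
    have := tsum_of_norm_bounded hMsum.hasSum hx2
    rw [← hx, Complex.norm_real] at this
    exact this.trans hMB
  -- Continuity of the blocks is available only now, once `f` is known to be bounded.
  have hcont : ∀ j, Continuous (block R u j) := fun j => by
    rw [block_eq_cv R hu]
    exact (cv_contDiff hu.continuous.measurable hfB _).continuous
  have hpc : ∀ n, Continuous (partialSum R u n) := fun n =>
    continuous_finsetSum _ fun j _ => hcont j
  refine ⟨hfB, fun n => forall_norm_le_of_ae (hpc n) ?_, fun n => forall_norm_le_of_ae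
    ((Complex.continuous_ofReal.comp hu.continuous).sub (hpc n)) ?_⟩
  · filter_upwards [hMb'] with x hx
    refine (norm_sum_le _ _).trans ((Finset.sum_le_sum fun j _ => hx j).trans ?_)
    exact (hMsum.sum_le_tsum _ fun j _ => hM0 j).trans hMB
  · filter_upwards [hae, hMb'] with x hx hx2
    have hsm : Summable fun j => block R u j x := Summable.of_norm_bounded hMsum hx2
    rw [Pi.sub_apply, Function.comp_apply, hx, partialSum, ← hsm.sum_add_tsum_nat_add n, add_sub_cancel_left]
    have hsm2 : Summable fun j => (2 : ℝ) ^ (((j + n : ℕ) : ℝ) * s) * M (j + n) :=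
      (summable_nat_add_iff n).2 hMs.summable
    have h1 : ‖∑' j, block R u (j + n) x‖ ≤
        ∑' j, (2 : ℝ) ^ (-((n : ℝ) * s)) * ((2 : ℝ) ^ (((j + n : ℕ) : ℝ) * s) * M (j + n)) := by
      refine tsum_of_norm_bounded (hsm2.mul_left _).hasSum fun j => (hx2 _).trans ?_
      rw [← mul_assoc, ← Real.rpow_add two_pos]
      refine le_mul_of_one_le_left (hM0 _) (Real.one_le_rpow one_le_two ?_)
      push_cast
      have : (0 : ℝ) ≤ j * s := by positivity
      linarith
    refine h1.trans ?_
    rw [tsum_mul_left]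
    refine mul_le_mul_of_nonneg_left ?_ (by positivity)
    rw [← hMs.tsum_eq, ← hMs.summable.sum_add_tsum_nat_add n]
    exact le_add_of_nonneg_left (Finset.sum_nonneg fun j _ => mul_nonneg (by positivity) (hM0 j))

end Representation

/-! ### Bernstein's inequality -/

/-- The Fourier series of `t²` on `[-r, r]`, obtained from that of the second Bernoulli polynomial
at `t/(2r) + 1/2`. -/
lemma hasSum_sq_cos {r t : ℝ} (hr : 0 < r) (ht : |t| ≤ r) :
    HasSum (fun n : ℕ => ((if n = 0 then r ^ 2 / 3 else 0) +
      4 * r ^ 2 / Real.pi ^ 2 * ((-1) ^ n * (1 / (n : ℝ) ^ 2))) * Real.cos (n * (Real.pi / r * t)))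
      (t ^ 2) := by
  have hx : t / (2 * r) + 1 / 2 ∈ Set.Icc (0 : ℝ) 1 := by
    have := abs_le.1 ht
    constructor
    · have : -(1 / 2) ≤ t / (2 * r) := by rw [le_div_iff₀ (by positivity)]; linarith
      linarith
    · have : t / (2 * r) ≤ 1 / 2 := by rw [div_le_iff₀ (by positivity)]; linarith
      linarith
  have h := hasSum_one_div_nat_pow_mul_cos one_ne_zero hx
  have hB : (Polynomial.map (algebraMap ℚ ℝ) (Polynomial.bernoulli (2 * 1))).eval
      (t / (2 * r) + 1 / 2) = t ^ 2 / (4 * r ^ 2) - 1 / 12 := by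
    rw [mul_one]
    simp [Polynomial.bernoulli, Finset.sum_range_succ, bernoulli_two, bernoulli_one]
    field_simp
    ring
  rw [hB] at h
  have h1 := (h.mul_left (4 * r ^ 2 / Real.pi ^ 2)).add
    (hasSum_ite_eq (0 : ℕ) (r ^ 2 / 3))
  -- In the Bernoulli series the term at `0` vanishes because `1 / 0 = 0`; the mean `r²/3` is put in
  -- its place.
  convert! h1 using 1
  · ext n
    have e : 2 * Real.pi * n * (t / (2 * r) + 1 / 2) = n * (Real.pi / r * t) + n * Real.pi := by
      field_simp
    rw [e, Real.cos_add_nat_mul_pi]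
    by_cases hn : n = 0
    · subst hn; simp
    · simp [hn]; ring
  · have := Real.pi_pos
    norm_num [Nat.factorial]
    field_simp
    ring

/-- The coefficients of `t²` have absolute sum `r²/3 + (4r²/π²)(π²/6) = r²`, the value of the series
at `t = r`. This is why the Bernstein constant is exactly `r²`. -/
lemma summable_abs_sq_cos_coeff (r : ℝ) :
    HasSum (fun n : ℕ => (if n = 0 then r ^ 2 / 3 else 0) +
      4 * r ^ 2 / Real.pi ^ 2 * (1 / (n : ℝ) ^ 2)) (r ^ 2) := by
  have h1 := (hasSum_zeta_two.mul_left (4 * r ^ 2 / Real.pi ^ 2)).add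
    (hasSum_ite_eq (0 : ℕ) (r ^ 2 / 3))
  convert! h1 using 1
  · ext n; ring
  · have := Real.pi_pos
    field_simp
    ring

lemma fourierInv_apply_integral (A : 𝓢(E d, ℂ)) (w : E d) :
    (𝓕⁻ A) w = ∫ ν, Complex.exp (((2 * Real.pi * inner ℝ ν w : ℝ) : ℂ) * Complex.I) * A ν := by
  rw [SchwartzMap.fourierInv_coe, Real.fourierInv_eq']
  rfl

lemma norm_cexp_mul_schwartz (A : 𝓢(E d, ℂ)) (t : ℝ) (ν : E d) :
    ‖Complex.exp ((t : ℂ) * Complex.I) * A ν‖ = ‖A ν‖ := by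
  rw [norm_mul, Complex.norm_exp_ofReal_mul_I, one_mul]

lemma integrable_cexp_mul (A : 𝓢(E d, ℂ)) (w : E d) : Integrable
    fun ν => Complex.exp (((2 * Real.pi * inner ℝ ν w : ℝ) : ℂ) * Complex.I) * A ν := by
  refine (A.integrable (μ := volume)).mono (Continuous.aestronglyMeasurable (by fun_prop))
    (Filter.Eventually.of_forall fun ν => (norm_cexp_mul_schwartz A _ ν).le)

/-! ### Multipliers given by absolutely summable cosine series. -/

section Multiplier

variable {A B : 𝓢(E d, ℂ)} {c : ℕ → ℝ} {b : ℕ → ℝ} {T : ℝ} {y : ℕ → E d} {m : E d → ℝ}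

lemma half_sum_translates (A : 𝓢(E d, ℂ)) (w y : E d) :
    (1 / 2 : ℂ) * ((𝓕⁻ A) (w + y) + (𝓕⁻ A) (w - y)) =
      ∫ ν, Complex.exp (((2 * Real.pi * inner ℝ ν w : ℝ) : ℂ) * Complex.I) *
        ((Real.cos (2 * Real.pi * inner ℝ ν y) : ℂ) * A ν) := by
  rw [fourierInv_apply_integral, fourierInv_apply_integral,
    ← integral_add (integrable_cexp_mul _ _) (integrable_cexp_mul _ _), ← integral_const_mul]
  congr 1
  ext ν
  rw [Complex.ofReal_cos, Complex.cos, inner_add_right, inner_sub_right]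
  have e1 : (((2 * Real.pi * (inner ℝ ν w + inner ℝ ν y) : ℝ) : ℂ) * Complex.I) =
    ((2 * Real.pi * inner ℝ ν w : ℝ) : ℂ) * Complex.I +
      ((2 * Real.pi * inner ℝ ν y : ℝ) : ℂ) * Complex.I := by push_cast; ring
  have e2 : (((2 * Real.pi * (inner ℝ ν w - inner ℝ ν y) : ℝ) : ℂ) * Complex.I) =
    ((2 * Real.pi * inner ℝ ν w : ℝ) : ℂ) * Complex.I +
      -((2 * Real.pi * inner ℝ ν y : ℝ) : ℂ) * Complex.I := by push_cast; ring
  rw [e1, e2, Complex.exp_add, Complex.exp_add]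
  ring

lemma hasSum_fourierInv_multiplier (hT : HasSum b T) (hcb : ∀ n, |c n| ≤ b n)
    (hm : ∀ ν, A ν ≠ 0 → HasSum (fun n => c n * Real.cos (2 * Real.pi * inner ℝ ν (y n))) (m ν))
    (hB : ∀ ν, B ν = (m ν : ℂ) * A ν) (w : E d) :
    HasSum (fun n => (c n : ℂ) * ((1 / 2 : ℂ) * ((𝓕⁻ A) (w + y n) + (𝓕⁻ A) (w - y n))))
      ((𝓕⁻ B) w) := by
  have hi : ∀ n, Integrable fun ν => (c n : ℂ) *
      (Complex.exp (((2 * Real.pi * inner ℝ ν w : ℝ) : ℂ) * Complex.I) *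
        ((Real.cos (2 * Real.pi * inner ℝ ν (y n)) : ℂ) * A ν)) := fun n => by
    refine ((A.integrable (μ := volume)).mono (Continuous.aestronglyMeasurable (by fun_prop))
      (Filter.Eventually.of_forall fun ν => ?_)).const_mul _
    rw [norm_mul, norm_mul, Complex.norm_exp_ofReal_mul_I, one_mul, Complex.norm_real]
    exact mul_le_of_le_one_left (norm_nonneg _) (Real.abs_cos_le_one _)
  have h := hasSum_integral_of_summable_integral_norm hi (by
    refine Summable.of_nonneg_of_le (fun n => integral_nonneg fun ν => norm_nonneg _)
      (fun n => ?_) (hT.summable.mul_right (∫ ν, ‖A ν‖))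
    rw [← integral_const_mul]
    refine integral_mono (hi n).norm (A.integrable.norm.const_mul _) fun ν => ?_
    beta_reduce
    rw [norm_mul, norm_mul, norm_mul, Complex.norm_exp_ofReal_mul_I, one_mul, Complex.norm_real,
      Complex.norm_real]
    gcongr
    · exact (abs_nonneg _).trans (hcb n)
    · exact hcb n
    · exact mul_le_of_le_one_left (norm_nonneg _) (Real.abs_cos_le_one _))
  simp only [integral_const_mul, ← half_sum_translates] at h
  convert! h using 1
  rw [fourierInv_apply_integral]
  congr 1
  ext ν
  rw [hB]
  by_cases hA : A ν = 0
  · simp [hA]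
  · have h2 := (Complex.hasSum_ofReal.2 (hm ν hA)).mul_left
      (Complex.exp (((2 * Real.pi * inner ℝ ν w : ℝ) : ℂ) * Complex.I) * A ν)
    rw [show Complex.exp (((2 * Real.pi * inner ℝ ν w : ℝ) : ℂ) * Complex.I) * ((m ν : ℂ) * A ν) =
      Complex.exp (((2 * Real.pi * inner ℝ ν w : ℝ) : ℂ) * Complex.I) * A ν * (m ν : ℂ) by ring,
      ← h2.tsum_eq]
    congr 1
    ext n
    push_cast
    ring

/-- The multiplier `cos(2π⟨ν, y⟩)` averages the translates by `y` and `-y`, hence does not increase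
the sup norm; an absolutely summable combination costs only the sum of its coefficients. The series
need represent `m` only where `A` is nonzero. -/
lemma cv_multiplier_le {f : E d → ℝ} (hf : Measurable f) {C : ℝ} (hC : ∀ x, |f x| ≤ C)
    (hT : HasSum b T) (hcb : ∀ n, |c n| ≤ b n)
    (hm : ∀ ν, A ν ≠ 0 → HasSum (fun n => c n * Real.cos (2 * Real.pi * inner ℝ ν (y n))) (m ν))
    (hB : ∀ ν, B ν = (m ν : ℂ) * A ν) {H : ℝ} (hH : ∀ x, ‖cv f (𝓕⁻ A) x‖ ≤ H) (x : E d) :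
    ‖cv f (𝓕⁻ B) x‖ ≤ T * H := by
  have hC0 : 0 ≤ C := (abs_nonneg _).trans (hC 0)
  have hi0 : ∀ n, Integrable (fun z => f z • (𝓕⁻ A) (x + y n - z)) ∧
      Integrable (fun z => f z • (𝓕⁻ A) (x - y n - z)) := fun n =>
    ⟨cv_integrable hf hC _ _, cv_integrable hf hC _ _⟩
  have e0 : ∀ n z, f z • ((c n : ℂ) * ((1 / 2 : ℂ) *
      ((𝓕⁻ A) (x - z + y n) + (𝓕⁻ A) (x - z - y n)))) =
      (c n : ℂ) * ((1 / 2 : ℂ) * (f z • (𝓕⁻ A) (x + y n - z) + f z • (𝓕⁻ A) (x - y n - z))) :=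
    fun n z => by
      rw [show x - z + y n = x + y n - z by abel, show x - z - y n = x - y n - z by abel]
      simp only [Complex.real_smul]
      ring
  have hi : ∀ n, Integrable fun z => f z • ((c n : ℂ) * ((1 / 2 : ℂ) *
      ((𝓕⁻ A) (x - z + y n) + (𝓕⁻ A) (x - z - y n)))) := fun n => by
    simp only [e0]
    exact (((hi0 n).1.add (hi0 n).2).const_mul _).const_mul _
  have hn := (𝓕⁻ A : 𝓢(E d, ℂ)).integrable (μ := volume) |>.norm
  have h := hasSum_integral_of_summable_integral_norm hi (by
    refine Summable.of_nonneg_of_le (fun n => integral_nonneg fun ν => norm_nonneg _)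
      (fun n => ?_) (hT.summable.mul_right (C * ∫ z, ‖(𝓕⁻ A) z‖))
    have i1 := (hn.comp_sub_left (x + y n)).const_mul C
    have i2 := (hn.comp_sub_left (x - y n)).const_mul C
    have hle : ∀ z, ‖f z • ((c n : ℂ) * ((1 / 2 : ℂ) *
        ((𝓕⁻ A) (x - z + y n) + (𝓕⁻ A) (x - z - y n))))‖ ≤
        b n * ((1 / 2) * (C * ‖(𝓕⁻ A) (x + y n - z)‖ + C * ‖(𝓕⁻ A) (x - y n - z)‖)) := fun z => by
      rw [e0, norm_mul, norm_mul, Complex.norm_real]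
      gcongr
      · exact (abs_nonneg _).trans (hcb n)
      · exact hcb n
      · norm_num
      · refine (norm_add_le _ _).trans (add_le_add ?_ ?_) <;>
        · rw [norm_smul]
          gcongr
          exact hC z
    refine (integral_mono (hi n).norm (((i1.add i2).const_mul _).const_mul _) hle).trans ?_
    simp only [Pi.add_apply]
    rw [integral_const_mul, integral_const_mul, integral_add i1 i2, integral_const_mul,
      integral_const_mul, integral_sub_left_eq_self (fun z => ‖(𝓕⁻ A : 𝓢(E d, ℂ)) z‖) volume (x + y n),
      integral_sub_left_eq_self (fun z => ‖(𝓕⁻ A : 𝓢(E d, ℂ)) z‖) volume (x - y n)]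
    apply le_of_eq
    ring)
  have e1 : ∀ n, (∫ z, f z • ((c n : ℂ) * ((1 / 2 : ℂ) *
      ((𝓕⁻ A) (x - z + y n) + (𝓕⁻ A) (x - z - y n))))) =
      (c n : ℂ) * ((1 / 2 : ℂ) * (cv f (𝓕⁻ A) (x + y n) + cv f (𝓕⁻ A) (x - y n))) := fun n => by
    simp only [e0]
    rw [integral_const_mul, integral_const_mul, integral_add (hi0 n).1 (hi0 n).2]
    rfl
  have e2 : (∫ z, ∑' n, f z • ((c n : ℂ) * ((1 / 2 : ℂ) *
      ((𝓕⁻ A) (x - z + y n) + (𝓕⁻ A) (x - z - y n))))) = cv f (𝓕⁻ B) x := by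
    rw [cv]
    congr 1
    ext z
    exact ((hasSum_fourierInv_multiplier hT hcb hm hB (x - z)).const_smul (f z)).tsum_eq
  simp only [e1, e2] at h
  rw [← h.tsum_eq]
  refine tsum_of_norm_bounded (hT.mul_right H) fun n => ?_
  rw [norm_mul, Complex.norm_real, norm_mul]
  have h3 := norm_add_le (cv f (𝓕⁻ A) (x + y n)) (cv f (𝓕⁻ A) (x - y n))
  have hH1 := hH (x + y n)
  have hH2 := hH (x - y n)
  have h4 : ‖(1 / 2 : ℂ)‖ * ‖cv f (𝓕⁻ A) (x + y n) + cv f (𝓕⁻ A) (x - y n)‖ ≤ H := by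
    norm_num
    linarith
  exact mul_le_mul (hcb n) h4 (by positivity) ((abs_nonneg _).trans (hcb n))

end Multiplier

open LineDeriv in
lemma cv_hasDerivAt_line {f : E d → ℝ} (hf : Measurable f) {C : ℝ} (hC : ∀ x, |f x| ≤ C)
    (K : 𝓢(E d, ℂ)) (x v : E d) (s : ℝ) :
    HasDerivAt (fun s : ℝ => cv f K (x + s • v)) (cv f (∂_{v} K) (x + s • v)) s := by
  have h1 : HasDerivAt (fun s : ℝ => x + s • v) v s := by
    simpa using ((hasDerivAt_id s).smul_const v).const_add x
  have h2 := (cv_hasFDerivAt hf hC K (x + s • v)).comp_hasDerivAt s h1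
  convert! h2 using 1
  rw [cv, cv, ContinuousLinearMap.integral_apply (cv_integrable hf hC _ _)]
  rfl

open LineDeriv in
-- Two derivatives along `v` multiply the symbol by `-(2π⟨ν, v⟩)²`. Where `A` lives this is `-t²`
-- with `|t| ≤ r`, so it may be replaced by the cosine series of `t²`. Only one direction is
-- involved, so the dimension does not enter.
lemma bernstein_second {f : E d → ℝ} (hf : Measurable f) {C : ℝ} (hC : ∀ x, |f x| ≤ C)
    (A : 𝓢(E d, ℂ)) {r : ℝ} (hr : 0 < r) {v : E d}
    (hA : ∀ ν, A ν ≠ 0 → |2 * Real.pi * inner ℝ ν v| ≤ r) {H : ℝ}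
    (hH : ∀ x, ‖cv f (𝓕⁻ A) x‖ ≤ H) (x : E d) :
    ‖cv f (∂_{v} (∂_{v} (𝓕⁻ A))) x‖ ≤ r ^ 2 * H := by
  rw [SchwartzMap.lineDerivOp_fourierInv_eq, SchwartzMap.lineDerivOp_fourierInv_eq]
  have htg : (fun ν : E d => inner ℝ ν v).HasTemperateGrowth := by fun_prop
  refine cv_multiplier_le hf hC (A := A) (m := fun ν => -(2 * Real.pi * inner ℝ ν v) ^ 2)
    (c := fun n => -((if n = 0 then r ^ 2 / 3 else 0) +
      4 * r ^ 2 / Real.pi ^ 2 * ((-1) ^ n * (1 / (n : ℝ) ^ 2))))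
    (y := fun n => (n * (Real.pi / r)) • v)
    (summable_abs_sq_cos_coeff r) (fun n => ?_) (fun ν hν => ?_) (fun ν => ?_) hH x
  · rw [abs_neg]
    refine (abs_add_le _ _).trans (add_le_add (le_of_eq ?_) (le_of_eq ?_))
    · apply abs_of_nonneg
      split_ifs <;> positivity
    · rw [abs_mul, abs_mul, abs_pow, abs_neg, abs_one, one_pow, one_mul, abs_of_nonneg,
        abs_of_nonneg] <;> positivity
  · have h := (hasSum_sq_cos hr (hA ν hν)).neg
    convert! h using 1
    ext n
    rw [inner_smul_right, neg_mul]
    congr 3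
    ring
  · simp only [smul_apply, SchwartzMap.smulLeftCLM_apply_apply htg, smul_eq_mul,
      Complex.real_smul]
    push_cast
    ring_nf
    rw [Complex.I_sq]
    ring

open LineDeriv in
-- Bernstein along `y`, then the mean value inequality twice on the segment; the factor `1/2` of the
-- sharp remainder is not needed.
lemma cv_taylor {f : E d → ℝ} (hf : Measurable f) {C : ℝ} (hC : ∀ x, |f x| ≤ C)
    (A : 𝓢(E d, ℂ)) {r : ℝ} (hr : 0 < r)
    (hA : ∀ ν, A ν ≠ 0 → ‖(2 * Real.pi) • ν‖ ≤ r) {H : ℝ}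
    (hH : ∀ x, ‖cv f (𝓕⁻ A) x‖ ≤ H) (x y : E d) :
    ‖cv f (𝓕⁻ A) (x + y) - cv f (𝓕⁻ A) x - fderiv ℝ (cv f (𝓕⁻ A)) x y‖ ≤
      (r * ‖y‖) ^ 2 * H := by
  have hH0 : 0 ≤ H := (norm_nonneg _).trans (hH 0)
  rcases eq_or_ne y 0 with rfl | hy
  · simp
  have hr' : 0 < r * ‖y‖ := mul_pos hr (norm_pos_iff.2 hy)
  have hb := bernstein_second hf hC A hr' (v := y) (fun ν hν => by
    rw [abs_mul, abs_of_pos Real.two_pi_pos]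
    have h1 := hA ν hν
    rw [norm_smul, Real.norm_of_nonneg Real.two_pi_pos.le] at h1
    calc 2 * Real.pi * |inner ℝ ν y| ≤ 2 * Real.pi * (‖ν‖ * ‖y‖) := by
          have := Real.two_pi_pos
          gcongr
          exact abs_real_inner_le_norm _ _
      _ = (2 * Real.pi * ‖ν‖) * ‖y‖ := by ring
      _ ≤ r * ‖y‖ := by gcongr) hH
  set K : 𝓢(E d, ℂ) := 𝓕⁻ A
  have h1 : ∀ s ∈ Set.Icc (0 : ℝ) 1, ‖cv f (∂_{y} K) (x + s • y) - cv f (∂_{y} K) x‖ ≤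
      (r * ‖y‖) ^ 2 * H := fun s hs => by
    have := norm_image_sub_le_of_norm_deriv_le_segment' (a := 0) (b := 1)
      (fun t _ => (cv_hasDerivAt_line hf hC (∂_{y} K) x y t).hasDerivWithinAt)
      (fun t _ => hb (x + t • y)) s hs
    simp only [zero_smul, add_zero, sub_zero] at this
    exact this.trans (mul_le_of_le_one_right (by positivity) hs.2)
  have h2 := norm_image_sub_le_of_norm_deriv_le_segment' (a := 0) (b := 1)
      (f := fun s : ℝ => cv f K (x + s • y) - (s : ℂ) * cv f (∂_{y} K) x)
      (fun t _ => ((cv_hasDerivAt_line hf hC K x y t).sub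
        ((Complex.ofRealCLM.hasDerivAt (x := t)).mul_const _)).hasDerivWithinAt)
      (fun t ht => by simpa using h1 t (Set.Ico_subset_Icc_self ht)) 1 (by simp)
  have h3 : fderiv ℝ (cv f K) x y = cv f (∂_{y} K) x := by
    rw [cv_fderiv hf hC, cv, cv, ContinuousLinearMap.integral_apply (cv_integrable hf hC _ _)]
    rfl
  rw [h3]
  simp only [one_smul, zero_smul, add_zero, Complex.ofReal_one, one_mul, Complex.ofReal_zero,
    zero_mul, sub_zero, mul_one] at h2
  rw [sub_right_comm]
  exact h2

/-! ### Inversion of the heat flow -/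

section Heat

variable {γ : Measure (E d)} [IsProbabilityMeasure γ]

lemma integral_fourierInv_shift {A B : 𝓢(E d, ℂ)} (c : ℝ)
    (hAB : ∀ ν, A ν = charFun γ ((2 * Real.pi * c) • ν) * B ν) (w : E d) :
    ∫ ξ, (𝓕⁻ B) (w + c • ξ) ∂γ = (𝓕⁻ A) w := by
  simp only [fourierInv_apply_integral]
  have hi : Integrable (fun p : E d × E d =>
      Complex.exp (((2 * Real.pi * inner ℝ p.2 (w + c • p.1) : ℝ) : ℂ) * Complex.I) * B p.2)
      (γ.prod volume) := by
    have := (integrable_const (1 : ℂ) (μ := γ)).mul_prod (B.integrable (μ := volume))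
    refine this.mono (Continuous.aestronglyMeasurable (by fun_prop))
      (Filter.Eventually.of_forall fun p => ?_)
    rw [norm_cexp_mul_schwartz]
    simp
  rw [integral_integral_swap (f := fun ξ ν =>
    Complex.exp (((2 * Real.pi * inner ℝ ν (w + c • ξ) : ℝ) : ℂ) * Complex.I) * B ν) hi]
  congr 1
  ext ν
  rw [hAB, charFun_apply, ← mul_assoc, integral_mul_const, ← integral_const_mul]
  congr 2
  ext ξ
  rw [← Complex.exp_add, inner_add_right, inner_smul_right, inner_smul_right, real_inner_comm ξ ν]
  congr 1
  push_cast
  ring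

lemma integrable_prod_cv_shift {f : E d → ℝ} (hf : Measurable f) {C : ℝ} (hC : ∀ x, |f x| ≤ C)
    (K : 𝓢(E d, ℂ)) (c : ℝ) (x : E d) :
    Integrable (fun p : E d × E d => f p.2 • K (x + c • p.1 - p.2)) (γ.prod volume) := by
  have hC0 : 0 ≤ C := (abs_nonneg _).trans (hC 0)
  have hn := (K.integrable (μ := volume)).norm
  have hm : AEStronglyMeasurable (fun p : E d × E d => f p.2 • K (x + c • p.1 - p.2))
      (γ.prod volume) := by
    have hc : Continuous fun p : E d × E d => x + c • p.1 - p.2 := by fun_prop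
    exact AEStronglyMeasurable.smul (hf.comp measurable_snd).aestronglyMeasurable
      (K.continuous.comp hc).aestronglyMeasurable
  have hs : ∀ ξ : E d, Integrable fun z => f z • K (x + c • ξ - z) :=
    fun ξ => cv_integrable hf hC K (x + c • ξ)
  have hle : ∀ ξ : E d, ∫ z, ‖f z • K (x + c • ξ - z)‖ ≤ C * ∫ z, ‖K z‖ := fun ξ => by
    have h1 := (hn.comp_sub_left (x + c • ξ)).const_mul C
    have h2 := integral_sub_left_eq_self (fun z => ‖K z‖) volume (x + c • ξ)
    rw [← h2, ← integral_const_mul]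
    refine integral_mono (hs ξ).norm h1 fun z => ?_
    beta_reduce
    rw [norm_smul]
    exact mul_le_mul_of_nonneg_right (hC z) (norm_nonneg _)
  refine (integrable_prod_iff hm).2 ⟨Filter.Eventually.of_forall hs, ?_⟩
  refine (integrable_const (C * ∫ z, ‖K z‖)).mono' hm.norm.integral_prod_right'
    (Filter.Eventually.of_forall fun ξ => ?_)
  rw [Real.norm_of_nonneg (integral_nonneg fun _ => norm_nonneg _)]
  exact hle ξ

lemma integral_cv_shift {f : E d → ℝ} (hf : Measurable f) {C : ℝ} (hC : ∀ x, |f x| ≤ C)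
    {A B : 𝓢(E d, ℂ)} (c : ℝ) (hAB : ∀ ν, A ν = charFun γ ((2 * Real.pi * c) • ν) * B ν)
    (x : E d) :
    ∫ ξ, cv f (𝓕⁻ B) (x + c • ξ) ∂γ = cv f (𝓕⁻ A) x := by
  simp only [cv]
  rw [integral_integral_swap (integrable_prod_cv_shift hf hC (𝓕⁻ B) c x)]
  congr 1
  ext z
  rw [integral_smul, ← integral_fourierInv_shift c hAB]
  congr 3
  ext ξ
  rw [add_sub_right_comm]

/-- The function with symbol `A` is the average of the one with symbol `B` over the shifts `c ξ`. By
Taylor's formula and the zero mean of `ξ` the two differ by at most half the supremum of the latter,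
which can then be absorbed. -/
lemma heat_step {f : E d → ℝ} (hf : Measurable f) {C : ℝ} (hC : ∀ x, |f x| ≤ C)
    {A B : 𝓢(E d, ℂ)} (c : ℝ) (hAB : ∀ ν, A ν = charFun γ ((2 * Real.pi * c) • ν) * B ν)
    {r : ℝ} (hr : 0 < r) (hB : ∀ ν, B ν ≠ 0 → ‖(2 * Real.pi) • ν‖ ≤ r)
    (hγ : MemLp id 2 γ) (hmean : ∫ ξ, ξ ∂γ = 0)
    (hsmall : c ^ 2 * r ^ 2 * ∫ ξ, ‖ξ‖ ^ 2 ∂γ ≤ 1 / 2)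
    {H : ℝ} (hH : ∀ x, ‖cv f (𝓕⁻ A) x‖ ≤ H) (x : E d) :
    ‖cv f (𝓕⁻ B) x‖ ≤ 2 * H := by
  -- Absorption requires the supremum to be finite beforehand.
  have hbdd : BddAbove (Set.range fun x => ‖cv f (𝓕⁻ B) x‖) :=
    ⟨_, by rintro _ ⟨x, rfl⟩; exact cv_norm_le hC (𝓕⁻ B) x⟩
  set T := ⨆ x, ‖cv f (𝓕⁻ B) x‖ with hT
  have hTle : ∀ x, ‖cv f (𝓕⁻ B) x‖ ≤ T := fun x => le_ciSup hbdd x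
  have hT0 : 0 ≤ T := (norm_nonneg _).trans (hTle 0)
  have hsq : Integrable (fun ξ : E d => ‖ξ‖ ^ 2) γ := hγ.integrable_norm_pow two_ne_zero
  have hid : Integrable (fun ξ : E d => ξ) γ := hγ.integrable one_le_two
  have hidc : Integrable (fun ξ : E d => c • ξ) γ := hid.smul c
  have key : ∀ x, ‖cv f (𝓕⁻ B) x‖ ≤ H + 1 / 2 * T := fun x => by
    have hcont : Continuous (cv f (𝓕⁻ B)) := (cv_contDiff hf hC _).continuous
    have i1 : Integrable (fun ξ => cv f (𝓕⁻ B) (x + c • ξ)) γ :=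
      (integrable_const T).mono' (Continuous.aestronglyMeasurable (by fun_prop))
        (Filter.Eventually.of_forall fun ξ => hTle _)
    have i2 : Integrable (fun ξ => fderiv ℝ (cv f (𝓕⁻ B)) x (c • ξ)) γ :=
      ContinuousLinearMap.integrable_comp _ hidc
    have e2 : ∫ ξ, fderiv ℝ (cv f (𝓕⁻ B)) x (c • ξ) ∂γ = 0 := by
      rw [ContinuousLinearMap.integral_comp_comm _ hidc, integral_smul, hmean]
      simp
    have i3 : Integrable (fun ξ => cv f (𝓕⁻ B) (x + c • ξ) - cv f (𝓕⁻ B) x) γ :=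
      i1.sub (integrable_const _)
    have e3 : ∫ ξ, (cv f (𝓕⁻ B) (x + c • ξ) - cv f (𝓕⁻ B) x -
        fderiv ℝ (cv f (𝓕⁻ B)) x (c • ξ)) ∂γ = cv f (𝓕⁻ A) x - cv f (𝓕⁻ B) x := by
      rw [integral_sub i3 i2, e2, integral_sub i1 (integrable_const _),
        integral_cv_shift hf hC c hAB]
      simp
    have h4 : ‖cv f (𝓕⁻ A) x - cv f (𝓕⁻ B) x‖ ≤ 1 / 2 * T := by
      rw [← e3]
      refine (norm_integral_le_of_norm_le (hsq.const_mul (c ^ 2 * r ^ 2 * T))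
        (Filter.Eventually.of_forall fun ξ => ?_)).trans ?_
      · refine (cv_taylor hf hC B hr hB hTle x (c • ξ)).trans (le_of_eq ?_)
        rw [norm_smul, mul_pow, mul_pow, Real.norm_eq_abs, sq_abs]
        ring
      · rw [integral_const_mul]
        calc c ^ 2 * r ^ 2 * T * ∫ ξ, ‖ξ‖ ^ 2 ∂γ
            = (c ^ 2 * r ^ 2 * ∫ ξ, ‖ξ‖ ^ 2 ∂γ) * T := by ring
          _ ≤ 1 / 2 * T := by gcongr
    have h5 := norm_sub_le (cv f (𝓕⁻ A) x) (cv f (𝓕⁻ A) x - cv f (𝓕⁻ B) x)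
    rw [sub_sub_cancel] at h5
    linarith [hH x]
  have : T ≤ H + 1 / 2 * T := ciSup_le key
  exact (hTle x).trans (by linarith)

end Heat

/-! ### Centered Gaussian measures -/

/-- The covariance operator. -/
def covOp (S : Matrix (Fin d) (Fin d) ℝ) : E d →L[ℝ] E d := Matrix.toEuclideanCLM (𝕜 := ℝ) S

lemma quad_eq (S : Matrix (Fin d) (Fin d) ℝ) (a : E d) : quad S a = inner ℝ (covOp S a) a := rfl

lemma covOp_symm {S : Matrix (Fin d) (Fin d) ℝ} (hS : S.PosSemidef) (a b : E d) :
    inner ℝ (covOp S a) b = inner ℝ a (covOp S b) := by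
  have h : IsSelfAdjoint (covOp S) := hS.isHermitian.isSelfAdjoint.map _
  exact (ContinuousLinearMap.isSelfAdjoint_iff_isSymmetric.1 h) a b

lemma quad_nonneg {S : Matrix (Fin d) (Fin d) ℝ} (hS : S.PosSemidef) (a : E d) :
    0 ≤ quad S a := by
  rw [quad_eq, real_inner_comm, covOp, Matrix.inner_toEuclideanCLM]
  simpa using hS.dotProduct_mulVec_nonneg a.ofLp

lemma quad_pos {S : Matrix (Fin d) (Fin d) ℝ} (hS : S.PosDef) {a : E d} (ha : a ≠ 0) :
    0 < quad S a := by
  rw [quad_eq, real_inner_comm, covOp, Matrix.inner_toEuclideanCLM]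
  simpa using hS.dotProduct_mulVec_pos (x := a.ofLp) (by simpa using ha)

lemma quad_comb {S : Matrix (Fin d) (Fin d) ℝ} (hS : S.PosSemidef) (p q : ℝ) (a b : E d) :
    quad S (p • a + q • b) =
      p ^ 2 * quad S a + 2 * p * q * inner ℝ (covOp S a) b + q ^ 2 * quad S b := by
  have h : inner ℝ (covOp S b) a = inner ℝ (covOp S a) b := by
    rw [covOp_symm hS, real_inner_comm]
  simp only [quad_eq, map_add, map_smul, inner_add_left, inner_add_right, inner_smul_left,
    inner_smul_right, RCLike.conj_to_real, h]
  ring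

lemma charFun_centered {S : Matrix (Fin d) (Fin d) ℝ} (hS : S.PosSemidef) (t : E d) :
    charFun (multivariateGaussian 0 S) t = Complex.exp (((-(quad S t) / 2 : ℝ)) : ℂ) := by
  rw [charFun_multivariateGaussian hS, quad_eq, real_inner_comm t (covOp S t), covOp,
    Matrix.inner_toEuclideanCLM]
  simp [neg_div]

lemma multivariateGaussian_eq_map (S : Matrix (Fin d) (Fin d) ℝ) (θ : E d) :
    multivariateGaussian θ S = (multivariateGaussian 0 S).map (fun x => θ + x) := by
  rw [multivariateGaussian, multivariateGaussian, Measure.map_map (by fun_prop) (by fun_prop)]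
  congr 1
  ext x
  simp

lemma memLp_two_centered (S : Matrix (Fin d) (Fin d) ℝ) :
    MemLp id 2 (multivariateGaussian 0 S) := IsGaussian.memLp_two_id

lemma integral_norm_sq_centered {S : Matrix (Fin d) (Fin d) ℝ} (hS : S.PosSemidef) :
    ∫ x, ‖x‖ ^ 2 ∂(multivariateGaussian 0 S) = S.trace := by
  have hm : ∀ i : Fin d, MemLp (fun x : E d => x i) 2 (multivariateGaussian 0 S) := fun i =>
    (memLp_two_centered S).continuousLinearMap_comp (EuclideanSpace.proj (𝕜 := ℝ) i)
  simp only [EuclideanSpace.norm_sq_eq, Real.norm_eq_abs, sq_abs]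
  rw [integral_finsetSum _ fun i _ => (hm i).integrable_sq, Matrix.trace]
  refine Finset.sum_congr rfl fun i _ => ?_
  have h := variance_eval_multivariateGaussian (μ := 0) hS i
  have h0 : ∫ x : E d, x i ∂(multivariateGaussian 0 S) = 0 := by
    have := (EuclideanSpace.proj (𝕜 := ℝ) i).integral_comp_comm
      ((memLp_two_centered S).integrable one_le_two)
    simpa using this
  rw [variance_of_integral_eq_zero (hm i).aestronglyMeasurable.aemeasurable h0] at h
  exact h

/-! ### Gaussian integration by parts and invariance under rotations. -/

lemma gaussianReal_integration_by_parts {h h' : ℝ → ℝ} (hd : ∀ t, HasDerivAt h (h' t) t)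
    (hc : Continuous h') {C C' : ℝ} (hC : ∀ t, |h t| ≤ C) (hC' : ∀ t, |h' t| ≤ C') :
    ∫ t, h t * t ∂(gaussianReal 0 1) = ∫ t, h' t ∂(gaussianReal 0 1) := by
  have hcont : Continuous h := continuous_iff_continuousAt.2 fun t => (hd t).continuousAt
  rw [integral_gaussianReal_eq_integral_smul one_ne_zero,
    integral_gaussianReal_eq_integral_smul one_ne_zero]
  have hpdf : ∀ t : ℝ, HasDerivAt (gaussianPDFReal 0 1) (-(t * gaussianPDFReal 0 1 t)) t := by
    intro t
    have e : gaussianPDFReal 0 1 = fun x => (√(2 * Real.pi * (1 : ℝ≥0)))⁻¹ *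
        Real.exp (-(x - 0) ^ 2 / (2 * (1 : ℝ≥0))) := by
      ext x; rfl
    rw [e]
    have h1 : HasDerivAt (fun x : ℝ => -(x - 0) ^ 2 / (2 * ((1 : ℝ≥0) : ℝ))) (-t) t := by
      have := (((hasDerivAt_id t).sub_const 0).pow 2).neg.div_const (2 * ((1 : ℝ≥0) : ℝ))
      convert! this using 1
      simp
      ring
    convert! (h1.exp.const_mul _) using 1
    ring
  have i0 : Integrable (gaussianPDFReal 0 1) := integrable_gaussianPDFReal 0 1
  have i1 : Integrable fun t => t * gaussianPDFReal 0 1 t := by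
    have := (integrable_mul_exp_neg_mul_sq (b := 1 / 2) (by norm_num)).const_mul
      (√(2 * Real.pi * (1 : ℝ≥0)))⁻¹
    refine this.congr (Filter.Eventually.of_forall fun t => ?_)
    simp only [gaussianPDFReal, sub_zero, NNReal.coe_one, mul_one]
    rw [show -t ^ 2 / 2 = -(1 / 2) * t ^ 2 by ring]
    ring
  have key := integral_mul_deriv_eq_deriv_mul_of_integrable (u := h) (u' := h')
    (v := gaussianPDFReal 0 1) (v' := fun t => -(t * gaussianPDFReal 0 1 t))
    (fun t _ => hd t) (fun t _ => hpdf t)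
    (i1.neg.bdd_mul hcont.aestronglyMeasurable (Filter.Eventually.of_forall hC))
    (i0.bdd_mul hc.aestronglyMeasurable (Filter.Eventually.of_forall hC'))
    (i0.bdd_mul hcont.aestronglyMeasurable (Filter.Eventually.of_forall hC))
  simp only [mul_neg, integral_neg, neg_inj] at key
  simp only [smul_eq_mul]
  calc _ = ∫ t, h t * (t * gaussianPDFReal 0 1 t) := by congr 1; ext t; ring
    _ = _ := key
    _ = _ := by congr 1; ext t; ring

/-- The component of a Gaussian vector along `Σa` is independent of the remainder, so it can be
replaced by a fresh standard normal multiple of `Σa/√v`. This reduces integration by parts in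
direction `Σa` to one real variable. -/
lemma map_decomposition {S : Matrix (Fin d) (Fin d) ℝ} (hS : S.PosSemidef) {a : E d}
    (ha : 0 < quad S a) :
    ((multivariateGaussian 0 S).prod (gaussianReal 0 1)).map
      (fun p : E d × ℝ => p.1 - (inner ℝ a p.1 / quad S a) • covOp S a +
        p.2 • (√(quad S a))⁻¹ • covOp S a) = multivariateGaussian 0 S := by
  have hm : Measurable (fun p : E d × ℝ => p.1 - (inner ℝ a p.1 / quad S a) • covOp S a +
        p.2 • (√(quad S a))⁻¹ • covOp S a) := Continuous.measurable (by fun_prop)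
  have := Measure.isProbabilityMeasure_map (μ := (multivariateGaussian 0 S).prod
    (gaussianReal 0 1)) hm.aemeasurable
  refine Measure.ext_of_charFun (funext fun ζ => ?_)
  set v := quad S a with hv
  set κ := inner ℝ (covOp S a) ζ with hκ
  rw [charFun_apply, integral_map hm.aemeasurable (by fun_prop)]
  have e : ∀ p : E d × ℝ, Complex.exp ((inner ℝ (p.1 - (inner ℝ a p.1 / v) • covOp S a +
        p.2 • (√v)⁻¹ • covOp S a) ζ : ℝ) * Complex.I) =
      Complex.exp ((inner ℝ p.1 ((1 : ℝ) • ζ + (-(κ / v)) • a) : ℝ) * Complex.I) *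
        Complex.exp ((inner ℝ p.2 (κ / √v) : ℝ) * Complex.I) := fun p => by
    rw [← Complex.exp_add]
    congr 1
    simp only [inner_add_left, inner_sub_left, inner_smul_left, inner_add_right, inner_smul_right,
      RCLike.conj_to_real, ← hκ, one_mul, real_inner_comm p.1 a]
    simp
    ring
  simp only [e]
  rw [integral_prod_mul (μ := multivariateGaussian 0 S) (ν := gaussianReal 0 1)
    (fun x => Complex.exp ((inner ℝ x ((1 : ℝ) • ζ + (-(κ / v)) • a) : ℝ) * Complex.I))
    (fun t => Complex.exp ((inner ℝ t (κ / √v) : ℝ) * Complex.I)),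
    ← charFun_apply, ← charFun_apply, charFun_gaussianReal, charFun_centered hS,
    charFun_centered hS, quad_comb hS, ← Complex.exp_add]
  congr 1
  have h1 : inner ℝ (covOp S ζ) a = κ := by rw [covOp_symm hS, real_inner_comm]
  have h2 : (κ / √v) ^ 2 = κ ^ 2 / v := by rw [div_pow, Real.sq_sqrt ha.le]
  rw [h1, ← hv]
  have h3 : ((κ / √v : ℝ) : ℂ) ^ 2 = ((κ ^ 2 / v : ℝ) : ℂ) := by rw [← h2]; push_cast; rfl
  rw [h3]
  simp only [Complex.ofReal_zero, mul_zero, zero_mul, NNReal.coe_one, Complex.ofReal_one, one_mul]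
  rw [zero_sub, ← Complex.ofReal_ofNat, ← Complex.ofReal_div, ← Complex.ofReal_neg,
    ← Complex.ofReal_add]
  congr 1
  field_simp
  ring

/-- Condition on the part of the vector orthogonal to `a`; what remains is the one-dimensional
formula on the line in direction `Σa`. -/
lemma gaussian_integration_by_parts {S : Matrix (Fin d) (Fin d) ℝ} (hS : S.PosDef)
    {H : E d → ℝ} (hH : ContDiff ℝ 1 H) {C C' : ℝ} (hC : ∀ x, |H x| ≤ C)
    (hC' : ∀ x, ‖fderiv ℝ H x‖ ≤ C') (a : E d) :
    ∫ y, H y * inner ℝ a y ∂(multivariateGaussian 0 S) =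
      ∫ y, fderiv ℝ H y (covOp S a) ∂(multivariateGaussian 0 S) := by
  rcases eq_or_ne a 0 with rfl | ha
  · simp
  have hv := quad_pos hS ha
  set v := quad S a with hvdef
  have hm : Measurable (fun p : E d × ℝ => p.1 - (inner ℝ a p.1 / v) • covOp S a +
        p.2 • (√v)⁻¹ • covOp S a) := Continuous.measurable (by fun_prop)
  have hmap := map_decomposition hS.posSemidef hv
  rw [← hvdef] at hmap
  have hd : Differentiable ℝ H := hH.differentiable one_ne_zero
  have hfc : Continuous (fderiv ℝ H) := hH.continuous_fderiv one_ne_zero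
  have hidp : Integrable (fun y : E d => inner ℝ a y) (multivariateGaussian 0 S) :=
    ((memLp_two_centered S).integrable one_le_two).const_inner a
  have i1 : Integrable (fun y => H y * inner ℝ a y) (multivariateGaussian 0 S) :=
    hidp.bdd_mul hH.continuous.aestronglyMeasurable (Filter.Eventually.of_forall hC)
  have i2 : Integrable (fun y => fderiv ℝ H y (covOp S a)) (multivariateGaussian 0 S) :=
    (integrable_const (C' * ‖covOp S a‖)).mono'
      (Continuous.aestronglyMeasurable (by fun_prop)) (Filter.Eventually.of_forall fun y =>
        (ContinuousLinearMap.le_opNorm _ _).trans (by gcongr; exact hC' y))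
  have hcov : inner ℝ a (covOp S a) = v := by rw [real_inner_comm]; rfl
  have hsq : √v * √v = v := Real.mul_self_sqrt hv.le
  have hsq0 : √v ≠ 0 := (Real.sqrt_pos.2 hv).ne'
  rw [← hmap] at i1 i2
  rw [integrable_map_measure i1.aestronglyMeasurable hm.aemeasurable] at i1
  rw [integrable_map_measure i2.aestronglyMeasurable hm.aemeasurable] at i2
  simp only [Function.comp_def] at i1 i2
  rw [← hmap, integral_map hm.aemeasurable, integral_map hm.aemeasurable]
  · rw [integral_prod _ i1, integral_prod _ i2]
    congr 1
    ext w
    set z := w - (inner ℝ a w / v) • covOp S a with hz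
    have haz : inner ℝ a z = 0 := by
      rw [hz, inner_sub_right, inner_smul_right, hcov]
      field_simp
      simp
    have hline : ∀ t : ℝ, HasDerivAt (fun t : ℝ => H (z + t • (√v)⁻¹ • covOp S a))
        (fderiv ℝ H (z + t • (√v)⁻¹ • covOp S a) ((√v)⁻¹ • covOp S a)) t := fun t => by
      have h1 : HasDerivAt (fun t : ℝ => z + t • (√v)⁻¹ • covOp S a)
          ((√v)⁻¹ • covOp S a) t := by
        simpa using ((hasDerivAt_id t).smul_const ((√v)⁻¹ • covOp S a)).const_add z
      exact (hd _).hasFDerivAt.comp_hasDerivAt t h1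
    have hibp := gaussianReal_integration_by_parts hline (by fun_prop)
      (C := C) (C' := C' * ‖(√v)⁻¹ • covOp S a‖) (fun t => hC _)
      (fun t => (ContinuousLinearMap.le_opNorm _ _).trans 
        (mul_le_mul_of_nonneg_right (hC' _) (norm_nonneg _)))
    simp only [map_smul, smul_eq_mul, integral_const_mul] at hibp
    have e1 : ∀ t : ℝ, H (z + t • (√v)⁻¹ • covOp S a) *
        inner ℝ a (z + t • (√v)⁻¹ • covOp S a) =
        √v * (H (z + t • (√v)⁻¹ • covOp S a) * t) := fun t => by
      rw [inner_add_right, haz, inner_smul_right, inner_smul_right, hcov]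
      have : (√v)⁻¹ * v = √v := by
        nth_rewrite 2 [← hsq]; field_simp
      rw [this]
      ring
    change ∫ t, H (z + t • (√v)⁻¹ • covOp S a) * inner ℝ a (z + t • (√v)⁻¹ • covOp S a)
        ∂gaussianReal 0 1 =
      ∫ t, fderiv ℝ H (z + t • (√v)⁻¹ • covOp S a) (covOp S a) ∂gaussianReal 0 1
    simp only [e1, integral_const_mul]
    rw [hibp, ← mul_assoc, mul_inv_cancel₀ hsq0, one_mul]
  · rw [hmap]; exact Continuous.aestronglyMeasurable (by fun_prop)
  · rw [hmap]; exact ((hH.continuous.mul (by fun_prop)).aestronglyMeasurable)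

/-- The rotation by the angle `α` of pairs of vectors. -/
def rotate (α : ℝ) (p : E d × E d) : E d × E d :=
  (Real.cos α • p.1 - Real.sin α • p.2, Real.sin α • p.1 + Real.cos α • p.2)

/-- In the characteristic function of the pair the cross terms `⟨Σa, b⟩` of the two rotated
frequencies cancel. -/
lemma measurePreserving_rotate {S : Matrix (Fin d) (Fin d) ℝ} (hS : S.PosSemidef) (α : ℝ) :
    MeasurePreserving (rotate (d := d) α)
      ((multivariateGaussian 0 S).prod (multivariateGaussian 0 S))
      ((multivariateGaussian 0 S).prod (multivariateGaussian 0 S)) := by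
  have hm : Measurable (rotate (d := d) α) := Continuous.measurable (by unfold rotate; fun_prop)
  refine ⟨hm, ?_⟩
  have := Measure.isProbabilityMeasure_map (μ := (multivariateGaussian 0 S).prod
    (multivariateGaussian 0 S)) hm.aemeasurable
  refine Measure.ext_of_charFunDual (funext fun L => ?_)
  set a := (InnerProductSpace.toDual ℝ (E d)).symm (L.comp (.inl ℝ (E d) (E d)))
  set b := (InnerProductSpace.toDual ℝ (E d)).symm (L.comp (.inr ℝ (E d) (E d)))
  have hL : ∀ p : E d × E d, L p = inner ℝ p.1 a + inner ℝ p.2 b := fun p => by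
    rw [real_inner_comm, real_inner_comm b, InnerProductSpace.toDual_symm_apply,
      InnerProductSpace.toDual_symm_apply]
    simp [← map_add]
  have hprod : ∀ x y : E d, ∫ p : E d × E d,
      Complex.exp ((inner ℝ p.1 x + inner ℝ p.2 y : ℝ) * Complex.I)
        ∂((multivariateGaussian 0 S).prod (multivariateGaussian 0 S)) =
      Complex.exp (((-(quad S x + quad S y) / 2 : ℝ)) : ℂ) := fun x y => by
    have e : ∀ p : E d × E d, Complex.exp ((inner ℝ p.1 x + inner ℝ p.2 y : ℝ) * Complex.I) =
        Complex.exp ((inner ℝ p.1 x : ℝ) * Complex.I) *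
          Complex.exp ((inner ℝ p.2 y : ℝ) * Complex.I) := fun p => by
      rw [← Complex.exp_add]; push_cast; ring_nf
    simp only [e]
    rw [integral_prod_mul (fun u : E d => Complex.exp ((inner ℝ u x : ℝ) * Complex.I))
      (fun u : E d => Complex.exp ((inner ℝ u y : ℝ) * Complex.I)), ← charFun_apply,
      ← charFun_apply, charFun_centered hS, charFun_centered hS, ← Complex.exp_add]
    congr 1
    push_cast
    ring
  rw [charFunDual_apply, charFunDual_apply, integral_map hm.aemeasurable (by fun_prop)]
  simp only [hL, hprod]
  have e : ∀ p : E d × E d, inner ℝ (rotate α p).1 a + inner ℝ (rotate α p).2 b =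
      inner ℝ p.1 (Real.cos α • a + Real.sin α • b) +
        inner ℝ p.2 (-Real.sin α • a + Real.cos α • b) := fun p => by
    simp only [rotate, inner_add_left, inner_sub_left, inner_smul_left, inner_add_right,
      inner_smul_right, RCLike.conj_to_real]
    ring
  simp only [e, hprod, quad_comb hS]
  congr 3
  have := Real.sin_sq_add_cos_sq α
  linear_combination -(quad S a + quad S b) * this

/-! ### A covariance formula -/

section Covariance

variable {S : Matrix (Fin d) (Fin d) ℝ} {F G : E d → ℝ} {CF CF' CG CG' : ℝ}

/-- The mean of `⟨Σ ∇G(U), ∇F(cos α U - sin α V)⟩` for independent `U`, `V` with law `N(0, Σ)`. -/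
def crossGradient (S : Matrix (Fin d) (Fin d) ℝ) (F G : E d → ℝ) (α : ℝ) : ℝ :=
  ∫ p : E d × E d, fderiv ℝ F (Real.cos α • p.1 - Real.sin α • p.2) (covOp S (gradient G p.1))
    ∂((multivariateGaussian 0 S).prod (multivariateGaussian 0 S))

lemma continuous_gradient (hG : ContDiff ℝ 1 G) : Continuous (gradient G) :=
  (InnerProductSpace.toDual ℝ (E d)).symm.continuous.comp (hG.continuous_fderiv one_ne_zero)

lemma inner_gradient_eq (G : E d → ℝ) (x y : E d) : inner ℝ (gradient G x) y = fderiv ℝ G x y := by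
  rw [gradient, InnerProductSpace.toDual_symm_apply]

lemma norm_gradient_eq (G : E d → ℝ) (x : E d) : ‖gradient G x‖ = ‖fderiv ℝ G x‖ :=
  LinearIsometryEquiv.norm_map _ _

/-- Rotating the pair turns the argument of `∇G` into `U` and its direction into `V`, while `F` is
evaluated at `cos α U - sin α V`. With `U` fixed, integration by parts in `V` moves the factor `V`
onto `F`, and the chain rule produces `-sin α`. -/
lemma integral_mul_fderiv_rotate (hS : S.PosDef) (hF : ContDiff ℝ 1 F) (hG : ContDiff ℝ 1 G)
    (hCF : ∀ x, |F x| ≤ CF) (hCF' : ∀ x, ‖fderiv ℝ F x‖ ≤ CF')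
    (hCG' : ∀ x, ‖fderiv ℝ G x‖ ≤ CG') (α : ℝ) :
    ∫ p : E d × E d, F p.1 * fderiv ℝ G (Real.cos α • p.1 + Real.sin α • p.2)
      (-Real.sin α • p.1 + Real.cos α • p.2)
        ∂((multivariateGaussian 0 S).prod (multivariateGaussian 0 S)) =
      -Real.sin α * crossGradient S F G α := by
  set γ := multivariateGaussian 0 S with hγ
  have hid : Integrable (fun x : E d => ‖x‖) γ :=
    ((memLp_two_centered S).integrable one_le_two).norm
  have hfF := hF.continuous_fderiv one_ne_zero
  have hfG := hG.continuous_fderiv one_ne_zero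
  have hcF := hF.continuous
  have hcG := continuous_gradient hG
  have hmp := measurePreserving_rotate hS.posSemidef α
  have hCF0 : 0 ≤ CF := (abs_nonneg _).trans (hCF 0)
  have hCF'0 : 0 ≤ CF' := (norm_nonneg _).trans (hCF' 0)
  have hCG0 : 0 ≤ CG' := (norm_nonneg _).trans (hCG' 0)
  have hcont : Continuous fun p : E d × E d =>
      F p.1 * fderiv ℝ G (Real.cos α • p.1 + Real.sin α • p.2)
        (-Real.sin α • p.1 + Real.cos α • p.2) := by fun_prop
  rw [← hmp.map_eq, integral_map hmp.measurable.aemeasurable hcont.aestronglyMeasurable]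
  have e1 : ∀ p : E d × E d, F (rotate α p).1 *
      fderiv ℝ G (Real.cos α • (rotate α p).1 + Real.sin α • (rotate α p).2)
        (-Real.sin α • (rotate α p).1 + Real.cos α • (rotate α p).2) =
      F (Real.cos α • p.1 - Real.sin α • p.2) * inner ℝ (gradient G p.1) p.2 := fun p => by
    have hsc := Real.sin_sq_add_cos_sq α
    have h1 : Real.cos α • (rotate α p).1 + Real.sin α • (rotate α p).2 = p.1 := by
      have : Real.cos α • (rotate α p).1 + Real.sin α • (rotate α p).2 =
        (Real.sin α ^ 2 + Real.cos α ^ 2) • p.1 := by simp only [rotate]; module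
      rw [this, hsc, one_smul]
    have h2 : -Real.sin α • (rotate α p).1 + Real.cos α • (rotate α p).2 = p.2 := by
      have : -Real.sin α • (rotate α p).1 + Real.cos α • (rotate α p).2 =
        (Real.sin α ^ 2 + Real.cos α ^ 2) • p.2 := by simp only [rotate]; module
      rw [this, hsc, one_smul]
    rw [h1, h2, inner_gradient_eq]
    rfl
  simp only [e1]
  have i1 : Integrable (fun p : E d × E d => F (Real.cos α • p.1 - Real.sin α • p.2) *
      inner ℝ (gradient G p.1) p.2) (γ.prod γ) := by
    have h0 : Integrable (fun p : E d × E d => CF * CG' * ‖p.2‖) (γ.prod γ) := by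
      have := (integrable_const (μ := γ) (CF * CG')).mul_prod hid
      exact this
    refine h0.mono' (Continuous.aestronglyMeasurable (by fun_prop))
      (Filter.Eventually.of_forall fun p => ?_)
    rw [norm_mul, mul_assoc]
    refine mul_le_mul (hCF _) ?_ (norm_nonneg _) hCF0
    refine (norm_inner_le_norm _ _).trans ?_
    rw [norm_gradient_eq]
    gcongr
    exact hCG' _
  have i2 : Integrable (fun p : E d × E d =>
      fderiv ℝ F (Real.cos α • p.1 - Real.sin α • p.2) (covOp S (gradient G p.1)))
      (γ.prod γ) := by
    refine (integrable_const (CF' * (‖covOp S‖ * CG'))).mono'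
      (Continuous.aestronglyMeasurable (by fun_prop)) (Filter.Eventually.of_forall fun p => ?_)
    refine (ContinuousLinearMap.le_opNorm _ _).trans ?_
    gcongr
    · exact hCF' _
    · refine (ContinuousLinearMap.le_opNorm _ _).trans ?_
      rw [norm_gradient_eq]
      gcongr
      exact hCG' _
  rw [crossGradient, integral_prod _ i1, integral_prod _ i2, ← integral_const_mul]
  congr 1
  ext u
  have hH : ContDiff ℝ 1 fun v => F (Real.cos α • u - Real.sin α • v) :=
    hF.comp (contDiff_const.sub (contDiff_id.const_smul _))
  have hfd : ∀ v, fderiv ℝ (fun v => F (Real.cos α • u - Real.sin α • v)) v =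
      -Real.sin α • fderiv ℝ F (Real.cos α • u - Real.sin α • v) := fun v => by
    have h1 : HasFDerivAt (fun v : E d => Real.cos α • u - Real.sin α • v)
        (-(Real.sin α • ContinuousLinearMap.id ℝ (E d))) v := by
      simpa using ((hasFDerivAt_id v).const_smul (Real.sin α)).const_sub (Real.cos α • u)
    have h2 := ((hF.differentiable one_ne_zero) _).hasFDerivAt.comp v h1
    refine HasFDerivAt.fderiv (h2.congr_fderiv ?_)
    ext w
    simp
  rw [gaussian_integration_by_parts hS hH (fun v => hCF _) (C' := |Real.sin α| * CF') (fun v => by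
    rw [hfd, norm_smul, norm_neg, Real.norm_eq_abs]
    gcongr
    exact hCF' _) (gradient G u), ← integral_const_mul]
  congr 1
  ext v
  rw [hfd]
  rfl

/-- The function `Φ(α) = E F(U) G(cos α U + sin α V)` runs from `E FG` at `0` to `E F · E G` at
`π/2`, with derivative `-sin α` times `crossGradient`. If the latter is nearly a constant `c` for
all angles, the covariance is nearly `c`. -/
lemma covariance_approx (hS : S.PosDef) (hF : ContDiff ℝ 1 F) (hG : ContDiff ℝ 1 G)
    (hCF : ∀ x, |F x| ≤ CF) (hCF' : ∀ x, ‖fderiv ℝ F x‖ ≤ CF')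
    (hCG : ∀ x, |G x| ≤ CG) (hCG' : ∀ x, ‖fderiv ℝ G x‖ ≤ CG') {c δ : ℝ}
    (hδ : ∀ α, |crossGradient S F G α - c| ≤ δ) :
    |∫ x, F x * (G x - ∫ y, G y ∂(multivariateGaussian 0 S)) ∂(multivariateGaussian 0 S) - c| ≤
      Real.pi / 2 * δ := by
  set γ := multivariateGaussian 0 S with hγ
  have hid : Integrable (fun x : E d => ‖x‖) γ :=
    ((memLp_two_centered S).integrable one_le_two).norm
  have hfG := hG.continuous_fderiv one_ne_zero
  have hcF := hF.continuous
  have hcG := hG.continuous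
  have hCF0 : 0 ≤ CF := (abs_nonneg _).trans (hCF 0)
  have hCG0 : 0 ≤ CG' := (norm_nonneg _).trans (hCG' 0)
  have hδ0 : 0 ≤ δ := (abs_nonneg _).trans (hδ 0)
  set Φ : ℝ → ℝ := fun α => ∫ p : E d × E d, F p.1 * G (Real.cos α • p.1 + Real.sin α • p.2)
    ∂(γ.prod γ) with hΦ
  have hderiv : ∀ α, HasDerivAt Φ (-Real.sin α * crossGradient S F G α) α := fun α => by
    rw [← integral_mul_fderiv_rotate hS hF hG hCF hCF' hCG' α]
    refine (hasDerivAt_integral_of_dominated_loc_of_deriv_le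
      (F := fun α (p : E d × E d) => F p.1 * G (Real.cos α • p.1 + Real.sin α • p.2))
      (F' := fun α (p : E d × E d) => F p.1 * fderiv ℝ G (Real.cos α • p.1 + Real.sin α • p.2)
        (-Real.sin α • p.1 + Real.cos α • p.2))
      (bound := fun p => CF * (CG' * (‖p.1‖ + ‖p.2‖))) Filter.univ_mem
      (Filter.Eventually.of_forall fun β => Continuous.aestronglyMeasurable (by fun_prop))
      ?_ (Continuous.aestronglyMeasurable (by fun_prop))
      (Filter.Eventually.of_forall fun p β _ => ?_) ?_
      (Filter.Eventually.of_forall fun p β _ => ?_)).2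
    · refine (integrable_const (CF * CG)).mono' (Continuous.aestronglyMeasurable (by fun_prop))
        (Filter.Eventually.of_forall fun p => ?_)
      rw [norm_mul]
      exact mul_le_mul (hCF _) (hCG _) (norm_nonneg _) hCF0
    · rw [norm_mul]
      refine mul_le_mul (hCF _) ?_ (norm_nonneg _) hCF0
      refine (ContinuousLinearMap.le_opNorm _ _).trans ?_
      refine mul_le_mul (hCG' _) ?_ (norm_nonneg _) hCG0
      refine (norm_add_le _ _).trans ?_
      rw [norm_smul, norm_smul, norm_neg]
      exact add_le_add
        (mul_le_of_le_one_left (norm_nonneg _) (Real.abs_sin_le_one β))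
        (mul_le_of_le_one_left (norm_nonneg _) (Real.abs_cos_le_one β))
    · have h1 : Integrable (fun p : E d × E d => ‖p.1‖) (γ.prod γ) := hid.comp_fst γ
      have h2 : Integrable (fun p : E d × E d => ‖p.2‖) (γ.prod γ) := hid.comp_snd γ
      exact ((h1.add h2).const_mul CG').const_mul CF
    · have h1 : HasDerivAt (fun β : ℝ => Real.cos β • p.1 + Real.sin β • p.2)
          (-Real.sin β • p.1 + Real.cos β • p.2) β :=
        ((Real.hasDerivAt_cos β).smul_const p.1).add ((Real.hasDerivAt_sin β).smul_const p.2)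
      exact (((hG.differentiable one_ne_zero) _).hasFDerivAt.comp_hasDerivAt β h1).const_mul _
  have h0 : Φ 0 = ∫ x, F x * G x ∂γ := by
    simp only [hΦ, Real.cos_zero, Real.sin_zero, one_smul, zero_smul, add_zero]
    have := integral_prod_mul (μ := γ) (ν := γ) (fun x => F x * G x) (fun _ => (1 : ℝ))
    simpa using this
  have h1 : Φ (Real.pi / 2) = (∫ x, F x ∂γ) * ∫ y, G y ∂γ := by
    simp only [hΦ, Real.cos_pi_div_two, Real.sin_pi_div_two, one_smul, zero_smul, zero_add]
    exact integral_prod_mul (μ := γ) (ν := γ) F G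
  -- Bounding `|sin α|` by 1 over an interval of length `π/2` gives the factor `π/2`.
  have hmv := norm_image_sub_le_of_norm_deriv_le_segment' (a := 0) (b := Real.pi / 2)
    (f := fun α => Φ α - Real.cos α * c) (C := δ)
    (fun α _ => ((hderiv α).sub ((Real.hasDerivAt_cos α).mul_const c)).hasDerivWithinAt)
    (fun α _ => by
      rw [← mul_sub, norm_mul, norm_neg]
      exact (mul_le_of_le_one_left (norm_nonneg _) (Real.abs_sin_le_one α)).trans (hδ α))
    (Real.pi / 2) ⟨by positivity, le_rfl⟩
  simp only [h0, h1, Real.cos_pi_div_two, Real.cos_zero, zero_mul, one_mul, sub_zero,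
    Real.norm_eq_abs] at hmv
  have iF : Integrable F γ := (integrable_const CF).mono' hcF.aestronglyMeasurable
    (Filter.Eventually.of_forall hCF)
  have iFG : Integrable (fun x => F x * G x) γ := (integrable_const (CF * CG)).mono'
    (hcF.mul hcG).aestronglyMeasurable (Filter.Eventually.of_forall fun x => by
      rw [norm_mul]; exact mul_le_mul (hCF _) (hCG _) (norm_nonneg _) hCF0)
  simp only [mul_sub]
  rw [integral_sub iFG (iF.mul_const _), integral_mul_const, abs_sub_comm]
  rw [mul_comm δ] at hmv
  convert! hmv using 2
  ring

end Covariance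

/-! ### Stein's equation and normal approximation -/

section Stein

/-- The Mills ratio bound: on the tail `w` is at most `x`, and `x e^{-x²/2}` has an explicit
primitive. -/
lemma mul_integral_Ioi_exp_le {w : ℝ} :
    w * ∫ x in Set.Ioi w, Real.exp (-(1 / 2) * x ^ 2) ≤ Real.exp (-(1 / 2) * w ^ 2) := by
  have hint := integrable_mul_exp_neg_mul_sq (b := 1 / 2) (by norm_num)
  have h1 : ∫ x in Set.Ioi w, x * Real.exp (-(1 / 2) * x ^ 2) = Real.exp (-(1 / 2) * w ^ 2) := by
    have h := integral_Ioi_of_hasDerivAt_of_tendsto' (a := w) (m := 0)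
      (f := fun x => -Real.exp (-(1 / 2) * x ^ 2))
      (f' := fun x => x * Real.exp (-(1 / 2) * x ^ 2)) (fun x _ => by
        have h := (((hasDerivAt_pow 2 x).const_mul (-(1 / 2))).exp).neg
        convert! h using 1
        simp; ring) hint.integrableOn (by
        rw [← neg_zero]
        refine (Real.tendsto_exp_atBot.comp ?_).neg
        exact (Filter.tendsto_pow_atTop two_ne_zero).const_mul_atTop_of_neg (by norm_num))
    rw [h]; ring
  rw [← h1, ← integral_const_mul]
  refine setIntegral_mono_on
    ((integrable_exp_neg_mul_sq (b := 1 / 2) (by norm_num)).const_mul w).integrableOn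
    hint.integrableOn measurableSet_Ioi fun x hx => ?_
  have : w < x := hx
  gcongr

lemma abs_mul_integral_Ioi_le {k : ℝ → ℝ} (hk : ∀ x, |k x| ≤ 1) {w : ℝ} (hw : 0 ≤ w) :
    w * |∫ x in Set.Ioi w, k x * Real.exp (-(1 / 2) * x ^ 2)| ≤ Real.exp (-(1 / 2) * w ^ 2) := by
  refine le_trans ?_ mul_integral_Ioi_exp_le
  gcongr
  rw [← Real.norm_eq_abs]
  refine norm_integral_le_of_norm_le
    (integrable_exp_neg_mul_sq (b := 1 / 2) (by norm_num)).integrableOn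
    (Filter.Eventually.of_forall fun x => ?_)
  rw [norm_mul, Real.norm_of_nonneg (Real.exp_pos _).le]
  exact mul_le_of_le_one_left (Real.exp_pos _).le (hk x)

/-- The solution is `ψ(w) = e^{w²/2} ∫_{-∞}^w (h - m) e^{-x²/2} dx`. The Mills ratio gives `|w ψ(w)|
≤ 1`, and the equation then bounds the derivative by 2. No smoothness of `h` is used beyond
continuity. -/
lemma exists_stein_solution {h : ℝ → ℝ} (hc : Continuous h) (h0 : ∀ x, 0 ≤ h x)
    (h1 : ∀ x, h x ≤ 1) :
    ∃ ψ : ℝ → ℝ, ContDiff ℝ 1 ψ ∧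
      (∀ w, deriv ψ w = w * ψ w + (h w - ∫ x, h x ∂gaussianReal 0 1)) ∧
      ∀ w, |deriv ψ w| ≤ 2 := by
  have hhint : Integrable h (gaussianReal 0 1) := (integrable_const (1 : ℝ)).mono'
    hc.aestronglyMeasurable (Filter.Eventually.of_forall fun x => by
      rw [Real.norm_of_nonneg (h0 x)]; exact h1 x)
  set m := ∫ x, h x ∂gaussianReal 0 1 with hm
  have hm0 : 0 ≤ m := integral_nonneg h0
  have hm1 : m ≤ 1 := by
    have := integral_mono hhint (integrable_const (1 : ℝ)) h1
    simpa using this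
  set k : ℝ → ℝ := fun x => h x - m with hk
  have hkc : Continuous k := hc.sub continuous_const
  have hkb : ∀ x, |k x| ≤ 1 := fun x => abs_le.2 ⟨by simp only [hk]; linarith [h0 x],
    by simp only [hk]; linarith [h1 x]⟩
  have hek := integrable_exp_neg_mul_sq (b := 1 / 2) (by norm_num)
  set q : ℝ → ℝ := fun x => k x * Real.exp (-(1 / 2) * x ^ 2) with hq
  have hqc : Continuous q := by fun_prop
  have hqi : Integrable q := hek.bdd_mul hkc.aestronglyMeasurable
    (Filter.Eventually.of_forall hkb)
  have hq0 : ∫ x, q x = 0 := by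
    have e : ∫ x, k x ∂gaussianReal 0 1 = 0 := by
      rw [hk, integral_sub hhint (integrable_const _)]; simp [hm]
    rw [integral_gaussianReal_eq_integral_smul one_ne_zero] at e
    have e2 : ∀ x, gaussianPDFReal 0 1 x • k x = (√(2 * Real.pi))⁻¹ * q x := fun x => by
      simp only [gaussianPDFReal, hq, smul_eq_mul, NNReal.coe_one, mul_one, sub_zero]
      rw [show -x ^ 2 / 2 = -(1 / 2) * x ^ 2 by ring]
      ring
    simp only [e2] at e
    rw [integral_const_mul] at e
    exact (mul_eq_zero.1 e).resolve_left (by positivity)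
  set Q : ℝ → ℝ := fun w => ∫ x in Set.Iic w, q x with hQ
  have hQd : ∀ w, HasDerivAt Q (q w) w := fun w => by
    have e : Q = fun w => (∫ x in Set.Iic 0, q x) + ∫ x in (0 : ℝ)..w, q x := by
      ext w
      rw [← intervalIntegral.integral_Iic_sub_Iic hqi.integrableOn hqi.integrableOn]
      simp [hQ]
    rw [e]
    exact (intervalIntegral.integral_hasDerivAt_right (hqc.intervalIntegrable _ _)
      (hqc.stronglyMeasurableAtFilter _ _) hqc.continuousAt).const_add _
  have hQb : ∀ w, |w * Q w| ≤ Real.exp (-(1 / 2) * w ^ 2) := fun w => by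
    rw [abs_mul]
    rcases le_total 0 w with hw | hw
    -- For positive `w` the left integral is traded for the right tail, the total mass of `q` being
    -- zero.
    · have e : Q w = -∫ x in Set.Ioi w, q x := by
        have := intervalIntegral.integral_Iic_add_Ioi (b := w) hqi.integrableOn hqi.integrableOn
        rw [hq0] at this
        linarith
      rw [e, abs_neg, abs_of_nonneg hw]
      exact abs_mul_integral_Ioi_le hkb hw
    · have e : Q w = ∫ x in Set.Ioi (-w), k (-x) * Real.exp (-(1 / 2) * x ^ 2) := by
        have := integral_comp_neg_Iic w (fun x => k (-x) * Real.exp (-(1 / 2) * x ^ 2))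
        rw [← this]
        simp [hQ, hq]
      rw [e, abs_of_nonpos hw]
      have := abs_mul_integral_Ioi_le (k := fun x => k (-x)) (fun x => hkb _) (w := -w)
        (by linarith)
      simpa using this
  set ψ : ℝ → ℝ := fun w => Real.exp ((1 / 2) * w ^ 2) * Q w with hψ
  have hexp : ∀ w : ℝ, Real.exp ((1 / 2) * w ^ 2) * Real.exp (-(1 / 2) * w ^ 2) = 1 := fun w => by
    rw [← Real.exp_add]; ring_nf; simp
  have hψd : ∀ w, HasDerivAt ψ (w * ψ w + k w) w := fun w => by
    have h2 : HasDerivAt (fun w : ℝ => Real.exp ((1 / 2) * w ^ 2))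
        (Real.exp ((1 / 2) * w ^ 2) * w) w := by
      convert! ((hasDerivAt_pow 2 w).const_mul (1 / 2 : ℝ)).exp using 1
      simp
    convert! h2.mul (hQd w) using 1
    simp only [hψ, hq]
    linear_combination (-k w) * hexp w
  have hd : ∀ w, deriv ψ w = w * ψ w + k w := fun w => (hψd w).deriv
  have hdiff : Differentiable ℝ ψ := fun w => (hψd w).differentiableAt
  refine ⟨ψ, contDiff_one_iff_deriv.2 ⟨hdiff, ?_⟩, hd, fun w => ?_⟩
  · have e : deriv ψ = fun w => w * ψ w + k w := funext hd
    rw [e]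
    exact (continuous_id.mul hdiff.continuous).add hkc
  · rw [hd]
    have : |w * ψ w| ≤ 1 := by
      rw [show w * ψ w = Real.exp ((1 / 2) * w ^ 2) * (w * Q w) by simp only [hψ]; ring, abs_mul,
        abs_of_pos (Real.exp_pos _)]
      refine le_trans ?_ (hexp w).le
      exact mul_le_mul_of_nonneg_left (hQb w) (Real.exp_pos _).le
    linarith [abs_add_le (w * ψ w) (k w), hkb w]

variable {S : Matrix (Fin d) (Fin d) ℝ} {G : E d → ℝ} {CG CG' : ℝ}

/-- The average of `|⟨Σ ∇G(U), ∇G(cos α U - sin α V)⟩ - v|` for independent `U`, `V` with law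
`N(0, Σ)`. -/
def gradientDefect (S : Matrix (Fin d) (Fin d) ℝ) (G : E d → ℝ) (v α : ℝ) : ℝ :=
  ∫ p : E d × E d, |fderiv ℝ G (Real.cos α • p.1 - Real.sin α • p.2)
      (covOp S (gradient G p.1)) - v|
    ∂((multivariateGaussian 0 S).prod (multivariateGaussian 0 S))

lemma abs_fderiv_covOp_le (hCG' : ∀ x, ‖fderiv ℝ G x‖ ≤ CG') (x y : E d) :
    |fderiv ℝ G x (covOp S (gradient G y))| ≤ CG' * (‖covOp S‖ * CG') := by
  have h0 : 0 ≤ CG' := (norm_nonneg _).trans (hCG' 0)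
  rw [← Real.norm_eq_abs]
  refine (ContinuousLinearMap.le_opNorm _ _).trans ?_
  refine mul_le_mul (hCG' _) ?_ (norm_nonneg _) h0
  refine (ContinuousLinearMap.le_opNorm _ _).trans ?_
  rw [norm_gradient_eq]
  exact mul_le_mul_of_nonneg_left (hCG' _) (norm_nonneg _)

lemma integrable_gradientPair (hG : ContDiff ℝ 1 G) (hCG' : ∀ x, ‖fderiv ℝ G x‖ ≤ CG') (α : ℝ) :
    Integrable (fun p : E d × E d => fderiv ℝ G (Real.cos α • p.1 - Real.sin α • p.2)
      (covOp S (gradient G p.1)))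
      ((multivariateGaussian 0 S).prod (multivariateGaussian 0 S)) := by
  have hfG := hG.continuous_fderiv one_ne_zero
  have hcG := continuous_gradient hG
  exact (integrable_const (CG' * (‖covOp S‖ * CG'))).mono'
    (Continuous.aestronglyMeasurable (by fun_prop))
    (Filter.Eventually.of_forall fun p => abs_fderiv_covOp_le hCG' _ _)

lemma variance_le_of_gradientDefect (hS : S.PosDef) (hG : ContDiff ℝ 1 G)
    (hCG : ∀ x, |G x| ≤ CG) (hCG' : ∀ x, ‖fderiv ℝ G x‖ ≤ CG') {v δ : ℝ}
    (hδ : ∀ α, gradientDefect S G v α ≤ δ) :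
    |∫ x, (G x - ∫ y, G y ∂(multivariateGaussian 0 S)) ^ 2 ∂(multivariateGaussian 0 S) - v| ≤
      Real.pi / 2 * δ := by
  set γ := multivariateGaussian 0 S with hγ
  set μ := ∫ y, G y ∂γ with hμ
  have hfd : ∀ x, fderiv ℝ (fun x => G x - μ) x = fderiv ℝ G x := fun x => by
    rw [fderiv_sub_const]
  have h := covariance_approx hS (F := fun x => G x - μ) (hG.sub contDiff_const) hG
    (CF := CG + |μ|) (fun x => (abs_sub _ _).trans (by gcongr; exact hCG x)) (CF' := CG')
    (fun x => by rw [hfd]; exact hCG' x) hCG hCG' (c := v) (δ := δ) (fun α => by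
      refine le_trans ?_ (hδ α)
      rw [crossGradient, gradientDefect]
      simp only [hfd]
      have e := integral_sub (integrable_gradientPair (S := S) hG hCG' α) (integrable_const v)
      simp only [integral_const, probReal_univ, smul_eq_mul, one_mul] at e
      rw [← e]
      exact abs_integral_le_integral_abs)
  simpa only [pow_two] using h

/-- Stein's method for `W = (G - E G)/σ`: apply the covariance formula to `F = ψ(W)`, whose gradient
is `ψ'(W)∇G/σ`. Replacing the gradient pairing by `σ²` turns the covariance with `G` into `σ E
ψ'(W)`, at a cost governed by `|ψ'| ≤ 2`. -/
lemma abs_integral_sub_gaussian_le (hS : S.PosDef) (hG : ContDiff ℝ 1 G)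
    (hCG : ∀ x, |G x| ≤ CG) (hCG' : ∀ x, ‖fderiv ℝ G x‖ ≤ CG') {σ δ : ℝ} (hσ : 0 < σ)
    (hδ : ∀ α, gradientDefect S G (σ ^ 2) α ≤ σ ^ 2 * δ) {h : ℝ → ℝ} (hc : Continuous h)
    (h0 : ∀ x, 0 ≤ h x) (h1 : ∀ x, h x ≤ 1) :
    |∫ x, h ((G x - ∫ y, G y ∂(multivariateGaussian 0 S)) / σ) ∂(multivariateGaussian 0 S) -
      ∫ z, h z ∂gaussianReal 0 1| ≤ Real.pi * δ := by
  set γ := multivariateGaussian 0 S with hγ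
  set μ := ∫ y, G y ∂γ with hμ
  obtain ⟨ψ, hψ, hψe, hψb⟩ := exists_stein_solution hc h0 h1
  set m := ∫ z, h z ∂gaussianReal 0 1 with hm
  have hψd : Differentiable ℝ ψ := hψ.differentiable one_ne_zero
  have hψ' : Continuous (deriv ψ) := hψ.continuous_deriv le_rfl
  set W : E d → ℝ := fun x => (G x - μ) / σ with hW
  have hWc : ContDiff ℝ 1 W := (hG.sub contDiff_const).div_const σ
  have hfG := hG.continuous_fderiv one_ne_zero
  have hcG := continuous_gradient hG
  have hWcont := hWc.continuous
  have hWb : ∀ x, |W x| ≤ (CG + |μ|) / σ := fun x => by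
    simp only [hW]
    rw [abs_div, abs_of_pos hσ]
    gcongr
    exact (abs_sub _ _).trans (by gcongr; exact hCG x)
  obtain ⟨B, hB⟩ := (isCompact_Icc (a := -((CG + |μ|) / σ))
    (b := (CG + |μ|) / σ)).exists_bound_of_continuousOn hψ.continuous.continuousOn
  have hFb : ∀ x, |ψ (W x)| ≤ B := fun x => hB _ (abs_le.1 (hWb x))
  have hfd : ∀ x, fderiv ℝ (fun x => ψ (W x)) x = (deriv ψ (W x) / σ) • fderiv ℝ G x := fun x => by
    have e1 : HasFDerivAt W (σ⁻¹ • fderiv ℝ G x) x := by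
      have := (((hG.differentiable one_ne_zero) x).hasFDerivAt.sub_const μ).mul_const σ⁻¹
      simpa [hW, div_eq_mul_inv] using this
    have e2 := (hψd (W x)).hasDerivAt.comp_hasFDerivAt x e1
    rw [smul_smul] at e2
    exact e2.fderiv
  have hi : ∀ α, Integrable (fun p : E d × E d =>
      deriv ψ (W (Real.cos α • p.1 - Real.sin α • p.2))) (γ.prod γ) := fun α =>
    (integrable_const (2 : ℝ)).mono' (Continuous.aestronglyMeasurable (by fun_prop))
      (Filter.Eventually.of_forall fun p => hψb _)
  -- The vector `cos α U - sin α V` has the law of `U`, so the comparison constant does not depend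
  -- on `α`.
  have hmp : ∀ α, ∫ p : E d × E d, deriv ψ (W (Real.cos α • p.1 - Real.sin α • p.2)) ∂(γ.prod γ) =
      ∫ x, deriv ψ (W x) ∂γ := fun α => by
    have hr := measurePreserving_rotate hS.posSemidef (d := d) α
    have e := integral_map (μ := γ.prod γ) hr.measurable.aemeasurable
      (f := fun p : E d × E d => deriv ψ (W p.1))
      (Continuous.aestronglyMeasurable (by fun_prop))
    rw [hr.map_eq] at e
    have e2 := integral_prod_mul (μ := γ) (ν := γ) (fun x => deriv ψ (W x)) (fun _ => (1 : ℝ))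
    simp only [mul_one, integral_const, probReal_univ, smul_eq_mul] at e2
    rw [← e2, e]
    rfl
  have hcov := covariance_approx hS (F := fun x => ψ (W x)) (hψ.comp hWc) hG hFb
    (CF' := 2 / σ * CG') (fun x => by
      rw [hfd, norm_smul, Real.norm_eq_abs, abs_div, abs_of_pos hσ]
      gcongr
      · exact hψb _
      · exact hCG' x) hCG hCG' (c := σ * ∫ x, deriv ψ (W x) ∂γ) (δ := 2 * σ * δ) (fun α => by
      rw [← hmp α, crossGradient]
      simp only [hfd]
      have ei : ∀ p : E d × E d,
          ((deriv ψ (W (Real.cos α • p.1 - Real.sin α • p.2)) / σ) •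
            fderiv ℝ G (Real.cos α • p.1 - Real.sin α • p.2)) (covOp S (gradient G p.1)) -
          σ * deriv ψ (W (Real.cos α • p.1 - Real.sin α • p.2)) =
          deriv ψ (W (Real.cos α • p.1 - Real.sin α • p.2)) / σ *
            (fderiv ℝ G (Real.cos α • p.1 - Real.sin α • p.2) (covOp S (gradient G p.1)) -
              σ ^ 2) := fun p => by
        rw [smul_apply, smul_eq_mul]
        field_simp
      have hgi := integrable_gradientPair (S := S) hG hCG' α
      have i1 : Integrable (fun p : E d × E d =>
          ((deriv ψ (W (Real.cos α • p.1 - Real.sin α • p.2)) / σ) •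
            fderiv ℝ G (Real.cos α • p.1 - Real.sin α • p.2)) (covOp S (gradient G p.1)))
          (γ.prod γ) := by
        refine hgi.bdd_mul (c := 2 / σ) (Continuous.aestronglyMeasurable (by fun_prop))
          (Filter.Eventually.of_forall fun p => ?_)
        rw [norm_div, Real.norm_of_nonneg hσ.le]
        gcongr
        exact hψb _
      rw [← integral_const_mul, ← integral_sub i1 ((hi α).const_mul σ)]
      simp only [ei]
      refine abs_integral_le_integral_abs.trans ?_
      calc _ ≤ ∫ p : E d × E d, 2 / σ * |fderiv ℝ G (Real.cos α • p.1 - Real.sin α • p.2)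
            (covOp S (gradient G p.1)) - σ ^ 2| ∂(γ.prod γ) := by
            refine integral_mono_of_nonneg (Filter.Eventually.of_forall fun _ => abs_nonneg _)
              ((hgi.sub (integrable_const _)).abs.const_mul _)
              (Filter.Eventually.of_forall fun p => ?_)
            simp only [abs_mul, abs_div, abs_of_pos hσ]
            gcongr
            exact hψb _
        _ = 2 / σ * gradientDefect S G (σ ^ 2) α := by rw [integral_const_mul]; rfl
        _ ≤ 2 / σ * (σ ^ 2 * δ) := by gcongr; exact hδ α
        _ = 2 * σ * δ := by field_simp)
  have i1 : Integrable (fun x => deriv ψ (W x)) γ := (integrable_const (2 : ℝ)).mono'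
    (Continuous.aestronglyMeasurable (by fun_prop)) (Filter.Eventually.of_forall fun p => hψb _)
  have i2 : Integrable (fun x => ψ (W x) * W x) γ := by
    refine (integrable_const (B * ((CG + |μ|) / σ))).mono'
      (Continuous.aestronglyMeasurable ?_) (Filter.Eventually.of_forall fun x => ?_)
    · have := hψ.continuous
      fun_prop
    · rw [norm_mul]
      exact mul_le_mul (hFb x) (hWb x) (abs_nonneg _) ((abs_nonneg _).trans (hFb 0))
  have i3 : Integrable (fun x => h (W x)) γ := (integrable_const (1 : ℝ)).mono'
    (Continuous.aestronglyMeasurable (by fun_prop)) (Filter.Eventually.of_forall fun x => by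
      rw [Real.norm_of_nonneg (h0 _)]; exact h1 _)
  have e3 : ∫ x, h (W x) ∂γ - m = ∫ x, deriv ψ (W x) ∂γ - ∫ x, ψ (W x) * W x ∂γ := by
    rw [← integral_sub i1 i2]
    have : ∀ x, deriv ψ (W x) - ψ (W x) * W x = h (W x) - m := fun x => by rw [hψe]; ring
    simp only [this]
    rw [integral_sub i3 (integrable_const _)]
    simp
  have e4 : ∫ x, ψ (W x) * (G x - μ) ∂γ = σ * ∫ x, ψ (W x) * W x ∂γ := by
    rw [← integral_const_mul]
    congr 1
    ext x
    simp only [hW]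
    field_simp
  rw [e4, ← mul_sub, abs_mul, abs_of_pos hσ] at hcov
  rw [e3, abs_sub_comm]
  refine le_of_mul_le_mul_left (hcov.trans_eq ?_) hσ
  ring

/-! ### From continuous test functions to distribution functions. -/

lemma tendsto_integral_apprSeq {F : Set ℝ} (hF : IsClosed F) (μ : Measure ℝ)
    [IsProbabilityMeasure μ] :
    Filter.Tendsto (fun n => ∫ x, (hF.apprSeq n x : ℝ) ∂μ) Filter.atTop (nhds (μ.real F)) := by
  have h := (ENNReal.tendsto_toReal (measure_ne_top μ F)).comp
    (HasOuterApproxClosed.tendsto_lintegral_apprSeq hF μ)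
  refine h.congr fun n => ?_
  exact BoundedContinuousFunction.toReal_lintegral_coe_eq_integral _ μ

/-- The bound is uniform over continuous functions with values in `[0, 1]`, so it survives the limit
along outer approximations of a closed set. -/
lemma abs_measureReal_sub_le {μ ν : Measure ℝ} [IsProbabilityMeasure μ] [IsProbabilityMeasure ν]
    {δ : ℝ} (hδ : ∀ h : ℝ → ℝ, Continuous h → (∀ x, 0 ≤ h x) → (∀ x, h x ≤ 1) →
      |∫ x, h x ∂μ - ∫ x, h x ∂ν| ≤ δ) {F : Set ℝ} (hF : IsClosed F) :
    |μ.real F - ν.real F| ≤ δ := by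
  refine le_of_tendsto ((tendsto_integral_apprSeq hF μ).sub (tendsto_integral_apprSeq hF ν)).abs
    (Filter.Eventually.of_forall fun n => ?_)
  refine hδ _ (NNReal.continuous_coe.comp (hF.apprSeq n).continuous) (fun x => NNReal.coe_nonneg _)
    fun x => ?_
  exact_mod_cast HasOuterApproxClosed.apprSeq_apply_le_one hF n x

lemma gaussianReal_Ioc_le (a b : ℝ) (hab : a ≤ b) :
    (gaussianReal 0 1).real (Set.Ioc a b) ≤ b - a := by
  have h : ∀ x, gaussianPDFReal 0 1 x ≤ 1 := fun x => by
    simp only [gaussianPDFReal, NNReal.coe_one, mul_one, sub_zero]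
    have h1 : 1 ≤ √(2 * Real.pi) := by
      rw [Real.one_le_sqrt]; linarith [Real.pi_gt_three]
    refine mul_le_one₀ (inv_le_one_of_one_le₀ h1) (Real.exp_pos _).le ?_
    rw [Real.exp_le_one_iff]
    have := sq_nonneg x
    linarith
  rw [Measure.real, gaussianReal_apply_eq_integral 0 one_ne_zero, ENNReal.toReal_ofReal
    (integral_nonneg fun x => gaussianPDFReal_nonneg _ _ _)]
  calc _ ≤ ∫ x in Set.Ioc a b, (1 : ℝ) := by
        refine integral_mono (integrable_gaussianPDFReal 0 1).integrableOn
          (by simp) fun x => h x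
    _ = b - a := by simp [hab]

lemma abs_gaussianReal_Iic_sub_le (a b : ℝ) :
    |(gaussianReal 0 1).real (Set.Iic a) - (gaussianReal 0 1).real (Set.Iic b)| ≤ |a - b| := by
  wlog hab : a ≤ b generalizing a b
  · rw [abs_sub_comm, abs_sub_comm a]
    exact this b a (le_of_not_ge hab)
  have h := measureReal_union (μ := gaussianReal 0 1) (s₁ := Set.Iic a) (s₂ := Set.Ioc a b)
    (Set.Iic_disjoint_Ioc le_rfl) measurableSet_Ioc
  rw [Set.Iic_union_Ioc_eq_Iic hab] at h
  rw [h, abs_sub_comm, add_sub_cancel_left, abs_of_nonneg measureReal_nonneg, abs_sub_comm,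
    abs_of_nonneg (sub_nonneg.2 hab)]
  exact gaussianReal_Ioc_le a b hab

/-- Centering at `a` instead of the mean only shifts the threshold by `(a - μ)/σ`, and the standard
normal distribution function is 1-Lipschitz. -/
lemma abs_measureReal_le_sub_gaussian (hS : S.PosDef) (hG : ContDiff ℝ 1 G)
    (hCG : ∀ x, |G x| ≤ CG) (hCG' : ∀ x, ‖fderiv ℝ G x‖ ≤ CG') {σ δ : ℝ} (hσ : 0 < σ)
    (hδ : ∀ α, gradientDefect S G (σ ^ 2) α ≤ σ ^ 2 * δ) (a t : ℝ) :
    |(multivariateGaussian 0 S).real {x | (G x - a) / σ ≤ t} -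
      (gaussianReal 0 1).real (Set.Iic t)| ≤
      Real.pi * δ + |∫ y, G y ∂(multivariateGaussian 0 S) - a| / σ := by
  set γ := multivariateGaussian 0 S with hγ
  set μ := ∫ y, G y ∂γ with hμ
  have hm : Measurable fun x => (G x - μ) / σ := by
    have := hG.continuous
    exact Continuous.measurable (by fun_prop)
  have := Measure.isProbabilityMeasure_map (μ := γ) hm.aemeasurable
  have h1 := abs_measureReal_sub_le (μ := γ.map fun x => (G x - μ) / σ) (ν := gaussianReal 0 1)
    (δ := Real.pi * δ) (fun h hc h0 h1 => by
      rw [integral_map hm.aemeasurable hc.aestronglyMeasurable]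
      exact abs_integral_sub_gaussian_le hS hG hCG hCG' hσ hδ hc h0 h1)
    (isClosed_Iic (a := t + (a - μ) / σ))
  rw [map_measureReal_apply hm measurableSet_Iic] at h1
  have e : (fun x => (G x - μ) / σ) ⁻¹' Set.Iic (t + (a - μ) / σ) =
      {x | (G x - a) / σ ≤ t} := by
    ext x
    simp only [Set.mem_preimage, Set.mem_Iic, Set.mem_ofPred_eq]
    rw [← sub_le_iff_le_add, ← sub_div]
    ring_nf
  rw [e] at h1
  have h2 := abs_gaussianReal_Iic_sub_le (t + (a - μ) / σ) t
  rw [add_sub_cancel_left, abs_div, abs_of_pos hσ, abs_sub_comm a] at h2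
  refine (abs_sub_le _ _ _).trans (add_le_add h1 h2)

end Stein

/-! ### Bounds for the covariance operator -/

section Operator

variable {S : Matrix (Fin d) (Fin d) ℝ}

lemma abs_inner_covOp_le (hS : S.PosSemidef) (a b : E d) :
    |inner ℝ (covOp S a) b| ≤ √(quad S a) * √(quad S b) := by
  rw [← Real.sqrt_mul (quad_nonneg hS a)]
  refine Real.abs_le_sqrt ?_
  have h := discrim_le_zero (a := quad S b) (b := 2 * inner ℝ (covOp S a) b) (c := quad S a)
    fun x => by
      have := quad_nonneg hS ((1 : ℝ) • a + x • b)
      rw [quad_comb hS] at this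
      linarith
  rw [discrim] at h
  linarith

lemma quad_le (S : Matrix (Fin d) (Fin d) ℝ) (a : E d) : quad S a ≤ opNorm S * ‖a‖ ^ 2 := by
  refine (real_inner_le_norm _ _).trans ?_
  rw [pow_two, ← mul_assoc]
  exact mul_le_mul_of_nonneg_right (ContinuousLinearMap.le_opNorm _ _) (norm_nonneg _)

lemma sqrt_quad_le (S : Matrix (Fin d) (Fin d) ℝ) (a : E d) : √(quad S a) ≤ √(opNorm S) * ‖a‖ := by
  refine (Real.sqrt_le_sqrt (quad_le S a)).trans_eq ?_
  rw [Real.sqrt_mul (x := opNorm S) (norm_nonneg _), Real.sqrt_sq (norm_nonneg _)]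

lemma sum_quad_single (S : Matrix (Fin d) (Fin d) ℝ) :
    ∑ i, quad S (EuclideanSpace.single i (1 : ℝ)) = S.trace := by
  simp only [Matrix.trace, Matrix.diag]
  refine Finset.sum_congr rfl fun i _ => ?_
  rw [quad_eq, EuclideanSpace.inner_single_right, covOp, Matrix.ofLp_toEuclideanCLM]
  simp

/-- Cauchy–Schwarz for the form of `Σ` bounds each coordinate of `Σx`; summing, `‖Σx‖² ≤ tr Σ · ⟨Σx,
x⟩ ≤ tr Σ · ‖Σx‖ ‖x‖`. -/
lemma opNorm_le_trace (hS : S.PosSemidef) : opNorm S ≤ S.trace := by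
  have hT : 0 ≤ S.trace := hS.trace_nonneg
  refine ContinuousLinearMap.opNorm_le_bound _ hT fun x => ?_
  change ‖covOp S x‖ ≤ _
  rcases eq_or_ne (covOp S x) 0 with h0 | h0
  · rw [h0, norm_zero]; positivity
  have h1 : ‖covOp S x‖ ^ 2 ≤ S.trace * quad S x := by
    rw [EuclideanSpace.norm_sq_eq, ← sum_quad_single, Finset.sum_mul]
    refine Finset.sum_le_sum fun i _ => ?_
    have h := abs_inner_covOp_le hS x (EuclideanSpace.single i 1)
    rw [EuclideanSpace.inner_single_right] at h
    simp only [RCLike.conj_to_real, one_mul] at h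
    have h' := pow_le_pow_left₀ (abs_nonneg _) h 2
    rw [mul_pow, Real.sq_sqrt (quad_nonneg hS _), Real.sq_sqrt (quad_nonneg hS _)] at h'
    rw [Real.norm_eq_abs]
    linarith
  have h2 : quad S x ≤ ‖covOp S x‖ * ‖x‖ := real_inner_le_norm _ _
  have h3 : ‖covOp S x‖ * ‖covOp S x‖ ≤ ‖covOp S x‖ * (S.trace * ‖x‖) := by
    nlinarith [mul_le_mul_of_nonneg_left h2 hT]
  exact le_of_mul_le_mul_left h3 (norm_pos_iff.2 h0)

end Operator

/-! ### The defect of the gradient -/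

lemma sq_integral_le {Ω : Type*} [MeasurableSpace Ω] {P : Measure Ω} [IsProbabilityMeasure P]
    {X : Ω → ℝ} (hX : MemLp X 2 P) : (∫ x, X x ∂P) ^ 2 ≤ ∫ x, X x ^ 2 ∂P := by
  have h := variance_nonneg X P
  rw [variance_eq_sub hX] at h
  simpa using h

section Defect

variable {S : Matrix (Fin d) (Fin d) ℝ} {G : E d → ℝ} {CG' : ℝ}

lemma abs_fderiv_covOp_sub_le (hS : S.PosSemidef) (c : E d) (x y : E d) :
    |fderiv ℝ G x (covOp S (gradient G y)) - quad S c| ≤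
      √(quad S c) * √(opNorm S) * (‖gradient G x - c‖ + ‖gradient G y - c‖) +
        opNorm S * (‖gradient G x - c‖ * ‖gradient G y - c‖) := by
  set q := gradient G x - c with hq
  set p := gradient G y - c with hp
  have e : fderiv ℝ G x (covOp S (gradient G y)) - quad S c =
      inner ℝ (covOp S c) q + inner ℝ (covOp S c) p + inner ℝ (covOp S p) q := by
    have hx : gradient G x = c + q := by simp [hq]
    have hy : gradient G y = c + p := by simp [hp]
    rw [← inner_gradient_eq, hx, hy, quad_eq, map_add, inner_add_left, inner_add_right,
      inner_add_right, ← covOp_symm hS c p, real_inner_comm _ c, real_inner_comm _ q,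
      real_inner_comm _ q]
    ring
  rw [e]
  have h1 := (abs_inner_covOp_le hS c q).trans
    (mul_le_mul_of_nonneg_left (sqrt_quad_le S q) (Real.sqrt_nonneg _))
  have h2 := (abs_inner_covOp_le hS c p).trans
    (mul_le_mul_of_nonneg_left (sqrt_quad_le S p) (Real.sqrt_nonneg _))
  have h3 : |inner ℝ (covOp S p) q| ≤ opNorm S * (‖q‖ * ‖p‖) := by
    refine (abs_real_inner_le_norm _ _).trans ?_
    calc _ ≤ opNorm S * ‖p‖ * ‖q‖ :=
          mul_le_mul_of_nonneg_right (ContinuousLinearMap.le_opNorm _ _) (norm_nonneg _)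
      _ = _ := by ring
  refine (abs_add_three _ _ _).trans ?_
  linarith

lemma memLp_norm_gradient_sub (hG : ContDiff ℝ 1 G) (hCG' : ∀ x, ‖fderiv ℝ G x‖ ≤ CG') (c : E d)
    (P : Measure (E d)) [IsFiniteMeasure P] : MemLp (fun x => ‖gradient G x - c‖) 2 P := by
  have hcG := continuous_gradient hG
  refine MemLp.of_bound (Continuous.aestronglyMeasurable (by fun_prop)) (CG' + ‖c‖)
    (Filter.Eventually.of_forall fun x => ?_)
  rw [norm_norm]
  refine (norm_sub_le _ _).trans ?_
  rw [norm_gradient_eq]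
  gcongr
  exact hCG' x

/-- Both points at which the gradient is taken have law `N(0, Σ)`, so the dependence between them is
irrelevant: only the `L²` distance of `∇G` from the constant `c` enters. -/
lemma gradientDefect_le (hS : S.PosSemidef) (hG : ContDiff ℝ 1 G)
    (hCG' : ∀ x, ‖fderiv ℝ G x‖ ≤ CG') (c : E d) {η : ℝ} (hη : 0 ≤ η)
    (h : ∫ x, ‖gradient G x - c‖ ^ 2 ∂(multivariateGaussian 0 S) ≤ η ^ 2) (α : ℝ) :
    gradientDefect S G (quad S c) α ≤
      2 * (√(quad S c) * √(opNorm S) * η) + opNorm S * η ^ 2 := by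
  set γ := multivariateGaussian 0 S with hγ
  have hcG := continuous_gradient hG
  have hm := memLp_norm_gradient_sub hG hCG' c γ
  have h1 : ∫ x, ‖gradient G x - c‖ ∂γ ≤ η :=
    abs_le_of_sq_le_sq' ((sq_integral_le hm).trans h) hη |>.2
  have hr := measurePreserving_rotate hS (d := d) α
  set Y : E d × E d → E d := fun p => Real.cos α • p.1 - Real.sin α • p.2 with hY
  have hYm : MeasurePreserving Y (γ.prod γ) γ := measurePreserving_fst.comp hr
  have hXm : MeasurePreserving (Prod.fst : E d × E d → E d) (γ.prod γ) γ := measurePreserving_fst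
  have i1 := hm.integrable one_le_two
  have i2 := hm.integrable_sq
  have iY1 : Integrable (fun p => ‖gradient G (Y p) - c‖) (γ.prod γ) :=
    hYm.integrable_comp_of_integrable i1
  have iY2 : Integrable (fun p => ‖gradient G (Y p) - c‖ ^ 2) (γ.prod γ) :=
    hYm.integrable_comp_of_integrable i2
  have iX1 : Integrable (fun p : E d × E d => ‖gradient G p.1 - c‖) (γ.prod γ) :=
    hXm.integrable_comp_of_integrable i1
  have iX2 : Integrable (fun p : E d × E d => ‖gradient G p.1 - c‖ ^ 2) (γ.prod γ) :=
    hXm.integrable_comp_of_integrable i2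
  have key : ∀ (Z : E d × E d → E d), MeasurePreserving Z (γ.prod γ) γ → ∀ (φ : E d → ℝ),
      Continuous φ → ∫ p, φ (Z p) ∂(γ.prod γ) = ∫ x, φ x ∂γ := fun Z hZ φ hφ => by
    have e := integral_map (μ := γ.prod γ) hZ.measurable.aemeasurable (f := φ)
      hφ.aestronglyMeasurable
    rw [hZ.map_eq] at e
    exact e.symm
  have eY1 := key Y hYm (fun x => ‖gradient G x - c‖) (by fun_prop)
  have eY2 := key Y hYm (fun x => ‖gradient G x - c‖ ^ 2) (by fun_prop)
  have eX1 := key _ hXm (fun x => ‖gradient G x - c‖) (by fun_prop)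
  have eX2 := key _ hXm (fun x => ‖gradient G x - c‖ ^ 2) (by fun_prop)
  have hL : 0 ≤ opNorm S := norm_nonneg _
  have iS1 : Integrable (fun p : E d × E d => ‖gradient G (Y p) - c‖ + ‖gradient G p.1 - c‖)
    (γ.prod γ) := iY1.add iX1
  have iS2 : Integrable (fun p : E d × E d => ‖gradient G (Y p) - c‖ ^ 2 +
    ‖gradient G p.1 - c‖ ^ 2) (γ.prod γ) := iY2.add iX2
  calc gradientDefect S G (quad S c) α
      ≤ ∫ p : E d × E d, (√(quad S c) * √(opNorm S) *
          (‖gradient G (Y p) - c‖ + ‖gradient G p.1 - c‖) +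
          opNorm S * (1 / 2 * (‖gradient G (Y p) - c‖ ^ 2 + ‖gradient G p.1 - c‖ ^ 2)))
          ∂(γ.prod γ) := by
        refine integral_mono_of_nonneg (Filter.Eventually.of_forall fun _ => abs_nonneg _)
          ((iS1.const_mul _).add ((iS2.const_mul _).const_mul _))
          (Filter.Eventually.of_forall fun p => ?_)
        refine (abs_fderiv_covOp_sub_le hS c (Y p) p.1).trans ?_
        have : ‖gradient G (Y p) - c‖ * ‖gradient G p.1 - c‖ ≤
            1 / 2 * (‖gradient G (Y p) - c‖ ^ 2 + ‖gradient G p.1 - c‖ ^ 2) := by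
          nlinarith [sq_nonneg (‖gradient G (Y p) - c‖ - ‖gradient G p.1 - c‖)]
        exact add_le_add_right (mul_le_mul_of_nonneg_left this hL) _
    _ = √(quad S c) * √(opNorm S) * (2 * ∫ x, ‖gradient G x - c‖ ∂γ) +
          opNorm S * ∫ x, ‖gradient G x - c‖ ^ 2 ∂γ := by
        rw [integral_add (iS1.const_mul _) ((iS2.const_mul _).const_mul _),
          integral_const_mul, integral_const_mul, integral_const_mul, integral_add iY1 iX1,
          integral_add iY2 iX2, eY1, eY2, eX1, eX2]
        ring
    _ ≤ √(quad S c) * √(opNorm S) * (2 * η) + opNorm S * η ^ 2 := by gcongr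
    _ = _ := by ring

/-- Compare the gradient with its own mean by the Lipschitz bound, then the mean with `L`. The three
terms `M‖x‖`, `M E‖ξ‖` and `r` each have second moment at most the square of the maximum, whence the
factor 3. -/
lemma integral_norm_fderiv_sub_sq_le (hS : S.PosSemidef) (hG : ContDiff ℝ 1 G)
    (hCG' : ∀ x, ‖fderiv ℝ G x‖ ≤ CG') {M r : ℝ} (hM : 0 ≤ M)
    (hL : ∀ x y, ‖fderiv ℝ G x - fderiv ℝ G y‖ ≤ M * ‖x - y‖) (L : E d →L[ℝ] ℝ)
    (hr : ‖∫ x, fderiv ℝ G x ∂(multivariateGaussian 0 S) - L‖ ≤ r) :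
    ∫ x, ‖fderiv ℝ G x - L‖ ^ 2 ∂(multivariateGaussian 0 S) ≤
      (3 * max (√S.trace * M) r) ^ 2 := by
  set γ := multivariateGaussian 0 S with hγ
  set D := max (√S.trace * M) r with hD
  have hT : 0 ≤ S.trace := hS.trace_nonneg
  have hid : MemLp (fun x : E d => ‖x‖) 2 γ := (memLp_two_centered S).norm
  have hfG := hG.continuous_fderiv one_ne_zero
  have iG : Integrable (fun x => fderiv ℝ G x) γ := (integrable_const CG').mono'
    hfG.aestronglyMeasurable (Filter.Eventually.of_forall hCG')
  have i1 : Integrable (fun x : E d => ‖x‖) γ := hid.integrable one_le_two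
  have i2 : Integrable (fun x : E d => ‖x‖ ^ 2) γ := hid.integrable_sq
  set m := ∫ x, ‖x‖ ∂γ with hm
  have hm0 : 0 ≤ m := integral_nonneg fun _ => norm_nonneg _
  have hm2 : m ^ 2 ≤ S.trace := (sq_integral_le hid).trans_eq (integral_norm_sq_centered hS)
  have hr0 : 0 ≤ r := (norm_nonneg _).trans hr
  have hpt : ∀ x, ‖fderiv ℝ G x - L‖ ≤ M * ‖x‖ + M * m + r := fun x => by
    have e : fderiv ℝ G x - ∫ y, fderiv ℝ G y ∂γ = ∫ y, (fderiv ℝ G x - fderiv ℝ G y) ∂γ := by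
      rw [integral_sub (integrable_const _) iG]; simp
    have h1 : ‖fderiv ℝ G x - ∫ y, fderiv ℝ G y ∂γ‖ ≤ M * ‖x‖ + M * m := by
      rw [e]
      have e2 : M * ‖x‖ + M * m = ∫ y, (M * ‖x‖ + M * ‖y‖) ∂γ := by
        rw [integral_add (integrable_const _) (i1.const_mul M), integral_const,
          integral_const_mul, probReal_univ, one_smul]
      rw [e2]
      refine norm_integral_le_of_norm_le ((integrable_const _).add (i1.const_mul M))
        (Filter.Eventually.of_forall fun y => (hL x y).trans ?_)
      rw [← mul_add]
      gcongr
      exact norm_sub_le _ _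
    refine (norm_sub_le_norm_sub_add_norm_sub _ (∫ y, fderiv ℝ G y ∂γ) _).trans ?_
    linarith
  have hD1 : S.trace * M ^ 2 ≤ D ^ 2 := by
    have := pow_le_pow_left₀ (by positivity) (le_max_left (√S.trace * M) r) 2
    rwa [mul_pow, Real.sq_sqrt hT] at this
  have hD2 : r ^ 2 ≤ D ^ 2 := pow_le_pow_left₀ hr0 (le_max_right _ _) 2
  calc ∫ x, ‖fderiv ℝ G x - L‖ ^ 2 ∂γ
      ≤ ∫ x, (3 * M ^ 2 * ‖x‖ ^ 2 + (3 * M ^ 2 * m ^ 2 + 3 * r ^ 2)) ∂γ := by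
        refine integral_mono_of_nonneg (Filter.Eventually.of_forall fun _ => sq_nonneg _)
          ((i2.const_mul _).add (integrable_const _)) (Filter.Eventually.of_forall fun x => ?_)
        refine (pow_le_pow_left₀ (norm_nonneg _) (hpt x) 2).trans ?_
        nlinarith [sq_nonneg (M * ‖x‖ - M * m), sq_nonneg (M * ‖x‖ - r), sq_nonneg (M * m - r)]
    _ = 3 * M ^ 2 * S.trace + (3 * M ^ 2 * m ^ 2 + 3 * r ^ 2) := by
        rw [integral_add (i2.const_mul _) (integrable_const _), integral_const_mul,
          integral_norm_sq_centered hS]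
        simp
    _ ≤ (3 * D) ^ 2 := by nlinarith [mul_le_mul_of_nonneg_left hm2 (sq_nonneg M)]

lemma norm_gradient_sub_gradient (G f : E d → ℝ) (x y : E d) :
    ‖gradient G x - gradient f y‖ = ‖fderiv ℝ G x - fderiv ℝ f y‖ := by
  rw [gradient, gradient, ← map_sub, LinearIsometryEquiv.norm_map]

end Defect

/-! ### The norm of the Hessian -/

/-- Polarization together with the parallelogram law, which loses no constant in a Hilbert space. It
converts `hessianNorm`, defined by the quadratic form, into a Lipschitz constant for the gradient.
-/
lemma norm_le_of_diag_le {B : E d →L[ℝ] E d →L[ℝ] ℝ} (hB : ∀ v w, B v w = B w v) {M : ℝ}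
    (hM : 0 ≤ M) (h : ∀ v, ‖v‖ = 1 → |B v v| ≤ M) : ‖B‖ ≤ M := by
  have h1 : ∀ v, |B v v| ≤ M * ‖v‖ ^ 2 := fun v => by
    rcases eq_or_ne v 0 with rfl | hv
    · simp
    have hv' : 0 < ‖v‖ := norm_pos_iff.2 hv
    have := h (‖v‖⁻¹ • v) (by rw [norm_smul, norm_inv, norm_norm, inv_mul_cancel₀ hv'.ne'])
    simp only [map_smul, smul_apply, smul_eq_mul, abs_mul, abs_inv, abs_norm] at this
    rw [← mul_assoc, ← mul_inv, inv_mul_le_iff₀ (by positivity)] at this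
    linarith
  have h2 : ∀ v w, ‖v‖ = 1 → ‖w‖ = 1 → |B v w| ≤ M := fun v w hv hw => by
    have e : 4 * B v w = B (v + w) (v + w) - B (v - w) (v - w) := by
      simp only [map_add, map_sub, add_apply, sub_apply]
      rw [hB w v]
      ring
    have hp := parallelogram_law_with_norm ℝ v w
    rw [hv, hw] at hp
    have := (abs_sub _ _).trans (add_le_add (h1 (v + w)) (h1 (v - w)))
    rw [← e, abs_mul, abs_of_pos (by norm_num : (0 : ℝ) < 4)] at this
    nlinarith
  refine ContinuousLinearMap.opNorm_le_of_unit_norm hM fun v hv => ?_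
  exact ContinuousLinearMap.opNorm_le_of_unit_norm hM fun w hw => h2 v w hv hw

lemma norm_fderiv_sub_le_of_hessianNorm {g : E d → ℝ} (hg : ContDiff ℝ ∞ g)
    (hH : hessianNorm g ≠ ⊤) (x y : E d) :
    ‖fderiv ℝ g x - fderiv ℝ g y‖ ≤ (hessianNorm g).toReal * ‖x - y‖ := by
  have hg2 : ContDiff ℝ 2 g := contDiff_infty.1 hg 2
  have hd : Differentiable ℝ (fderiv ℝ g) :=
    (hg2.fderiv_right (m := 1) (by norm_num)).differentiable one_ne_zero
  refine Convex.norm_image_sub_le_of_norm_fderiv_le (𝕜 := ℝ) (s := Set.univ)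
    (fun z _ => hd z) (fun z _ => ?_) convex_univ (Set.mem_univ y) (Set.mem_univ x)
  refine norm_le_of_diag_le (fun v w => ?_) ENNReal.toReal_nonneg fun v hv => ?_
  · exact (hg2.contDiffAt.isSymmSndFDerivAt (by simp)) v w
  · have h1 : ‖iteratedFDeriv ℝ 2 g z ![v, v]‖ₑ ≤ hessianNorm g := by
      refine le_trans ?_ (le_iSup _ z)
      exact le_iSup₂ (f := fun (w : E d) (_ : w ∈ Metric.sphere (0 : E d) 1) =>
        ‖iteratedFDeriv ℝ 2 g z ![w, w]‖ₑ) v (by simpa using hv)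
    rw [iteratedFDeriv_two_apply] at h1
    have h2 := ENNReal.toReal_mono hH h1
    simpa using h2

/-! ### The truncation level -/

section Level

variable {S : Matrix (Fin d) (Fin d) ℝ}

lemma opNorm_mul_effRank (h : 0 < opNorm S) : opNorm S * effRank S = S.trace := by
  rw [effRank]; field_simp

/-- Since `‖Σ‖ r(Σ) = tr Σ`, the level is `⌈L/2 - 1⌉` with `L = log₂(1 / tr Σ)`. So retained
frequencies are at most `2/√(tr Σ)`, while discarded blocks start at an index `j` with `2^j ≥ 1/√(tr
Σ)`. -/
lemma level_bounds (h : 0 < opNorm S) (hT : 0 < S.trace) :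
    Real.logb 2 (1 / S.trace) / 2 ≤ level S + 1 ∧
      (level S : ℝ) ≤ Real.logb 2 (1 / S.trace) / 2 := by
  have e : Real.logb 2 (1 / opNorm S) - Real.logb 2 (effRank S) = Real.logb 2 (1 / S.trace) := by
    have hr : effRank S ≠ 0 := by rw [effRank]; positivity
    rw [← Real.logb_div (by positivity) hr, ← opNorm_mul_effRank h]
    congr 1
    field_simp
  have h1 := Int.le_ceil ((Real.logb 2 (1 / opNorm S) - Real.logb 2 (effRank S) - 2) / 2)
  have h2 := Int.ceil_lt_add_one ((Real.logb 2 (1 / opNorm S) - Real.logb 2 (effRank S) - 2) / 2)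
  rw [e] at h1 h2
  rw [level, e]
  constructor <;> linarith

lemma rpow_logb_half {T : ℝ} (hT : 0 < T) : (2 : ℝ) ^ (Real.logb 2 (1 / T) / 2) = (√T)⁻¹ := by
  rw [div_eq_mul_one_div, Real.rpow_mul zero_le_two,
    Real.rpow_logb two_pos (by norm_num) (by positivity), ← Real.sqrt_eq_rpow, one_div,
    Real.sqrt_inv]

lemma two_pow_le_of_lt_level (h : 0 < opNorm S) (hT : 0 < S.trace) {j : ℕ}
    (hj : j < (level S + 1).toNat) : (2 : ℝ) ^ (j + 1) ≤ 2 / √S.trace := by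
  have hj' : (j : ℤ) ≤ level S := by omega
  have hj'' : (j : ℝ) ≤ level S := by exact_mod_cast hj'
  have h1 := Real.rpow_le_rpow_of_exponent_le one_le_two (hj''.trans (level_bounds h hT).2)
  rw [rpow_logb_half hT, Real.rpow_natCast] at h1
  rw [pow_succ, div_eq_mul_inv]
  linarith

lemma two_rpow_neg_level_le (h : 0 < opNorm S) (hT : 0 < S.trace) {s : ℝ} (hs : 0 ≤ s) :
    (2 : ℝ) ^ (-(((level S + 1).toNat : ℝ) * s)) ≤ S.trace ^ (s / 2) := by
  -- Truncation to natural numbers only increases `N + 1`, so an empty range of indices needs no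
  -- separate case.
  have hn : (level S : ℝ) + 1 ≤ ((level S + 1).toNat : ℝ) := by
    exact_mod_cast Int.self_le_toNat (level S + 1)
  have h1 := (level_bounds h hT).1.trans hn
  have h2 : (2 : ℝ) ^ (-(((level S + 1).toNat : ℝ) * s)) ≤
      2 ^ (-(Real.logb 2 (1 / S.trace) / 2 * s)) :=
    Real.rpow_le_rpow_of_exponent_le one_le_two
      (neg_le_neg (mul_le_mul_of_nonneg_right h1 hs))
  refine h2.trans_eq ?_
  rw [← neg_mul, Real.rpow_mul zero_le_two, Real.rpow_neg zero_le_two, rpow_logb_half hT, inv_inv,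
    Real.sqrt_eq_rpow, ← Real.rpow_mul hT.le]
  congr 1
  ring

end Level

/-! ### Heat symbols -/

lemma quad_smul (S : Matrix (Fin d) (Fin d) ℝ) (c : ℝ) (ζ : E d) :
    quad S (c • ζ) = c ^ 2 * quad S ζ := by
  rw [quad_eq, quad_eq, map_smul, inner_smul_left, inner_smul_right, RCLike.conj_to_real]
  ring

/-- The function `ζ ↦ (∑_{j < n} φ_j(ζ)) e^{t⟨Sζ,ζ⟩}`. -/
def heatProfile (R : DyadicResolution d) (S : Matrix (Fin d) (Fin d) ℝ) (n : ℕ) (t : ℝ)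
    (ζ : E d) : ℂ :=
  (∑ j ∈ Finset.range n, R.φ j ζ) * (Real.exp (t * quad S ζ) : ℂ)

section Heat

variable (R : DyadicResolution d) (S : Matrix (Fin d) (Fin d) ℝ) (n : ℕ) (t : ℝ)

lemma heatProfile_contDiff : ContDiff ℝ ∞ (heatProfile R S n t) := by
  have h1 : ContDiff ℝ ∞ (fun ζ : E d => ∑ j ∈ Finset.range n, R.φ j ζ) :=
    ContDiff.sum fun j _ => (R.φ j).smooth ⊤
  have h2 : ContDiff ℝ ∞ (fun ζ : E d => quad S ζ) :=
    (ContinuousLinearMap.contDiff _).inner ℝ contDiff_id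
  exact h1.mul (Complex.ofRealCLM.contDiff.comp (contDiff_const.mul h2).exp)

lemma heatProfile_hasCompactSupport : HasCompactSupport (heatProfile R S n t) := by
  have h : HasCompactSupport (fun ζ : E d => ∑ j ∈ Finset.range n, R.φ j ζ) := by
    induction n with
    | zero =>
      simp only [Finset.range_zero, Finset.sum_empty]
      exact HasCompactSupport.zero
    | succ n ih =>
      simp only [Finset.sum_range_succ]
      exact ih.add (R.hasCompactSupport n)
  exact h.mul_right

/-- The Schwartz function `ν ↦ (∑_{j < n} φ_j(2πν)) e^{t⟨S2πν,2πν⟩}`. -/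
def heatSymbol : 𝓢(E d, ℂ) :=
  symbol (heatProfile R S n t) (heatProfile_contDiff R S n t) (heatProfile_hasCompactSupport R S n t)

variable {R S n t}

lemma heatSymbol_apply (ν : E d) : heatSymbol R S n t ν =
    (∑ j ∈ Finset.range n, R.φ j ((2 * Real.pi) • ν)) *
      (Real.exp (t * quad S ((2 * Real.pi) • ν)) : ℂ) := symbol_apply _ _ _ _

/-- Averaging over the shifts `c ξ` runs the heat flow forward, lowering the exponent `t` by `c²/2`.
-/
lemma heatSymbol_eq_charFun_mul (hS : S.PosSemidef) {c t t' : ℝ} (ht : t = t' - c ^ 2 / 2)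
    (ν : E d) : heatSymbol R S n t ν =
      charFun (multivariateGaussian 0 S) ((2 * Real.pi * c) • ν) * heatSymbol R S n t' ν := by
  rw [charFun_centered hS, heatSymbol_apply, heatSymbol_apply, mul_left_comm, ← Complex.ofReal_exp,
    ← Complex.ofReal_mul, ← Real.exp_add, quad_smul, quad_smul, ht]
  congr 3
  ring

lemma norm_le_of_heatSymbol_ne_zero {r : ℝ} (hr : ∀ j < n, (2 : ℝ) ^ (j + 1) ≤ r) {ν : E d}
    (h : heatSymbol R S n t ν ≠ 0) : ‖(2 * Real.pi) • ν‖ ≤ r := by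
  rw [heatSymbol_apply] at h
  obtain ⟨j, hj, hj0⟩ := Finset.exists_ne_zero_of_sum_ne_zero (left_ne_zero_of_mul h)
  exact (R.norm_le_of_ne_zero hj0).trans (hr j (Finset.mem_range.1 hj))

variable {f : E d → ℝ} {C : ℝ} {u : 𝓢'(E d, ℂ)}

lemma cv_heatSymbol_zero (hu : IsGivenBy u f) (hC : ∀ x, |f x| ≤ C) (x : E d) :
    cv f (𝓕⁻ (heatSymbol R S n 0)) x = partialSum R u n x := by
  have e : heatSymbol R S n 0 = ∑ j ∈ Finset.range n, R.sym j := by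
    ext ν
    rw [heatSymbol_apply, sum_apply]
    simp [DyadicResolution.sym_apply]
  have e2 : 𝓕⁻ (∑ j ∈ Finset.range n, R.sym j) = ∑ j ∈ Finset.range n, 𝓕⁻ (R.sym j) :=
    map_sum (FourierTransform.fourierInvCLM ℂ 𝓢(E d, ℂ)) _ _
  rw [e, e2, partialSum, cv]
  simp only [block_eq_cv R hu, cv, sum_apply, Finset.smul_sum]
  exact integral_finsetSum _ fun j _ => cv_integrable hu.continuous.measurable hC _ _

lemma norm_cv_heatSymbol_le (hS : S.PosSemidef) (hf : Measurable f) (hC : ∀ x, |f x| ≤ C) {r : ℝ}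
    (hr0 : 0 < r) (hr : ∀ j < n, (2 : ℝ) ^ (j + 1) ≤ r) (hrT : r ^ 2 * S.trace ≤ 4) {H : ℝ}
    (hH : ∀ x, ‖cv f (𝓕⁻ (heatSymbol R S n 0)) x‖ ≤ H) (k : ℕ) (x : E d) :
    ‖cv f (𝓕⁻ (heatSymbol R S n (k / 16))) x‖ ≤ 2 ^ k * H := by
  induction k generalizing x with
  | zero => simpa using hH x
  | succ k ih =>
    -- The choice `c² = 1/8` advances `t` by `1/16` and makes `c² r² tr Σ ≤ 1/2` when `r² tr Σ ≤ 4`.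
    have hc : √(1 / 8 : ℝ) ^ 2 = 1 / 8 := Real.sq_sqrt (by norm_num)
    have hmean : ∫ ξ : E d, ξ ∂(multivariateGaussian 0 S) = 0 := by
      simp
    refine (heat_step (γ := multivariateGaussian 0 S) hf hC (√(1 / 8))
      (heatSymbol_eq_charFun_mul hS (by rw [hc]; push_cast; ring)) hr0
      (fun ν hν => norm_le_of_heatSymbol_ne_zero hr hν) (memLp_two_centered S) hmean ?_ ih
      x).trans_eq (by ring)
    rw [hc, integral_norm_sq_centered hS]
    linarith

end Heat

/-! ### The estimator and the truncation -/

lemma hasFDerivAt_integral_shift {g : E d → ℝ} (hg : ContDiff ℝ 1 g) {C C' : ℝ}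
    (hC : ∀ x, |g x| ≤ C) (hC' : ∀ x, ‖fderiv ℝ g x‖ ≤ C') (γ : Measure (E d))
    [IsFiniteMeasure γ] (x : E d) :
    HasFDerivAt (fun x => ∫ ξ, g (x + ξ) ∂γ) (∫ ξ, fderiv ℝ g (x + ξ) ∂γ) x := by
  have hc := hg.continuous
  have hfc := hg.continuous_fderiv one_ne_zero
  refine hasFDerivAt_integral_of_dominated_of_fderiv_le (F := fun x ξ => g (x + ξ))
    (F' := fun x ξ => fderiv ℝ g (x + ξ)) (bound := fun _ => C') Filter.univ_mem
    (Filter.Eventually.of_forall fun y => Continuous.aestronglyMeasurable (by fun_prop))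
    ((integrable_const C).mono' (Continuous.aestronglyMeasurable (by fun_prop))
      (Filter.Eventually.of_forall fun ξ => hC _))
    (Continuous.aestronglyMeasurable (by fun_prop))
    (Filter.Eventually.of_forall fun ξ y _ => hC' _) (integrable_const _)
    (Filter.Eventually.of_forall fun ξ y _ => ?_)
  have h1 : HasFDerivAt (fun y : E d => y + ξ) (ContinuousLinearMap.id ℝ (E d)) y :=
    (hasFDerivAt_id y).add_const ξ
  have h2 := ((hg.differentiable one_ne_zero) (y + ξ)).hasFDerivAt.comp y h1
  rwa [ContinuousLinearMap.comp_id] at h2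

section Estimator

variable {R : DyadicResolution d} {S : Matrix (Fin d) (Fin d) ℝ} {f : E d → ℝ} {C : ℝ}
  {u : 𝓢'(E d, ℂ)}

lemma estimator_eq (hu : IsGivenBy u f) (x : E d) : estimator R S u x =
    (cv f (𝓕⁻ (heatSymbol R S (level S + 1).toNat (1 / 2))) x).re := by
  rw [estimator, synth_eq_cv hu]
  congr 4
  ext ν
  rw [profile, heatProfile, indices]
  congr 3
  ring

lemma truncation_eq (x : E d) :
    truncation R S u x = (partialSum R u (level S + 1).toNat x).re := rfl

lemma estimator_contDiff (hu : IsGivenBy u f) (hC : ∀ x, |f x| ≤ C) :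
    ContDiff ℝ ∞ (estimator R S u) := by
  rw [funext (estimator_eq hu)]
  exact Complex.reCLM.contDiff.comp (cv_contDiff hu.continuous.measurable hC _)

lemma exists_fderiv_estimator_le (hu : IsGivenBy u f) (hC : ∀ x, |f x| ≤ C) :
    ∃ C', ∀ x, ‖fderiv ℝ (estimator R S u) x‖ ≤ C' := by
  rw [funext (estimator_eq hu)]
  set K := 𝓕⁻ (heatSymbol R S (level S + 1).toNat (1 / 2))
  refine ⟨‖Complex.reCLM‖ * (C * ∫ z, ‖SchwartzMap.fderivCLM ℝ (E d) ℂ K z‖), fun x => ?_⟩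
  have h := Complex.reCLM.hasFDerivAt.comp x (cv_hasFDerivAt hu.continuous.measurable hC K x)
  have e : fderiv ℝ (fun x => (cv f K x).re) x = _ := h.fderiv
  rw [e]
  refine (ContinuousLinearMap.opNorm_comp_le _ _).trans ?_
  gcongr
  exact cv_norm_le hC _ x

/-- The estimator is an exactly unbiased estimator of the truncation: averaging over the noise
removes the factor `e^{⟨Σζ,ζ⟩/2}`. -/
lemma integral_estimator_shift (hS : S.PosSemidef) (hu : IsGivenBy u f) (hC : ∀ x, |f x| ≤ C)
    (x : E d) : ∫ ξ, estimator R S u (x + ξ) ∂(multivariateGaussian 0 S) =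
      truncation R S u x := by
  have hf := hu.continuous.measurable
  have h := integral_cv_shift (γ := multivariateGaussian 0 S) hf hC (A := heatSymbol R S _ 0)
    (B := heatSymbol R S (level S + 1).toNat (1 / 2)) 1
    (heatSymbol_eq_charFun_mul hS (by norm_num)) x
  simp only [one_smul] at h
  rw [cv_heatSymbol_zero hu hC] at h
  rw [truncation_eq, ← h]
  simp only [estimator_eq hu]
  refine Complex.reCLM.integral_comp_comm
    ((integrable_const (C * ∫ z, ‖(𝓕⁻ (heatSymbol R S (level S + 1).toNat (1 / 2))) z‖)).mono' ?_
      (Filter.Eventually.of_forall fun ξ => cv_norm_le hC _ _))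
  have := (cv_contDiff hf hC (𝓕⁻ (heatSymbol R S (level S + 1).toNat (1 / 2)))).continuous
  exact Continuous.aestronglyMeasurable (by fun_prop)

lemma abs_estimator_le (hS : S.PosSemidef) (h0 : 0 < opNorm S) (hT : 0 < S.trace)
    (hu : IsGivenBy u f) (hC : ∀ x, |f x| ≤ C) {H : ℝ} (hH : ∀ n x, ‖partialSum R u n x‖ ≤ H)
    (x : E d) : |estimator R S u x| ≤ 256 * H := by
  rw [estimator_eq hu]
  refine (Complex.abs_re_le_norm _).trans ?_
  -- Eight steps of `1/16` reach the exponent `1/2`, and `2 ^ 8 = 256`.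
  have h := norm_cv_heatSymbol_le (R := R) (n := (level S + 1).toNat) hS hu.continuous.measurable hC
    (r := 2 / √S.trace) (by positivity) (fun j hj => two_pow_le_of_lt_level h0 hT hj)
    (by rw [div_pow, Real.sq_sqrt hT.le]; field_simp; norm_num)
    (fun x => by rw [cv_heatSymbol_zero hu hC]; exact hH _ x) 8 x
  norm_num at h ⊢
  exact h

lemma abs_sub_truncation_le {s : ℝ} (hs : 0 ≤ s) (h0 : 0 < opNorm S) (hT : 0 < S.trace)
    (hu : IsGivenBy u f) (hb : besovNorm R s u < ⊤) (x : E d) :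
    |f x - truncation R S u x| ≤ S.trace ^ (s / 2) * (besovNorm R s u).toReal := by
  have h := (partialSum_bounds hu hs hb).2.2 (level S + 1).toNat x
  have h1 := (Complex.abs_re_le_norm _).trans h
  rw [Complex.sub_re, Complex.ofReal_re, ← truncation_eq (S := S)] at h1
  refine h1.trans ?_
  gcongr
  exact two_rpow_neg_level_le h0 hT hs

/-- Differentiating the unbiasedness identity identifies the mean gradient of the estimator with the
gradient of the truncation, which `remainderNorm` compares with that of `f`. -/
lemma hasFDerivAt_truncation (hS : S.PosSemidef) (hu : IsGivenBy u f) (hC : ∀ x, |f x| ≤ C)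
    {H : ℝ} (hH : ∀ x, |estimator R S u x| ≤ H) (x : E d) :
    HasFDerivAt (truncation R S u)
      (∫ ξ, fderiv ℝ (estimator R S u) (x + ξ) ∂(multivariateGaussian 0 S)) x := by
  obtain ⟨C', hC'⟩ := exists_fderiv_estimator_le (R := R) (S := S) hu hC
  have h := hasFDerivAt_integral_shift ((estimator_contDiff hu hC).of_le (by simp)) hH hC'
    (multivariateGaussian 0 S) x
  simpa only [integral_estimator_shift hS hu hC] using h

lemma norm_integral_fderiv_sub_le (hS : S.PosSemidef) (hu : IsGivenBy u f)
    (hC : ∀ x, |f x| ≤ C) {H : ℝ} (hH : ∀ x, |estimator R S u x| ≤ H) {x : E d}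
    (hd : DifferentiableAt ℝ f x) (hr : remainderNorm R S u f ≠ ⊤) :
    ‖∫ ξ, fderiv ℝ (estimator R S u) (x + ξ) ∂(multivariateGaussian 0 S) - fderiv ℝ f x‖ ≤
      (remainderNorm R S u f).toReal := by
  have h := hd.hasFDerivAt.sub (hasFDerivAt_truncation (R := R) hS hu hC hH x)
  have h1 : ‖gradient (fun y => f y - truncation R S u y) x‖ₑ ≤ remainderNorm R S u f :=
    le_iSup (fun x => ‖gradient (fun y => f y - truncation R S u y) x‖ₑ) x
  have h2 := ENNReal.toReal_mono hr h1
  rw [toReal_enorm, norm_gradient_eq] at h2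
  have e : fderiv ℝ (fun y => f y - truncation R S u y) x = _ := h.fderiv
  rwa [e, norm_sub_rev] at h2

end Estimator

/-! ### The error of the estimator -/

lemma eLpNorm_two_le {X : Type*} [MeasurableSpace X] {P : Measure X} {h : X → ℝ}
    (hh : MemLp h 2 P) {A : ℝ} (hA : 0 ≤ A) (hle : ∫ x, h x ^ 2 ∂P ≤ A ^ 2) :
    eLpNorm h 2 P ≤ ENNReal.ofReal A := by
  rw [hh.eLpNorm_eq_integral_rpow_norm two_ne_zero ENNReal.ofNat_ne_top]
  refine ENNReal.ofReal_le_ofReal ?_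
  simp only [ENNReal.toReal_ofNat, Real.norm_eq_abs, Real.rpow_ofNat, sq_abs]
  rw [← one_div, ← Real.sqrt_eq_rpow]
  exact Real.sqrt_le_iff.2 ⟨hA, hle⟩

section Error

variable {R : DyadicResolution d} {S : Matrix (Fin d) (Fin d) ℝ} {f : E d → ℝ} {s : ℝ}
  {u : 𝓢'(E d, ℂ)} {θ : E d}

lemma stdDev_sq (hS : S.PosSemidef) : stdDev S f θ ^ 2 = quad S (gradient f θ) :=
  Real.sq_sqrt (quad_nonneg hS _)

lemma opNorm_pos_of_stdDev_pos (hσ : 0 < stdDev S f θ) : 0 < opNorm S := by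
  have h := (Real.sqrt_pos.1 hσ).trans_le (quad_le S (gradient f θ))
  exact pos_of_mul_pos_left h (sq_nonneg _)

/-- `gradient` takes the value zero at points of nondifferentiability, which would make the standard
deviation vanish. -/
lemma differentiableAt_of_stdDev_pos (hσ : 0 < stdDev S f θ) : DifferentiableAt ℝ f θ := by
  by_contra h
  have : gradient f θ = 0 := by rw [gradient, fderiv_zero_of_not_differentiableAt h, map_zero]
  rw [stdDev, this] at hσ
  simp [quad] at hσ

lemma memLp_estimator_sub (hS : S.PosSemidef) (hs : 0 ≤ s) (hu : IsGivenBy u f)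
    (hb : besovNorm R s u < ⊤) (hσ : 0 < stdDev S f θ) :
    MemLp (fun x => estimator R S u x - f θ) 2 (multivariateGaussian θ S) ∧
      ∀ x, |estimator R S u x - f θ| ≤ 257 * (besovNorm R s u).toReal := by
  have h0 := opNorm_pos_of_stdDev_pos hσ
  obtain ⟨hC, hH, -⟩ := partialSum_bounds hu hs hb
  have hg := abs_estimator_le hS h0 (h0.trans_le (opNorm_le_trace hS)) hu hC hH
  have hgc := (estimator_contDiff (R := R) (S := S) hu hC).continuous
  have h : ∀ x, |estimator R S u x - f θ| ≤ 257 * (besovNorm R s u).toReal := fun x => by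
    refine (abs_sub _ _).trans ?_
    linarith [hg x, hC θ]
  exact ⟨MemLp.of_bound (Continuous.aestronglyMeasurable (by fun_prop)) _
    (Filter.Eventually.of_forall h), h⟩

/-- Here `κD` is the relative size of the gradient error and `β` the relative bias; both conclusions
combine the gradient defect with the bias. -/
lemma estimator_error_le (hS : S.PosDef) (hs : 0 ≤ s) (hu : IsGivenBy u f)
    (hb : besovNorm R s u < ⊤) (hσ : 0 < stdDev S f θ)
    (hM : hessianNorm (estimator R S u) ≠ ⊤) (hR : remainderNorm R S u f ≠ ⊤) {κD β : ℝ}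
    (hκD : κD = √(opNorm S) / stdDev S f θ *
      max (√S.trace * (hessianNorm (estimator R S u)).toReal) (remainderNorm R S u f).toReal)
    (hβ : β = S.trace ^ (s / 2) * (besovNorm R s u).toReal / stdDev S f θ) :
    (∀ t, |(multivariateGaussian θ S).real {x | (estimator R S u x - f θ) / stdDev S f θ ≤ t} -
      (gaussianReal 0 1).real (Set.Iic t)| ≤ 48 * κD + β) ∧
    ∫ x, (estimator R S u x - f θ) ^ 2 ∂(multivariateGaussian θ S) ≤
      (stdDev S f θ * (1 + 5 * κD + β)) ^ 2 := by
  have h0 := opNorm_pos_of_stdDev_pos hσ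
  have hT := h0.trans_le (opNorm_le_trace hS.posSemidef)
  have hd := differentiableAt_of_stdDev_pos hσ
  obtain ⟨hC, hH, -⟩ := partialSum_bounds hu hs hb
  have hg := abs_estimator_le hS.posSemidef h0 hT hu hC hH
  have hgd := estimator_contDiff (R := R) (S := S) hu hC
  obtain ⟨C', hC'⟩ := exists_fderiv_estimator_le (R := R) (S := S) hu hC
  have hLip := norm_fderiv_sub_le_of_hessianNorm hgd hM
  have hmean := norm_integral_fderiv_sub_le (R := R) hS.posSemidef hu hC hg hd hR
  have hbias := abs_sub_truncation_le (R := R) hs h0 hT hu hb θ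
  have hσ2 := stdDev_sq (f := f) (θ := θ) hS.posSemidef
  set γ := multivariateGaussian 0 S with hγ
  set σ := stdDev S f θ with hσdef
  set M := (hessianNorm (estimator R S u)).toReal
  set r := (remainderNorm R S u f).toReal
  set D := max (√S.trace * M) r with hD
  have hD0 : 0 ≤ D := ENNReal.toReal_nonneg.trans (le_max_right _ _)
  have hκ0 : 0 ≤ κD := by rw [hκD]; positivity
  have hβ0 : 0 ≤ β := by rw [hβ]; positivity
  set G : E d → ℝ := fun ξ => estimator R S u (θ + ξ) with hG
  have hGd : ContDiff ℝ 1 G := (hgd.of_le (by simp)).comp (contDiff_const.add contDiff_id)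
  have hfd : ∀ ξ, fderiv ℝ G ξ = fderiv ℝ (estimator R S u) (θ + ξ) := fun ξ =>
    fderiv_comp_add_left θ
  have hGint : ∫ ξ, G ξ ∂γ = truncation R S u θ := integral_estimator_shift hS.posSemidef hu hC θ
  have hsq := integral_norm_fderiv_sub_sq_le hS.posSemidef hGd (CG' := C')
    (fun ξ => by rw [hfd]; exact hC' _) (M := M) (r := r) ENNReal.toReal_nonneg
    (fun x y => by rw [hfd, hfd]; simpa using hLip (θ + x) (θ + y)) (fderiv ℝ f θ)
    (by simp only [hfd]; exact hmean)
  simp only [← norm_gradient_sub_gradient G f _ θ] at hsq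
  have hdef := gradientDefect_le hS.posSemidef hGd (CG' := C') (fun ξ => by rw [hfd]; exact hC' _)
    (gradient f θ) (η := 3 * D) (by positivity) hsq
  -- With `η = 3D` the defect is `6 σ ‖Σ‖^{1/2} D + 9 ‖Σ‖ D²`, and `‖Σ‖^{1/2} D = σ κD`.
  have hdef' : ∀ α, gradientDefect S G (σ ^ 2) α ≤ σ ^ 2 * (6 * κD + 9 * κD ^ 2) := fun α => by
    rw [hσ2]
    refine (hdef α).trans_eq ?_
    have e1 : κD * σ = √(opNorm S) * D := by rw [hκD]; field_simp
    have e2 : √(opNorm S) ^ 2 = opNorm S := Real.sq_sqrt h0.le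
    rw [← hσ2, Real.sqrt_sq hσ.le]
    linear_combination (-6 * σ - 9 * (√(opNorm S) * D + κD * σ)) * e1 - 9 * D ^ 2 * e2
  have hbσ : |∫ ξ, G ξ ∂γ - f θ| ≤ σ * β := by
    rw [hGint, abs_sub_comm, hβ]
    refine hbias.trans_eq ?_
    field_simp
  have hmap : Measurable fun ξ : E d => θ + ξ := by fun_prop
  have hGc := hGd.continuous
  constructor
  · intro t
    have hset : MeasurableSet {x | (estimator R S u x - f θ) / σ ≤ t} := by
      have := hgd.continuous
      exact measurableSet_le (Continuous.measurable (by fun_prop)) measurable_const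
    have h1 := abs_measureReal_le_sub_gaussian hS hGd (fun ξ => hg (θ + ξ)) (CG' := C')
      (fun ξ => by rw [hfd]; exact hC' _) hσ hdef' (f θ) t
    rw [multivariateGaussian_eq_map, map_measureReal_apply hmap hset]
    change |γ.real {ξ | (G ξ - f θ) / σ ≤ t} - _| ≤ _
    have h2 : |∫ ξ, G ξ ∂γ - f θ| / σ ≤ β := by
      rw [div_le_iff₀ hσ]; linarith
    -- For `κD ≤ 1` the square is absorbed, giving `15π < 48`; for larger `κD` the claim is trivial,
    -- as a difference of probabilities is at most 1.
    rcases le_total κD 1 with h3 | h3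
    · have h4 : Real.pi * (6 * κD + 9 * κD ^ 2) ≤ 48 * κD := by
        have h5 : 6 * κD + 9 * κD ^ 2 ≤ 15 * κD := by nlinarith
        have := Real.pi_lt_d2
        calc Real.pi * (6 * κD + 9 * κD ^ 2) ≤ 3.15 * (15 * κD) := by gcongr
          _ ≤ 48 * κD := by linarith
      linarith
    · have h4 : |γ.real {ξ | (G ξ - f θ) / σ ≤ t} - (gaussianReal 0 1).real (Set.Iic t)| ≤ 1 :=
        abs_sub_le_of_nonneg_of_le measureReal_nonneg measureReal_le_one measureReal_nonneg
          measureReal_le_one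
      linarith
  · have hvar := variance_le_of_gradientDefect hS hGd (fun ξ => hg (θ + ξ)) (CG' := C')
      (fun ξ => by rw [hfd]; exact hC' _) hdef'
    rw [multivariateGaussian_eq_map, integral_map hmap.aemeasurable
      (by have := hgd.continuous; exact Continuous.aestronglyMeasurable (by fun_prop))]
    change ∫ ξ, (G ξ - f θ) ^ 2 ∂γ ≤ _
    have hGm : MemLp G 2 γ := MemLp.of_bound hGc.aestronglyMeasurable _
      (Filter.Eventually.of_forall fun ξ => hg (θ + ξ))
    set μ := ∫ ξ, G ξ ∂γ with hμ
    have hG1 : MemLp (fun ξ => G ξ - μ) 2 γ := hGm.sub (memLp_const _)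
    have e : ∫ ξ, (G ξ - f θ) ^ 2 ∂γ = ∫ ξ, (G ξ - μ) ^ 2 ∂γ + (μ - f θ) ^ 2 := by
      have e1 : ∀ ξ, (G ξ - f θ) ^ 2 =
          (G ξ - μ) ^ 2 + (2 * (μ - f θ) * (G ξ - μ) + (μ - f θ) ^ 2) := fun ξ => by ring
      have i1 : Integrable (fun ξ => 2 * (μ - f θ) * (G ξ - μ)) γ :=
        (hG1.integrable one_le_two).const_mul _
      have i2 : Integrable (fun ξ => 2 * (μ - f θ) * (G ξ - μ) + (μ - f θ) ^ 2) γ :=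
        i1.add (integrable_const _)
      simp only [e1]
      rw [integral_add hG1.integrable_sq i2,
        integral_add i1 (integrable_const _), integral_const_mul,
        integral_sub (hGm.integrable one_le_two) (integrable_const _)]
      simp [hμ]
    have h1 := (abs_le.1 hvar).2
    have h2 : (μ - f θ) ^ 2 ≤ (σ * β) ^ 2 := sq_le_sq' (abs_le.1 hbσ).1 (abs_le.1 hbσ).2
    have hpi := Real.pi_lt_d2
    have h3 : Real.pi / 2 * (σ ^ 2 * (6 * κD + 9 * κD ^ 2)) ≤
        3.15 / 2 * (σ ^ 2 * (6 * κD + 9 * κD ^ 2)) := by gcongr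
    -- Coefficientwise, `(3.15/2)·6 ≤ 2·5` and `(3.15/2)·9 ≤ 5²`.
    have h4 : σ ^ 2 + 3.15 / 2 * (σ ^ 2 * (6 * κD + 9 * κD ^ 2)) + (σ * β) ^ 2 ≤
        (σ * (1 + 5 * κD + β)) ^ 2 := by
      have h5 : 1 + 3.15 / 2 * (6 * κD + 9 * κD ^ 2) + β ^ 2 ≤ (1 + 5 * κD + β) ^ 2 := by
        nlinarith [mul_nonneg hκ0 hβ0, sq_nonneg κD]
      have := mul_le_mul_of_nonneg_left h5 (sq_nonneg σ)
      linarith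
    rw [e]
    linarith

lemma le_toReal_errorTerm (h0 : 0 < opNorm S) (hE : errorTerm R s S u f ≠ ⊤) :
    S.trace ^ (s / 2) / √(opNorm S) ≤ (errorTerm R s S u f).toReal := by
  refine ENNReal.ofReal_le_iff_le_toReal hE |>.1 ?_
  rw [errorTerm, opNorm_mul_effRank h0, Real.sqrt_eq_rpow]
  exact le_max_left _ _

lemma gradientTerm_le_errorTerm (h0 : 0 < opNorm S) (hT : 0 < S.trace)
    (hlog : 1 ≤ Real.log (opNorm S)⁻¹) (hE : errorTerm R s S u f ≠ ⊤) :
    hessianNorm (estimator R S u) ≠ ⊤ ∧ remainderNorm R S u f ≠ ⊤ ∧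
      max (√S.trace * (hessianNorm (estimator R S u)).toReal) (remainderNorm R S u f).toReal ≤
        (errorTerm R s S u f).toReal := by
  have h1 : max (ENNReal.ofReal √S.trace * hessianNorm (estimator R S u))
      (remainderNorm R S u f) ≤ errorTerm R s S u f := by
    rw [errorTerm, opNorm_mul_effRank h0, Real.sqrt_eq_rpow S.trace]
    refine le_max_of_le_right (le_max_of_le_right (le_mul_of_one_le_right' ?_))
    rw [ENNReal.one_le_ofReal, Real.one_le_sqrt]
    exact hlog
  have h2 := (le_max_left _ _).trans h1
  have h3 := (le_max_right _ _).trans h1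
  have hM : hessianNorm (estimator R S u) ≠ ⊤ := fun h => by
    rw [h, ENNReal.mul_top (by simpa using hT), top_le_iff] at h2
    exact hE h2
  refine ⟨hM, fun h => hE (top_le_iff.1 (h ▸ h3)), max_le ?_ (ENNReal.toReal_mono hE h3)⟩
  have := ENNReal.toReal_mono hE h2
  rwa [ENNReal.toReal_mul, ENNReal.toReal_ofReal (Real.sqrt_nonneg _)] at this

end Error

lemma kolmogorovToNormal_le {X : Type*} [MeasurableSpace X] {P : Measure X} {Y : X → ℝ} {δ : ℝ}
    (h : ∀ t, |P.real {y | Y y ≤ t} - (gaussianReal 0 1).real (Set.Iic t)| ≤ δ) :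
    kolmogorovToNormal P Y ≤ ENNReal.ofReal δ :=
  iSup_le fun t => ENNReal.ofReal_le_ofReal (h t)

lemma kolmogorovToNormal_le_one {X : Type*} [MeasurableSpace X] {P : Measure X}
    [IsProbabilityMeasure P] {Y : X → ℝ} : kolmogorovToNormal P Y ≤ 1 := by
  rw [← ENNReal.ofReal_one]
  exact kolmogorovToNormal_le fun t => abs_sub_le_of_nonneg_of_le measureReal_nonneg
    measureReal_le_one measureReal_nonneg measureReal_le_one

end GaussianShift

end

/-! ### The two bounds, with constants. -/

open GaussianShift in
theorem theorem8p1 (s τ m : ℝ) (hs : 1 < s) (hτ : 0 < τ) (hm : 0 < m) :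
    ∃ C₁ C₂ : ℝ≥0, ∀ (d : ℕ) (R : GaussianShift.DyadicResolution d)
      (S : Matrix (Fin d) (Fin d) ℝ) (u : 𝓢'(GaussianShift.E d, ℂ))
      (f : GaussianShift.E d → ℝ) (θ : GaussianShift.E d),
      S.PosDef → GaussianShift.opNorm S < 1 →
      GaussianShift.IsGivenBy u f →
      GaussianShift.besovNorm R s u < ⊤ →
      ENNReal.ofReal m ≤ GaussianShift.besovNorm R s u →
      0 < GaussianShift.stdDev S f θ →
      GaussianShift.KQuantity R s S u f θ ≤ τ →
      GaussianShift.kolmogorovToNormal (multivariateGaussian θ S)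
          (fun x => (GaussianShift.estimator R S u x - f θ) / GaussianShift.stdDev S f θ)
        ≤ C₁ * GaussianShift.errorTerm R s S u f ∧
      eLpNorm (fun x => GaussianShift.estimator R S u x - f θ) 2 (multivariateGaussian θ S)
          / ENNReal.ofReal (GaussianShift.stdDev S f θ)
        ≤ 1 + C₂ * GaussianShift.errorTerm R s S u f := by
  -- A lower bound for the error term when `‖Σ‖ ≥ 1/e`.
  set q : ℝ := Real.exp (-((s - 1) / 2)) with hq
  have hq0 : 0 < q := Real.exp_pos _
  -- The first two terms serve small noise, the last one noise bounded below, where the error term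
  -- is at least `q`.
  set a : ℝ := 48 * (τ / m) + τ + 1 + (1 + 257 * τ * Real.exp (1 / 2)) / q with ha
  have ha0 : 0 < a := by positivity
  refine ⟨a.toNNReal, a.toNNReal, fun d R S u f θ hS _ hu hb hmB hσ hK => ?_⟩
  have h0 := opNorm_pos_of_stdDev_pos hσ
  have hLT := opNorm_le_trace hS.posSemidef
  have hT := h0.trans_le hLT
  have hs0 : 0 ≤ s := by linarith
  have hac : ((a.toNNReal : ℝ≥0) : ℝ≥0∞) = ENNReal.ofReal a := rfl
  rw [hac]
  -- An infinite error term makes both bounds trivial, as `a` is positive.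
  rcases eq_or_ne (errorTerm R s S u f) ⊤ with hE | hE
  · rw [hE, ENNReal.mul_top (by simpa using ha0)]
    simp
  have hmB' : m ≤ (besovNorm R s u).toReal := (ENNReal.ofReal_le_iff_le_toReal hb.ne).1 hmB
  have he1 := le_toReal_errorTerm (R := R) (s := s) (u := u) (f := f) h0 hE
  set ε := (errorTerm R s S u f).toReal with hε
  have hEε : errorTerm R s S u f = ENNReal.ofReal ε := (ENNReal.ofReal_toReal hE).symm
  have hε0 : 0 ≤ ε := ENNReal.toReal_nonneg
  rw [hEε, ← ENNReal.ofReal_mul ha0.le]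
  set B := (besovNorm R s u).toReal with hB
  set σ := stdDev S f θ with hσdef
  set ρ := √(opNorm S) with hρ
  have hρ0 : 0 < ρ := Real.sqrt_pos.2 h0
  have hK' : ρ * B ≤ τ * σ := by
    rw [KQuantity, ← Real.sqrt_eq_rpow, div_le_iff₀ hσ] at hK
    exact hK
  have hsqrt : ∀ A : ℝ, 0 ≤ A →
      ∫ x, (estimator R S u x - f θ) ^ 2 ∂(multivariateGaussian θ S) ≤ (σ * A) ^ 2 →
      eLpNorm (fun x => estimator R S u x - f θ) 2 (multivariateGaussian θ S) / ENNReal.ofReal σ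
        ≤ ENNReal.ofReal A := fun A hA h => by
    refine ENNReal.div_le_of_le_mul ?_
    rw [← ENNReal.ofReal_mul hA, mul_comm]
    exact eLpNorm_two_le (memLp_estimator_sub hS.posSemidef hs0 hu hb hσ).1
      (mul_nonneg hσ.le hA) h
  rw [← ENNReal.ofReal_one, ← ENNReal.ofReal_add zero_le_one (mul_nonneg ha0.le hε0)]
  have hcases : 48 * (τ / m) * ε + τ * ε ≤ a * ε ∧
      (1 + 257 * τ * Real.exp (1 / 2)) / q * ε ≤ a * ε := by
    rw [← add_mul]
    constructor <;> refine mul_le_mul_of_nonneg_right ?_ hε0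
    · have : 0 ≤ (1 + 257 * τ * Real.exp (1 / 2)) / q := by positivity
      linarith
    · have : 0 ≤ 48 * (τ / m) := by positivity
      linarith
  rcases le_or_gt 1 (Real.log (opNorm S)⁻¹) with hlog | hlog
  · obtain ⟨hM, hR, hD⟩ := gradientTerm_le_errorTerm h0 hT hlog hE
    obtain ⟨h1, h2⟩ := estimator_error_le hS hs0 hu hb hσ hM hR rfl rfl
    -- From `ρ B ≤ τ σ` and `m ≤ B`; this is where the lower bound on the Besov norm enters.
    have hκ : ρ / σ ≤ τ / m := by
      rw [div_le_div_iff₀ hσ hm]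
      exact (mul_le_mul_of_nonneg_left hmB' hρ0.le).trans hK'
    have hκD := mul_le_mul hκ hD (le_max_of_le_right ENNReal.toReal_nonneg)
      (div_nonneg hτ.le hm.le)
    have hβ : S.trace ^ (s / 2) * B / σ ≤ τ * ε := by
      refine le_trans ?_ (mul_le_mul_of_nonneg_left he1 hτ.le)
      rw [← mul_div_assoc, div_le_div_iff₀ hσ hρ0]
      have := mul_le_mul_of_nonneg_left hK' (Real.rpow_nonneg hT.le (s / 2))
      linarith
    set κD := ρ / σ *
      max (√S.trace * (hessianNorm (estimator R S u)).toReal) (remainderNorm R S u f).toReal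
    have hκD0 : 0 ≤ κD := mul_nonneg (by positivity) (le_max_of_le_right ENNReal.toReal_nonneg)
    have hβ0 : 0 ≤ S.trace ^ (s / 2) * B / σ := by positivity
    constructor
    · refine (kolmogorovToNormal_le h1).trans (ENNReal.ofReal_le_ofReal ?_)
      linarith [hcases.1]
    · refine (hsqrt _ (by positivity) h2).trans (ENNReal.ofReal_le_ofReal ?_)
      have := mul_nonneg (div_nonneg hτ.le hm.le) hε0
      linarith [hcases.1]
  · have hL : Real.exp (-1) ≤ opNorm S := by
      rw [Real.log_inv] at hlog
      rw [← Real.le_log_iff_exp_le h0]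
      linarith
    -- Since `tr Σ ≥ ‖Σ‖`, the first entry of the error term is at least `‖Σ‖^{(s-1)/2}`; here `s >
    -- 1` keeps the exponent nonnegative.
    have hqε : q ≤ ε := by
      refine le_trans ?_ he1
      rw [le_div_iff₀ hρ0, hρ, Real.sqrt_eq_rpow]
      calc q * opNorm S ^ (1 / 2 : ℝ)
          ≤ opNorm S ^ ((s - 1) / 2) * opNorm S ^ (1 / 2 : ℝ) := by
            gcongr
            refine le_trans (le_of_eq ?_) (Real.rpow_le_rpow (Real.exp_pos _).le hL (by linarith))
            rw [← Real.exp_mul, hq]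
            ring_nf
        _ = opNorm S ^ (s / 2) := by rw [← Real.rpow_add h0]; ring_nf
        _ ≤ S.trace ^ (s / 2) := Real.rpow_le_rpow h0.le hLT (by linarith)
    have hq1 : 1 + 257 * τ * Real.exp (1 / 2) ≤ a * ε := by
      refine le_trans ?_ hcases.2
      rw [div_mul_eq_mul_div, le_div_iff₀ hq0]
      exact mul_le_mul_of_nonneg_left hqε (by positivity)
    constructor
    · refine kolmogorovToNormal_le_one.trans ?_
      rw [ENNReal.one_le_ofReal]
      have : 0 ≤ 257 * τ * Real.exp (1 / 2) := by positivity
      linarith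
    · have hρe : 1 ≤ Real.exp (1 / 2) * ρ := by
        have h1 : Real.exp (-(1 / 2)) ≤ ρ := by
          refine Real.le_sqrt_of_sq_le (le_trans (le_of_eq ?_) hL)
          rw [← Real.exp_nat_mul]
          norm_num
        calc 1 = Real.exp (1 / 2) * Real.exp (-(1 / 2)) := by rw [← Real.exp_add]; simp
          _ ≤ _ := by gcongr
      -- With `‖Σ‖` bounded below, `K ≤ τ` bounds the Besov norm by a multiple of `σ`, so the sup
      -- bound `257 B` already controls the risk.
      have hBσ : B ≤ σ * (τ * Real.exp (1 / 2)) := by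
        have hB0 : 0 ≤ B := ENNReal.toReal_nonneg
        calc B ≤ B * (Real.exp (1 / 2) * ρ) := le_mul_of_one_le_right hB0 hρe
          _ = Real.exp (1 / 2) * (ρ * B) := by ring
          _ ≤ Real.exp (1 / 2) * (τ * σ) := by gcongr
          _ = _ := by ring
      have hpt := (memLp_estimator_sub hS.posSemidef hs0 hu hb hσ).2
      refine (hsqrt (257 * τ * Real.exp (1 / 2)) (by positivity) ?_).trans
        (ENNReal.ofReal_le_ofReal (by linarith))
      calc ∫ x, (estimator R S u x - f θ) ^ 2 ∂(multivariateGaussian θ S)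
          ≤ ∫ _, (σ * (257 * τ * Real.exp (1 / 2))) ^ 2 ∂(multivariateGaussian θ S) := by
            refine integral_mono_of_nonneg (Filter.Eventually.of_forall fun _ => sq_nonneg _)
              (integrable_const _) (Filter.Eventually.of_forall fun x => ?_)
            refine sq_le_sq.2 ((hpt x).trans ((?_ : _ ≤ _).trans (le_abs_self _)))
            linarith
        _ = _ := by simp
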